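/- Let $n\le t$. For a set $S\subseteq\mathbb{R}^N$ let $I(S)$ be the ideal of real polynomials vanishing on $S$. A point $x\in S$ is \emph{regular} if there are $P_1,\dots,P_k\in I(S)$ ($k\ge 0$) with linearly independent gradients at $x$ whose common zero set coincides with $S$ in a Euclidean neighbourhood of $x$; $S^{\mathrm{reg}}$ is the set of regular points (the dimension of $S$ may differ from point to point), and $T_xS=\{a\in\mathbb{R}^N:\nabla P(x)^\top a=0\text{ for all }P\in I(S)\}$. The \emph{ED critical points} of $y\in\mathbb{R}^N$ on $S$ are the $x\in S^{\mathrm{reg}}$ with $(x-y)^\top a=0$ for all $a\in T_xS$. Sets of matrices $M\subseteq\mathbb{C}^{n\times t}$ are viewed in $\mathbb{R}^{2nt}$ through the real and imaginary parts of the entries; $M^{\mathrm{reg}}$ and $T_XM$ are formed there, and the \emph{HD critical points} of $Y\in\mathbb{C}^{n\times t}$ on $M$ are the $X\in M^{\mathrm{reg}}$ with $\mathrm{Re}\,\mathrm{Tr}((Y-X)A^*)=0$ for all $A\in T_XM$. Let $\mathbb{R}\mathrm{EDdeg}(S;y)$ be the number of ED critical points of $y$ on $S$, and let $\Delta_S$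 be the complement of the open set of those $y$ near which this number is finite and constant; thus it is constant on each chamber, that is, on each connected component of the complement of $\Delta_S$. Put $\mathbb{R}\mathrm{EDdeg}(S)=\{\mathbb{R}\mathrm{EDdeg}(S;y):y\notin\Delta_S\}\subseteq\mathbb{N}$. Define $\mathrm{HDdeg}(M;Y)$, $\Delta_M$ and $\mathrm{HDdeg}(M)\subseteq\mathbb{N}$ in the same way from the HD critical points. \textbf{Theorem.} Let $S\subseteq\mathbb{R}^n$ be a real algebraic set that is invariant under all signed permutations of the coordinates, and let $$M=\sigma^{-1}(S)=\{U\,\mathrm{diag}(x)\,V^*:x\in S,\ U\in U(n),\ V\in U(t)\}\subseteq\mathbb{C}^{n\times t}.$$ Then $M$ is a real algebraic set, and there is a semialgebraic open dense set $\Omega\subseteq\mathbb{C}^{n\times t}$ such that every $Y\in\Omega$ lies outside $\Delta_M$ and can be written as $Y=U\,\mathrm{diag}(y)\,V^*$ with $U\in U(n)$, $V\in U(t)$, $y\in\mathbb{R}^n$, and for every such decomposition of $Y$: (1) the set of HD critical points of $Y$ on $M$ is $\{U\,\mathrm{diag}(x)\,V^*: x\text{ is an ED critical point of }y\text{ on }S\}$;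 (2) $y\notin\Delta_S$ and $\mathrm{HDdeg}(M;Y)=\mathbb{R}\mathrm{EDdeg}(S;y)$. In particular $\mathrm{HDdeg}(M)=\mathbb{R}\mathrm{EDdeg}(S)$ as subsets of $\mathbb{N}$. -/

import Mathlib

open scoped Matrix Topology

namespace HDDegree

noncomputable section

/-! ### Real algebraic and semialgebraic sets in `ℝ^ι`, regular points, tangent spaces -/

/-- A real algebraic set in `ℝ^ι`: the real zero locus of an ideal of real polynomials. -/
def IsRealAlgebraic {ι : Type} (S : Set (ι → ℝ)) : Prop :=
  ∃ I : Ideal (MvPolynomial ι ℝ), S = MvPolynomial.zeroLocus ℝ I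

/-- Semialgebraic sets: the Boolean algebra of subsets of `ℝ^ι` generated by the sets `{p > 0}`
with `p` a real polynomial. -/
inductive IsSemialgebraic {ι : Type} : Set (ι → ℝ) → Prop
  | pos (p : MvPolynomial ι ℝ) : IsSemialgebraic {x | 0 < MvPolynomial.aeval x p}
  | compl {A : Set (ι → ℝ)} : IsSemialgebraic A → IsSemialgebraic Aᶜ
  | inter {A B : Set (ι → ℝ)} :
      IsSemialgebraic A → IsSemialgebraic B → IsSemialgebraic (A ∩ B)

/-- The gradient of a polynomial `p` at the point `x`. -/
def grad {ι : Type} (p : MvPolynomial ι ℝ) (x : ι → ℝ) : ι → ℝ :=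
  fun i => MvPolynomial.aeval x (MvPolynomial.pderiv i p)

/-- The tangent space `T_x S`: the common kernel of the differentials at `x` of all polynomials
that vanish on `S`. -/
def tangentSpace {ι : Type} [Fintype ι] (S : Set (ι → ℝ)) (x : ι → ℝ) : Submodule ℝ (ι → ℝ) where
  carrier := {a | ∀ p ∈ MvPolynomial.vanishingIdeal ℝ S, grad p x ⬝ᵥ a = 0}
  zero_mem' := by
    intro p _
    simp
  add_mem' := by
    intro a b ha hb p hp
    rw [dotProduct_add, ha p hp, hb p hp, add_zero]
  smul_mem' := by
    intro c a ha p hp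
    rw [dotProduct_smul, ha p hp, smul_zero]

/-- The regular locus `S^reg` of a real algebraic set `S` (Jacobian criterion): those `x ∈ S` for
which there are polynomials `P₁, …, P_k` vanishing on `S`, with linearly independent gradients
at `x`, whose common zero set coincides with `S` in a neighbourhood of `x`.  Then `S` is near `x` a
submanifold of codimension `k` with tangent space `tangentSpace S x` at `x`.  The local
dimension of `S` may vary with `x`. -/
def regularLocus {ι : Type} [Fintype ι] (S : Set (ι → ℝ)) : Set (ι → ℝ) :=
  {x | x ∈ S ∧ ∃ (k : ℕ) (P : Fin k → MvPolynomial ι ℝ),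
    (∀ j, P j ∈ MvPolynomial.vanishingIdeal ℝ S) ∧
    LinearIndependent ℝ (fun j => grad (P j) x) ∧
    ∃ O : Set (ι → ℝ), IsOpen O ∧ x ∈ O ∧
      ∀ z ∈ O, (∀ j, MvPolynomial.aeval z (P j) = 0) → z ∈ S}

/-! ### Critical point counts, discriminants and chambers -/

/-- The discriminant of a counting function `N`: the complement of the (open) set on which `N` is
finite and locally constant.  The chambers are the connected components of its complement. -/
def countDiscriminant {E : Type} [TopologicalSpace E] (N : E → ℕ∞) : Set E :=
  {y | ¬ ∃ k : ℕ, ∀ᶠ z in 𝓝 y, N z = k}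

/-- The count is constant on the chamber of any point off the discriminant. -/
theorem count_eq_of_mem_chamber {E : Type} [TopologicalSpace E] (N : E → ℕ∞) {y z : E}
    (hy : y ∉ countDiscriminant N) (hz : z ∈ connectedComponentIn (countDiscriminant N)ᶜ y) :
    N z = N y := by
  have key : ∀ w ∈ (countDiscriminant N)ᶜ, ∃ k : ℕ, ∀ᶠ v in 𝓝 w, N v = k := by
    intro w hw
    simpa [countDiscriminant] using hw
  have hcont : ContinuousOn (fun w => (N w).toNat) (countDiscriminant N)ᶜ := by
    intro w hw
    obtain ⟨k, hk⟩ := key w hw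
    have h1 : (fun v => (N v).toNat) =ᶠ[𝓝 w] fun _ => k := by
      filter_upwards [hk] with v hv
      simp [hv]
    exact (continuousAt_const.congr h1.symm).continuousWithinAt
  have hsub := connectedComponentIn_subset (countDiscriminant N)ᶜ y
  have hy' : y ∈ connectedComponentIn (countDiscriminant N)ᶜ y := mem_connectedComponentIn hy
  have heq := isPreconnected_connectedComponentIn.constant (hcont.mono hsub) hz hy'
  obtain ⟨k, hk⟩ := key z (hsub hz)
  obtain ⟨l, hl⟩ := key y hy
  have h1 := hk.self_of_nhds
  have h2 := hl.self_of_nhds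
  simp only [h1, h2, ENat.toNat_natCast] at heq
  rw [h1, h2, heq]

/-- The ED critical points of `y` on `S`: the regular points `x` of `S` with `x - y ⊥ T_x S`. -/
def edCritical {ι : Type} [Fintype ι] (S : Set (ι → ℝ)) (y : ι → ℝ) : Set (ι → ℝ) :=
  {x | x ∈ regularLocus S ∧ ∀ a ∈ tangentSpace S x, (x - y) ⬝ᵥ a = 0}

/-- The ED discriminant of `S`. -/
def edDiscriminant {ι : Type} [Fintype ι] (S : Set (ι → ℝ)) : Set (ι → ℝ) :=
  countDiscriminant fun y => (edCritical S y).encard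

/-- `ℝEDdeg(S; y)`: the number of real ED critical points of `y` on `S`. -/
def realEDdegAt {ι : Type} [Fintype ι] (S : Set (ι → ℝ)) (y : ι → ℝ) : ℕ :=
  (edCritical S y).ncard

/-- `ℝEDdeg(S)`: the set of all values `ℝEDdeg(S; y)` with `y` off the discriminant. -/
def realEDdeg {ι : Type} [Fintype ι] (S : Set (ι → ℝ)) : Set ℕ :=
  realEDdegAt S '' (edDiscriminant S)ᶜ

/-! ### Complex matrices as a real vector space -/

/-- Index set of the real coordinates of a complex `n × t` matrix: real parts, imaginary parts. -/
abbrev RealIdx (n t : ℕ) : Type := (Fin n × Fin t) ⊕ (Fin n × Fin t)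

/-- The identification of `ℂ^{n×t}` with `ℝ^{2nt}` by real and imaginary parts of the entries. -/
def realCoords (n t : ℕ) : Matrix (Fin n) (Fin t) ℂ ≃ₗ[ℝ] (RealIdx n t → ℝ) where
  toFun A := Sum.elim (fun p => (A p.1 p.2).re) (fun p => (A p.1 p.2).im)
  invFun v := Matrix.of fun i j => ⟨v (Sum.inl (i, j)), v (Sum.inr (i, j))⟩
  map_add' A B := by
    ext (p | p) <;> simp
  map_smul' c A := by
    ext (p | p) <;> simp
  left_inv A := by
    ext i j
    simp
  right_inv v := by
    ext (p | p) <;> simp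

/-- The regular locus `M^reg` of a set of complex matrices viewed in `ℝ^{2nt}`. -/
def matRegularLocus {n t : ℕ} (M : Set (Matrix (Fin n) (Fin t) ℂ)) :
    Set (Matrix (Fin n) (Fin t) ℂ) :=
  realCoords n t ⁻¹' regularLocus (realCoords n t '' M)

/-- The (real) tangent space `T_X M`. -/
def matTangentSpace {n t : ℕ} (M : Set (Matrix (Fin n) (Fin t) ℂ))
    (X : Matrix (Fin n) (Fin t) ℂ) : Submodule ℝ (Matrix (Fin n) (Fin t) ℂ) :=
  (tangentSpace (realCoords n t '' M) (realCoords n t X)).comap (realCoords n t).toLinearMap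

/-- The HD critical points of `Y` on `M`: the regular points `X` of `M` such that
`Re Tr((Y - X) A^*) = 0` for all `A ∈ T_X M`. -/
def hdCritical {n t : ℕ} (M : Set (Matrix (Fin n) (Fin t) ℂ))
    (Y : Matrix (Fin n) (Fin t) ℂ) : Set (Matrix (Fin n) (Fin t) ℂ) :=
  {X | X ∈ matRegularLocus M ∧
    ∀ A ∈ matTangentSpace M X, (Matrix.trace ((Y - X) * Aᴴ)).re = 0}

/-- The discriminant `Δ_M` of `M` for the Hermitian distance. -/
def hdDiscriminant {n t : ℕ} (M : Set (Matrix (Fin n) (Fin t) ℂ)) :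
    Set (Matrix (Fin n) (Fin t) ℂ) :=
  countDiscriminant fun Y => (hdCritical M Y).encard

/-- `HDdeg(M; Y)`: the number of HD critical points of `Y` on `M`. -/
def hdDegAt {n t : ℕ} (M : Set (Matrix (Fin n) (Fin t) ℂ)) (Y : Matrix (Fin n) (Fin t) ℂ) : ℕ :=
  (hdCritical M Y).ncard

/-- `HDdeg(M)`: the set of all values `HDdeg(M; Y)` with `Y` off the discriminant. -/
def hdDeg {n t : ℕ} (M : Set (Matrix (Fin n) (Fin t) ℂ)) : Set ℕ :=
  hdDegAt M '' (hdDiscriminant M)ᶜ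

/-! ### Signed permutations and unitarily invariant sets -/

/-- The signed permutation of `ℝ^n` with signs `ε` and permutation `π`. -/
def signedPerm {n : ℕ} (ε : Fin n → ℤˣ) (π : Equiv.Perm (Fin n)) (x : Fin n → ℝ) : Fin n → ℝ :=
  fun i => ((ε i : ℤ) : ℝ) * x (π i)

/-- `S` is absolutely symmetric: invariant under all signed permutations of the coordinates. -/
def IsAbsolutelySymmetric {n : ℕ} (S : Set (Fin n → ℝ)) : Prop :=
  ∀ (ε : Fin n → ℤˣ) (π : Equiv.Perm (Fin n)), signedPerm ε π '' S = S

/-- The rectangular diagonal matrix `diag(x) ∈ ℂ^{n×t}`. -/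
def rectDiag {n : ℕ} (t : ℕ) (x : Fin n → ℝ) : Matrix (Fin n) (Fin t) ℂ :=
  Matrix.of fun i j => if (i : ℕ) = (j : ℕ) then (x i : ℂ) else 0

/-- `σ⁻¹(S) = {U diag(x) V^* : x ∈ S, U ∈ U(n), V ∈ U(t)}`. -/
def sigmaInv {n : ℕ} (t : ℕ) (S : Set (Fin n → ℝ)) : Set (Matrix (Fin n) (Fin t) ℂ) :=
  {A | ∃ x ∈ S, ∃ U ∈ Matrix.unitaryGroup (Fin n) ℂ, ∃ V ∈ Matrix.unitaryGroup (Fin t) ℂ,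
    A = U * rectDiag t x * Vᴴ}

end

end HDDegree

/-!
Write `M = σ⁻¹(S)`. The signed permutations act on `ℝ^n` by reflections in the hyperplanes `x_i = 0`
and `x_i = ±x_j`; two singular value decompositions of a matrix differ by a signed permutation of
the diagonal. Polynomials invariant under this group are polynomials in the elementary symmetric
functions of the squares, hence are restrictions to diagonal matrices of polynomials in the
coefficients of the characteristic polynomial of `A A^*` (`exists_lift`). This makes `M` real
algebraic, and turns hypersurfaces in `ℝ^n` into unitarily invariant hypersurfaces of matrices.

*Generic data on `S`.* The endpoint map of the normal bundle of `S^reg` is a differentiable map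
between spaces of the same dimension. By Sard's theorem almost every `y` is a regular value, so has
countably many critical points. The same argument, applied to the endpoint map modified along a
hyperplane `H`, shows that for almost every `y` the set `S` is tangent to `H` at those critical
points that lie on `H`. The critical points form a semialgebraic family, so by the Tarski–Seidenberg
theorem countability is a uniform bound, the counting function is locally constant off a
hypersurface, and the exceptional null sets are contained in hypersurfaces. This is
`exists_generic_polynomial`; it is used with the hyperplanes `x_i = ±x_j`, where the case `i = j`
contains the coordinate hyperplanes. The Tarski–Seidenberg theorem is obtained from a maximal
algebra of functions with semialgebraic positivity sets: by induction on the degree, the real roots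
of a polynomial with coefficients in that algebra are finitely many functions in the algebra
(`IsMaximalTame.exists_coversRoots`).

*Critical points are diagonal.* The unitary orbit of `X` is contained in `M`, so its tangent vectors
are tangent to `M`. Hence, if `X` is critical for `Y = diag(y)`, both `Y X^*` and `X^* Y` are
Hermitian, and if the `y_i ^ 2` are distinct and nonzero, `X = diag(x)` with `x ∈ S` real
(`exists_diag_of_hermitian`).

*Regular points correspond.* If `diag(x)` is regular on `M`, every nearby point is a unique normal
translate of a nearby point of `M`; by uniqueness an isometry that preserves `M` and fixes the point
`diag(x)` fixes the foot of every diagonal matrix near it. Suitable diagonal unitaries together with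
complex conjugation have exactly the real diagonal matrices as common fixed points, so nearby points
of `ℝ^n` are normal translates of points of `S`, and `x` is regular
(`mem_regularLocus_of_rectDiag`).
Conversely let `x` be regular and `S` tangent at `x` to the reflection hyperplanes through `x`. The
tangent space of `M` at `diag(x)` is the sum of `diag(T_x S)` and the tangent space of the orbit: a
tangent vector `B` orthogonal to both has a singular value decomposition simultaneous with
`diag(x)`, say with diagonal `b`, and `b` is normal to `S`, hence the gradient at `x` of some
`p ∈ I(S)`. The lift of `∑ (p ∘ g)²` over the signed permutations `g` is nonnegative and vanishes
on `M`, so its derivative in the direction `B` belongs to the ideal of `M`, while its second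
derivative along `B` at `diag(x)` is positive unless `b = 0` (`eq_zero_of_mem_matTangentSpace`).
A chart of `S`, moved by unitary matrices, then exhausts the tangent space of `M`, which makes
`diag(x)` regular (`rectDiag_mem_matRegularLocus`).

So the critical points correspond for generic data (`hdCritical_eq`). Since the unitary groups are
compact, the set of matrices with a bad diagonal is closed, and the count on `M` is locally constant
wherever the count on `S` is (`notMem_hdDiscriminant`). Generic data are dense in every chamber on
both sides, which gives the equality of the degree sets.
-/

namespace HDDegree

/-! ### Semialgebraic sets: Boolean operations and polynomial preimages -/

namespace IsSemialgebraic

variable {ι κ : Type}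

lemma univ : IsSemialgebraic (Set.univ : Set (ι → ℝ)) := by
  convert IsSemialgebraic.pos (1 : MvPolynomial ι ℝ)
  simp

lemma empty : IsSemialgebraic (∅ : Set (ι → ℝ)) := by
  simpa using (univ (ι := ι)).compl

lemma union {A B : Set (ι → ℝ)} (hA : IsSemialgebraic A) (hB : IsSemialgebraic B) :
    IsSemialgebraic (A ∪ B) := by
  have := (hA.compl.inter hB.compl).compl
  rwa [Set.compl_inter, compl_compl, compl_compl] at this

lemma of_prop (p : Prop) : IsSemialgebraic {_x : ι → ℝ | p} := by
  by_cases h : p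
  · simpa [h] using univ
  · simpa [h] using empty

lemma and {P Q : (ι → ℝ) → Prop} (hP : IsSemialgebraic {x | P x})
    (hQ : IsSemialgebraic {x | Q x}) : IsSemialgebraic {x | P x ∧ Q x} := hP.inter hQ

lemma or {P Q : (ι → ℝ) → Prop} (hP : IsSemialgebraic {x | P x})
    (hQ : IsSemialgebraic {x | Q x}) : IsSemialgebraic {x | P x ∨ Q x} := hP.union hQ

lemma not {P : (ι → ℝ) → Prop} (hP : IsSemialgebraic {x | P x}) :
    IsSemialgebraic {x | ¬ P x} := hP.compl

lemma imp {P Q : (ι → ℝ) → Prop} (hP : IsSemialgebraic {x | P x})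
    (hQ : IsSemialgebraic {x | Q x}) : IsSemialgebraic {x | P x → Q x} := by
  simpa only [imp_iff_not_or] using hP.not.or hQ

lemma exists_mem {α : Type*} {s : Set α} (hs : s.Finite) {P : α → (ι → ℝ) → Prop}
    (h : ∀ a ∈ s, IsSemialgebraic {x | P a x}) : IsSemialgebraic {x | ∃ a ∈ s, P a x} := by
  induction s, hs using Set.Finite.induction_on with
  | empty => simpa using empty
  | @insert a s _ _ ih =>
    have := (h a (Set.mem_insert a s)).or (ih fun b hb => h b (Set.mem_insert_of_mem a hb))
    simpa [Set.mem_insert_iff, or_and_right, exists_or] using this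

lemma forall_mem {α : Type*} {s : Set α} (hs : s.Finite) {P : α → (ι → ℝ) → Prop}
    (h : ∀ a ∈ s, IsSemialgebraic {x | P a x}) : IsSemialgebraic {x | ∀ a ∈ s, P a x} := by
  have := (exists_mem hs (P := fun a x => ¬ P a x) fun a ha => (h a ha).not).not
  simpa using this

lemma exists_fin {α : Type*} [Finite α] {P : α → (ι → ℝ) → Prop}
    (h : ∀ a, IsSemialgebraic {x | P a x}) : IsSemialgebraic {x | ∃ a, P a x} := by
  simpa using exists_mem (Set.finite_univ (α := α)) fun a _ => h a

lemma forall_fin {α : Type*} [Finite α] {P : α → (ι → ℝ) → Prop}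
    (h : ∀ a, IsSemialgebraic {x | P a x}) : IsSemialgebraic {x | ∀ a, P a x} := by
  simpa using forall_mem (Set.finite_univ (α := α)) fun a _ => h a

end IsSemialgebraic

/-- The algebra of polynomial functions on `ℝ^ι`. -/
noncomputable def polyFun (ι : Type) : Subalgebra ℝ ((ι → ℝ) → ℝ) :=
  (MvPolynomial.aeval fun i (x : ι → ℝ) => x i).range

variable {ι κ : Type}

lemma aeval_coord_apply (p : MvPolynomial ι ℝ) (x : ι → ℝ) :
    (MvPolynomial.aeval (fun i (x : ι → ℝ) => x i) p : (ι → ℝ) → ℝ) x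
      = MvPolynomial.aeval x p := by
  induction p using MvPolynomial.induction_on with
  | C a => simp
  | add p q hp hq => simp [hp, hq]
  | mul_X p i hp => simp [hp]

lemma mem_polyFun {f : (ι → ℝ) → ℝ} :
    f ∈ polyFun ι ↔ ∃ p : MvPolynomial ι ℝ, ∀ x, f x = MvPolynomial.aeval x p := by
  constructor
  · rintro ⟨p, rfl⟩
    exact ⟨p, fun x => aeval_coord_apply p x⟩
  · rintro ⟨p, hp⟩
    exact ⟨p, funext fun x => (aeval_coord_apply p x).trans (hp x).symm⟩

lemma polyFun_coord (i : ι) : (fun x : ι → ℝ => x i) ∈ polyFun ι :=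
  mem_polyFun.2 ⟨.X i, by simp⟩

lemma polyFun_const (c : ℝ) : (fun _ : ι → ℝ => c) ∈ polyFun ι :=
  mem_polyFun.2 ⟨.C c, by simp⟩

lemma polyFun_aeval (p : MvPolynomial κ ℝ) {g : (ι → ℝ) → κ → ℝ}
    (hg : ∀ k, (fun x => g x k) ∈ polyFun ι) :
    (fun x => MvPolynomial.aeval (g x) p) ∈ polyFun ι := by
  induction p using MvPolynomial.induction_on with
  | C a => simpa using polyFun_const a
  | add p q hp hq => simp only [map_add]; exact add_mem hp hq
  | mul_X p i hp => simp only [map_mul, MvPolynomial.aeval_X]; exact mul_mem hp (hg i)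

namespace IsSemialgebraic

lemma polyFun_pos {f : (ι → ℝ) → ℝ} (hf : f ∈ polyFun ι) : IsSemialgebraic {x | 0 < f x} := by
  obtain ⟨p, hp⟩ := mem_polyFun.1 hf
  simpa only [hp] using IsSemialgebraic.pos p

lemma polyFun_lt {f g : (ι → ℝ) → ℝ} (hf : f ∈ polyFun ι) (hg : g ∈ polyFun ι) :
    IsSemialgebraic {x | f x < g x} := by
  simpa using polyFun_pos (sub_mem hg hf)

lemma polyFun_eq {f g : (ι → ℝ) → ℝ} (hf : f ∈ polyFun ι) (hg : g ∈ polyFun ι) :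
    IsSemialgebraic {x | f x = g x} := by
  have := ((polyFun_lt hf hg).or (polyFun_lt hg hf)).not
  simpa only [← ne_iff_lt_or_gt, ne_eq, not_not] using this

lemma preimage {A : Set (κ → ℝ)} (hA : IsSemialgebraic A) {g : (ι → ℝ) → κ → ℝ}
    (hg : ∀ k, (fun x => g x k) ∈ polyFun ι) : IsSemialgebraic {x | g x ∈ A} := by
  induction hA with
  | pos p => exact polyFun_pos (polyFun_aeval p hg)
  | compl _ ih => exact ih.compl
  | inter _ _ ih₁ ih₂ => exact ih₁.inter ih₂

end IsSemialgebraic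

/-! ### Root functions and the projection theorem -/

/-- A maximal algebra of semialgebraic functions: it contains the polynomials, all its members have
semialgebraic positivity sets, and no larger algebra has this property. -/
structure IsMaximalTame (F : Subalgebra ℝ ((ι → ℝ) → ℝ)) : Prop where
  poly_le : polyFun ι ≤ F
  pos : ∀ f ∈ F, IsSemialgebraic {x | 0 < f x}
  maximal : ∀ G : Subalgebra ℝ ((ι → ℝ) → ℝ), F ≤ G →
    (∀ f ∈ G, IsSemialgebraic {x | 0 < f x}) → G ≤ F

lemma exists_isMaximalTame (ι : Type) :
    ∃ F : Subalgebra ℝ ((ι → ℝ) → ℝ), IsMaximalTame F := by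
  obtain ⟨F, hF, hmax⟩ := zorn_le_nonempty₀
    {F : Subalgebra ℝ ((ι → ℝ) → ℝ) | ∀ f ∈ F, IsSemialgebraic {x | 0 < f x}} (by
      intro c hc hchain G hG
      refine ⟨sSup c, fun f hf => ?_, fun _ h => le_sSup h⟩
      have hne : c.Nonempty := ⟨G, hG⟩
      have : Nonempty c := hne.to_subtype
      rw [sSup_eq_iSup', ← SetLike.mem_coe,
        Subalgebra.coe_iSup_of_directed hchain.directedOn.directed_val] at hf
      obtain ⟨K, hfK⟩ := Set.mem_iUnion.1 hf
      exact hc K.2 f hfK) (polyFun ι) (fun f hf => IsSemialgebraic.polyFun_pos hf)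
  exact ⟨F, hF, hmax.prop, fun G hFG hG => hmax.le_of_ge hG hFG⟩

namespace IsMaximalTame

variable {F : Subalgebra ℝ ((ι → ℝ) → ℝ)}

lemma lt (hF : IsMaximalTame F) {f g : (ι → ℝ) → ℝ} (hf : f ∈ F) (hg : g ∈ F) :
    IsSemialgebraic {x | f x < g x} := by
  simpa using hF.pos _ (sub_mem hg hf)

lemma eq (hF : IsMaximalTame F) {f g : (ι → ℝ) → ℝ} (hf : f ∈ F) (hg : g ∈ F) :
    IsSemialgebraic {x | f x = g x} := by
  have := ((hF.lt hf hg).or (hF.lt hg hf)).not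
  simpa only [← ne_iff_lt_or_gt, ne_eq, not_not] using this

lemma le (hF : IsMaximalTame F) {f g : (ι → ℝ) → ℝ} (hf : f ∈ F) (hg : g ∈ F) :
    IsSemialgebraic {x | f x ≤ g x} := by
  simpa only [not_lt] using (hF.lt hg hf).not

lemma const (_ : IsMaximalTame F) (c : ℝ) : (fun _ => c) ∈ F := F.algebraMap_mem c

/-- A function that may be substituted into every polynomial over `F` belongs to `F`. -/
lemma mem_of_aeval (hF : IsMaximalTame F) {z : (ι → ℝ) → ℝ}
    (h : ∀ q : Polynomial F, IsSemialgebraic {x | 0 < (Polynomial.aeval z q) x}) : z ∈ F := by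
  have hle := hF.maximal
    ((Polynomial.aeval (R := F) z).range.restrictScalars ℝ) (by
      intro f hf
      exact ⟨Polynomial.C ⟨f, hf⟩, by simp⟩) (by
      rintro _ ⟨q, rfl⟩
      exact h q)
  exact hle ⟨Polynomial.X, by simp⟩

lemma aeval_mem (_ : IsMaximalTame F) {z : (ι → ℝ) → ℝ} (hz : z ∈ F) (q : Polynomial F) :
    Polynomial.aeval z q ∈ F := by
  rw [Polynomial.aeval_eq_sum_range]
  exact sum_mem fun k _ => mul_mem (q.coeff k).2 (pow_mem hz k)

end IsMaximalTame

/-- Evaluation at `x` of the members of an algebra of functions. -/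
noncomputable def evalAt (F : Subalgebra ℝ ((ι → ℝ) → ℝ)) (x : ι → ℝ) : F →+* ℝ :=
  (Pi.evalRingHom _ x).comp F.val.toRingHom

@[simp] lemma evalAt_apply (F : Subalgebra ℝ ((ι → ℝ) → ℝ)) (x : ι → ℝ) (f : F) :
    evalAt F x f = (f : (ι → ℝ) → ℝ) x := rfl

lemma aeval_apply_eq {F : Subalgebra ℝ ((ι → ℝ) → ℝ)} (z : (ι → ℝ) → ℝ) (q : Polynomial F)
    (x : ι → ℝ) : (Polynomial.aeval z q) x = (q.map (evalAt F x)).eval (z x) := by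
  induction q using Polynomial.induction_on' with
  | add p q hp hq => simp [hp, hq]
  | monomial n a => simp [Polynomial.aeval_monomial]

namespace IsMaximalTame

variable {F : Subalgebra ℝ ((ι → ℝ) → ℝ)}

lemma inv (hF : IsMaximalTame F) {f : (ι → ℝ) → ℝ} (hf : f ∈ F) : (fun x => (f x)⁻¹) ∈ F := by
  refine hF.mem_of_aeval fun q => ?_
  -- `q (1/f)` has the sign of `f ^ (2 deg q) * q (1/f)`, which is polynomial in `f`
  set g : (ι → ℝ) → ℝ := ∑ k ∈ Finset.range (q.natDegree + 1),
    (q.coeff k : (ι → ℝ) → ℝ) * f ^ (2 * q.natDegree - k) with hg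
  have hgF : g ∈ F := sum_mem fun k _ => mul_mem (Subtype.coe_prop _) (pow_mem hf _)
  have h0 : (fun _ : ι → ℝ => (0 : ℝ)) ∈ F := hF.const 0
  have h := ((hF.eq hf h0).and (hF.pos _ (q.coeff 0).2)).or ((hF.eq hf h0).not.and (hF.pos _ hgF))
  convert h using 3 with x
  by_cases hx : f x = 0
  · simp [aeval_apply_eq, hx, ← Polynomial.coeff_zero_eq_eval_zero]
  · have : g x = f x ^ (2 * q.natDegree) * (q.map (evalAt F x)).eval (f x)⁻¹ := by
      rw [Polynomial.eval_eq_sum_range' (n := q.natDegree + 1)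
        (Nat.lt_succ_of_le Polynomial.natDegree_map_le), Finset.mul_sum, hg]
      simp only [Finset.sum_apply, Pi.mul_apply, Pi.pow_apply, Polynomial.coeff_map, evalAt_apply]
      refine Finset.sum_congr rfl fun k hk => ?_
      have hk' : k ≤ 2 * q.natDegree := by
        have := Finset.mem_range.1 hk
        omega
      rw [pow_sub₀ _ hx hk', inv_pow]
      ring
    have hp : 0 < f x ^ (2 * q.natDegree) := by
      rw [pow_mul]
      positivity
    simp [aeval_apply_eq, hx, this, mul_pos_iff_of_pos_left hp]

end IsMaximalTame

end HDDegree

namespace HDDegree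

variable {ι κ : Type}

/-! ### Sign patterns of real polynomials on intervals -/

lemma pos_of_no_root {q : Polynomial ℝ} {I : Set ℝ} (hI : I.OrdConnected) {u v : ℝ} (hu : u ∈ I)
    (hv : v ∈ I) (hq : ∀ t ∈ I, q.eval t ≠ 0) (hpos : 0 < q.eval u) : 0 < q.eval v := by
  by_contra hneg
  obtain ⟨t, ht, h0⟩ := (isPreconnected_uIcc (a := u) (b := v)).intermediate_value₂
    Set.right_mem_uIcc Set.left_mem_uIcc (f := fun t => q.eval t) (g := fun _ => 0)
    q.continuousOn continuousOn_const (not_lt.1 hneg) hpos.le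
  exact hq t (hI.uIcc_subset hu hv ht) h0

lemma strictMonoOn_or_strictAntiOn_of_gap {p : Polynomial ℝ} {C : Set ℝ} {r s : ℝ} (hrs : r < s)
    (hC : ∀ t, p.derivative.eval t = 0 → t ∈ C) (hgap : ∀ c ∈ C, r < c → ¬ c < s) :
    StrictMonoOn (fun t => p.eval t) (Set.Icc r s) ∨
      StrictAntiOn (fun t => p.eval t) (Set.Icc r s) := by
  have hne : ∀ t ∈ Set.Ioo r s, p.derivative.eval t ≠ 0 :=
    fun t ht h0 => hgap t (hC t h0) ht.1 ht.2
  have hm : (r + s) / 2 ∈ Set.Ioo r s := ⟨by linarith, by linarith⟩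
  rcases lt_or_gt_of_ne (hne _ hm) with h | h
  · right
    refine strictAntiOn_of_deriv_neg (convex_Icc r s) p.continuousOn fun t ht => ?_
    rw [interior_Icc] at ht
    have := pos_of_no_root (q := -p.derivative) Set.ordConnected_Ioo hm ht
      (fun t ht => by simpa using hne t ht) (by simpa using h)
    simpa using this
  · left
    refine strictMonoOn_of_deriv_pos (convex_Icc r s) p.continuousOn fun t ht => ?_
    rw [interior_Icc] at ht
    simpa using pos_of_no_root Set.ordConnected_Ioo hm ht hne h

lemma lt_root_iff {f : ℝ → ℝ} {r s z a : ℝ}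
    (hf : StrictMonoOn f (Set.Icc r s) ∨ StrictAntiOn f (Set.Icc r s))
    (hz : z ∈ Set.Ioo r s) (h0 : f z = 0) (ha : a ∈ Set.Icc r s) :
    (f a * f s < 0 ↔ a < z) ∧ (f a * f r < 0 ↔ z < a) := by
  have hz' : z ∈ Set.Icc r s := Set.Ioo_subset_Icc_self hz
  have hr : r ∈ Set.Icc r s := ⟨le_rfl, (hz.1.trans hz.2).le⟩
  have hs : s ∈ Set.Icc r s := ⟨(hz.1.trans hz.2).le, le_rfl⟩
  rcases hf with hf | hf
  · have h1 : f r < 0 := h0 ▸ hf hr hz' hz.1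
    have h2 : 0 < f s := h0 ▸ hf hz' hs hz.2
    rw [← hf.lt_iff_lt ha hz', ← hf.lt_iff_lt hz' ha, h0]
    constructor <;> constructor <;> intro h <;> nlinarith
  · have h1 : 0 < f r := h0 ▸ hf hr hz' hz.1
    have h2 : f s < 0 := h0 ▸ hf hz' hs hz.2
    rw [← hf.lt_iff_gt hz' ha, ← hf.lt_iff_gt ha hz', h0]
    constructor <;> constructor <;> intro h <;> nlinarith

/-- Around a point, a finite set bracketing it contains a nearest bracket. -/
lemma exists_bracket {C : Set ℝ} (hC : C.Finite) {z r s : ℝ} (hr : r ∈ C) (hs : s ∈ C)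
    (hrz : r < z) (hzs : z < s) :
    ∃ a ∈ C, ∃ b ∈ C, r ≤ a ∧ b ≤ s ∧ a < z ∧ z < b ∧ ∀ c ∈ C, a < c → c < b → c = z := by
  obtain ⟨a, ⟨haC, haz⟩, ha⟩ := (hC.subset (Set.sep_subset C (· < z))).exists_maximal ⟨r, hr, hrz⟩
  obtain ⟨b, ⟨hbC, hbz⟩, hb⟩ := (hC.subset (Set.sep_subset C (z < ·))).exists_minimal ⟨s, hs, hzs⟩
  refine ⟨a, haC, b, hbC, ?_, ?_, haz, hbz, fun c hc hac hcb => ?_⟩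
  · by_contra h
    exact h (ha ⟨hr, hrz⟩ (not_le.1 h).le)
  · by_contra h
    exact h (hb ⟨hs, hzs⟩ (not_le.1 h).le)
  · rcases lt_trichotomy c z with h | h | h
    · exact absurd (ha ⟨hc, h⟩ hac.le) (not_le.2 hac)
    · exact h
    · exact absurd (hb ⟨hc, h⟩ hcb.le) (not_le.2 hcb)

/-- The sign of `q` at the root `z` of `p` in `(r, s)`, in terms of the values of `p` and `q` at the
roots of `q`, at `r`, `s` and at the midpoints of these points. -/
lemma pos_at_root_iff {p q : Polynomial ℝ} {C : Set ℝ} (hC : C.Finite) {r s z : ℝ}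
    (hp : StrictMonoOn (fun t => p.eval t) (Set.Icc r s) ∨
      StrictAntiOn (fun t => p.eval t) (Set.Icc r s))
    (hz : z ∈ Set.Ioo r s) (h0 : p.eval z = 0) (hr : r ∈ C) (hs : s ∈ C)
    (hq : q ≠ 0 → ∀ t, q.eval t = 0 → t ∈ C) :
    0 < q.eval z ↔ ∃ a ∈ C, ∃ b ∈ C, r ≤ a ∧ b ≤ s ∧ p.eval a * p.eval s < 0 ∧
      p.eval b * p.eval r < 0 ∧ (∀ c ∈ C, a < c → c < b → q.eval c ≠ 0) ∧
      0 < q.eval ((a + b) / 2) ∧ a ≤ s ∧ r ≤ b := by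
  have main : ∀ a b, a < z → z < b → (∀ c ∈ C, a < c → c < b → q.eval c ≠ 0) → q ≠ 0 →
      ∀ t ∈ Set.Ioo a b, q.eval t ≠ 0 := fun a b _ _ h hq0 t ht ht0 =>
    h t (hq hq0 t ht0) ht.1 ht.2 ht0
  constructor
  · intro hpos
    have hq0 : q ≠ 0 := by
      rintro rfl
      simp at hpos
    obtain ⟨a, ha, b, hb, hra, hbs, haz, hzb, hab⟩ := exists_bracket hC hr hs hz.1 hz.2
    have hnr : ∀ c ∈ C, a < c → c < b → q.eval c ≠ 0 := by
      intro c hc hac hcb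
      rw [hab c hc hac hcb]
      exact hpos.ne'
    have has : a ≤ s := (haz.trans hz.2).le
    have hrb : r ≤ b := (hz.1.trans hzb).le
    refine ⟨a, ha, b, hb, hra, hbs, (lt_root_iff hp hz h0 ⟨hra, has⟩).1.2 haz,
      (lt_root_iff hp hz h0 ⟨hrb, hbs⟩).2.2 hzb, hnr, ?_, has, hrb⟩
    exact pos_of_no_root (I := Set.Ioo a b) Set.ordConnected_Ioo ⟨haz, hzb⟩
      ⟨by linarith, by linarith⟩ (main a b haz hzb hnr hq0) hpos
  · rintro ⟨a, -, b, -, hra, hbs, h1, h2, hnr, hmid, has, hrb⟩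
    have haz := (lt_root_iff hp hz h0 ⟨hra, has⟩).1.1 h1
    have hzb := (lt_root_iff hp hz h0 ⟨hrb, hbs⟩).2.1 h2
    have hq0 : q ≠ 0 := by
      rintro rfl
      simp at hmid
    exact pos_of_no_root (I := Set.Ioo a b) Set.ordConnected_Ioo
      ⟨by linarith, by linarith⟩ ⟨haz, hzb⟩ (main a b haz hzb hnr hq0) hmid

/-- A root of `p` is a root of `p'`, or lies in a gap between roots of `p'` on which `p` changes
sign. -/
lemma exists_gap_of_root {p : Polynomial ℝ} {C D : Set ℝ} (hCD : C ⊆ D) (hD : D.Finite)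
    (hC : ∀ t, p.derivative.eval t = 0 → t ∈ C) {b z : ℝ} (hb : b ∈ D) (hb' : -b ∈ D)
    (hz1 : -b < z) (hz2 : z < b) (h0 : p.eval z = 0) (hzC : z ∉ C) :
    ∃ r ∈ D, ∃ s ∈ D, r < z ∧ z < s ∧ (∀ c ∈ C, r < c → ¬ c < s) ∧ p.eval r * p.eval s < 0 := by
  obtain ⟨r, hr, s, hs, -, -, hrz, hzs, hgap⟩ := exists_bracket hD hb' hb hz1 hz2
  have hgap' : ∀ c ∈ C, r < c → ¬ c < s := fun c hc h1 h2 =>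
    hzC (hgap c (hCD hc) h1 h2 ▸ hc)
  refine ⟨r, hr, s, hs, hrz, hzs, hgap', ?_⟩
  exact (lt_root_iff (strictMonoOn_or_strictAntiOn_of_gap (hrz.trans hzs) hC hgap')
    ⟨hrz, hzs⟩ h0 ⟨le_rfl, (hrz.trans hzs).le⟩).1.2 hrz

lemma abs_root_lt {p : Polynomial ℝ} (hp : p.Monic) {z : ℝ} (h0 : p.eval z = 0) :
    |z| < 2 + ∑ k ∈ Finset.range p.natDegree, p.coeff k ^ 2 := by
  refine lt_of_lt_of_le (show |z| < (p.cauchyBound : ℝ) from ?_) ?_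
  · exact_mod_cast Polynomial.IsRoot.norm_lt_cauchyBound hp.ne_zero h0
  · have hs : ∀ k ∈ Finset.range p.natDegree,
        p.coeff k ^ 2 ≤ ∑ k ∈ Finset.range p.natDegree, p.coeff k ^ 2 :=
      fun k hk => Finset.single_le_sum (f := fun k => p.coeff k ^ 2)
        (fun _ _ => sq_nonneg _) hk
    have h1 : (Finset.range p.natDegree).sup (fun k => ‖p.coeff k‖₊) ≤
        (1 + ∑ k ∈ Finset.range p.natDegree, p.coeff k ^ 2).toNNReal := by
      refine Finset.sup_le fun k hk => ?_
      rw [← NNReal.coe_le_coe, Real.coe_toNNReal _ (by positivity), coe_nnnorm, Real.norm_eq_abs]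
      have := hs k hk
      nlinarith [sq_abs (p.coeff k), sq_nonneg (|p.coeff k| - 1)]
    rw [Polynomial.cauchyBound, hp.leadingCoeff]
    have h2 := NNReal.coe_le_coe.2 h1
    rw [Real.coe_toNNReal _ (by positivity)] at h2
    simp only [nnnorm_one, div_one, NNReal.coe_add, NNReal.coe_one]
    linarith

end HDDegree

namespace HDDegree

variable {ι κ : Type}

/-- The functions in the finite set `L` run through all roots of the nonzero specializations of the
polynomial `p` with coefficients in the function algebra `F`. -/
structure CoversRoots (F : Subalgebra ℝ ((ι → ℝ) → ℝ)) (L : Set ((ι → ℝ) → ℝ))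
    (p : Polynomial F) : Prop where
  finite : L.Finite
  subset : ∀ f ∈ L, f ∈ F
  covers : ∀ x t, p.map (evalAt F x) ≠ 0 → (p.map (evalAt F x)).eval t = 0 → ∃ r ∈ L, r x = t

namespace IsMaximalTame

variable {F : Subalgebra ℝ ((ι → ℝ) → ℝ)}

/-- The root of a monic polynomial `p` in the gap between the functions `r` and `s`, taken where
this gap is free of roots of `p'` and `p` changes sign on it, belongs to `F`. -/
lemma gapRoot_mem (hF : IsMaximalTame F) {d : ℕ}
    (ih : ∀ q : Polynomial F, q.natDegree ≤ d → ∃ L, CoversRoots F L q)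
    {p : Polynomial F} (hp : p.Monic) (hd : p.natDegree = d + 1) {L : Set ((ι → ℝ) → ℝ)}
    (hL : CoversRoots F L p.derivative) (hp' : ∀ x, p.derivative.map (evalAt F x) ≠ 0)
    {r s : (ι → ℝ) → ℝ} (hr : r ∈ F) (hs : s ∈ F) :
    ∃ z ∈ F, ∀ x, r x < s x → (∀ c ∈ L, r x < c x → ¬ c x < s x) →
      (p.map (evalAt F x)).eval (r x) * (p.map (evalAt F x)).eval (s x) < 0 →
      z x ∈ Set.Ioo (r x) (s x) ∧ (p.map (evalAt F x)).eval (z x) = 0 := by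
  classical
  set A : Set (ι → ℝ) := {x | r x < s x ∧ (∀ c ∈ L, r x < c x → ¬ c x < s x) ∧
    (p.map (evalAt F x)).eval (r x) * (p.map (evalAt F x)).eval (s x) < 0} with hAdef
  have hA : IsSemialgebraic A := by
    refine (hF.lt hr hs).and (.and (.forall_mem hL.finite fun c hc =>
      .imp (hF.lt hr (hL.subset c hc)) (hF.lt (hL.subset c hc) hs).not) ?_)
    have := hF.lt (mul_mem (hF.aeval_mem hr p) (hF.aeval_mem hs p)) (hF.const 0)
    simpa only [Pi.mul_apply, aeval_apply_eq] using this
  have hex : ∀ x ∈ A, ∃ z ∈ Set.Ioo (r x) (s x), (p.map (evalAt F x)).eval z = 0 := by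
    intro x hx
    obtain ⟨hrs, -, hneg⟩ := hx
    by_contra hcon
    push Not at hcon
    have hne : ∀ t ∈ Set.Icc (r x) (s x), (p.map (evalAt F x)).eval t ≠ 0 := by
      intro t ht h0
      rcases ht.1.eq_or_lt with h | h
      · rw [h, h0, zero_mul] at hneg
        exact lt_irrefl _ hneg
      rcases ht.2.eq_or_lt with h' | h'
      · rw [← h', h0, mul_zero] at hneg
        exact lt_irrefl _ hneg
      exact hcon t ⟨h, h'⟩ h0
    have hrI : r x ∈ Set.Icc (r x) (s x) := ⟨le_rfl, hrs.le⟩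
    have hsI : s x ∈ Set.Icc (r x) (s x) := ⟨hrs.le, le_rfl⟩
    rcases lt_or_gt_of_ne (hne _ hrI) with h | h
    · have := pos_of_no_root (q := -p.map (evalAt F x)) Set.ordConnected_Icc hrI hsI
        (fun t ht => by simpa using hne t ht) (by simpa using h)
      simp only [Polynomial.eval_neg] at this
      nlinarith
    · have := pos_of_no_root Set.ordConnected_Icc hrI hsI hne h
      nlinarith
  choose! z hz hz0 using hex
  -- off `A`, where there need not be a root, the function is extended by `0`
  refine ⟨fun x => if x ∈ A then z x else 0, ?_, fun x h1 h2 h3 => ?_⟩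
  swap
  · have hx : x ∈ A := ⟨h1, h2, h3⟩
    simp only [hx, if_true]
    exact ⟨hz x hx, hz0 x hx⟩
  refine hF.mem_of_aeval fun q => ?_
  -- at a root of `p`, `q` takes the value of `q %ₘ p`, whose roots are known by induction
  obtain ⟨M, hM⟩ := ih (q %ₘ p) (by
    have := Polynomial.natDegree_modByMonic_lt q hp (by
      rintro rfl
      simp at hd)
    omega)
  set C : Set ((ι → ℝ) → ℝ) := insert r (insert s M) with hC
  have hCfin : C.Finite := (hM.finite.insert s).insert r
  have hCF : ∀ f ∈ C, f ∈ F := by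
    rintro f (rfl | rfl | hf)
    exacts [hr, hs, hM.subset f hf]
  have hmid : ∀ a ∈ C, ∀ b ∈ C, (fun x => (a x + b x) / 2) ∈ F := fun a ha b hb => by
    have := mul_mem (add_mem (hCF a ha) (hCF b hb)) (hF.const (1 / 2))
    convert this using 1
    ext x
    simp [div_eq_mul_inv]
  have hev : ∀ (g : Polynomial F) (f : (ι → ℝ) → ℝ), f ∈ F →
      (fun x => (g.map (evalAt F x)).eval (f x)) ∈ F := fun g f hf => by
    simpa only [← aeval_apply_eq] using hF.aeval_mem hf g
  have key : ∀ x ∈ A, (0 < (q.map (evalAt F x)).eval (z x) ↔ ∃ a ∈ C, ∃ b ∈ C,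
      r x ≤ a x ∧ b x ≤ s x ∧
      (p.map (evalAt F x)).eval (a x) * (p.map (evalAt F x)).eval (s x) < 0 ∧
      (p.map (evalAt F x)).eval (b x) * (p.map (evalAt F x)).eval (r x) < 0 ∧
      (∀ c ∈ C, a x < c x → c x < b x → ((q %ₘ p).map (evalAt F x)).eval (c x) ≠ 0) ∧
      0 < ((q %ₘ p).map (evalAt F x)).eval ((a x + b x) / 2) ∧ a x ≤ s x ∧ r x ≤ b x) := by
    intro x hx
    have hval : (q.map (evalAt F x)).eval (z x) = ((q %ₘ p).map (evalAt F x)).eval (z x) := by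
      conv_lhs => rw [← Polynomial.modByMonic_add_div q p]
      simp [Polynomial.map_add, Polynomial.map_mul, hz0 x hx]
    rw [hval, pos_at_root_iff (p := p.map (evalAt F x)) (hCfin.image fun f => f x)
      (strictMonoOn_or_strictAntiOn_of_gap (C := (fun f => f x) '' L) hx.1 ?_ ?_)
      (hz x hx) (hz0 x hx) ⟨r, by simp [hC]⟩ ⟨s, by simp [hC]⟩ ?_]
    · simp only [Set.exists_mem_image, Set.forall_mem_image]
    · intro t ht
      rw [Polynomial.derivative_map] at ht
      obtain ⟨f, hf, hft⟩ := hL.covers x t (hp' x) ht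
      exact ⟨f, hf, hft⟩
    · rintro _ ⟨c, hc, rfl⟩
      exact hx.2.1 c hc
    · intro hq0 t ht
      obtain ⟨f, hf, hft⟩ := hM.covers x t hq0 ht
      exact ⟨f, by simp [hC, hf], hft⟩
  have hK : IsSemialgebraic {x | ∃ a ∈ C, ∃ b ∈ C,
      r x ≤ a x ∧ b x ≤ s x ∧
      (p.map (evalAt F x)).eval (a x) * (p.map (evalAt F x)).eval (s x) < 0 ∧
      (p.map (evalAt F x)).eval (b x) * (p.map (evalAt F x)).eval (r x) < 0 ∧
      (∀ c ∈ C, a x < c x → c x < b x → ((q %ₘ p).map (evalAt F x)).eval (c x) ≠ 0) ∧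
      0 < ((q %ₘ p).map (evalAt F x)).eval ((a x + b x) / 2) ∧ a x ≤ s x ∧ r x ≤ b x} := by
    refine .exists_mem hCfin fun a ha => .exists_mem hCfin fun b hb => ?_
    have haF := hCF a ha
    have hbF := hCF b hb
    exact (hF.le hr haF).and <| (hF.le hbF hs).and <|
      .and (hF.lt (mul_mem (hev p a haF) (hev p s hs)) (hF.const 0)) <|
      .and (hF.lt (mul_mem (hev p b hbF) (hev p r hr)) (hF.const 0)) <|
      .and (.forall_mem hCfin fun c hc => .imp (hF.lt haF (hCF c hc)) <|
        .imp (hF.lt (hCF c hc) hbF) (hF.eq (hev _ c (hCF c hc)) (hF.const 0)).not) <|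
      .and (hF.pos _ (hev _ _ (hmid a ha b hb))) <|
      (hF.le haF hs).and (hF.le hr hbF)
  have hoff := hF.pos _ (hev q _ (hF.const 0))
  convert (hA.and hK).or (hA.not.and hoff) using 3 with x
  rw [aeval_apply_eq]
  change _ ↔ (x ∈ A ∧ _) ∨ (x ∉ A ∧ _)
  by_cases hx : x ∈ A
  · simp only [hx, if_true, true_and, not_true_eq_false, false_and, or_false]
    exact key x hx
  · simp only [hx, if_false, false_and, not_false_eq_true, true_and, false_or]

lemma coversRoots_monic (hF : IsMaximalTame F) {d : ℕ}
    (ih : ∀ q : Polynomial F, q.natDegree ≤ d → ∃ L, CoversRoots F L q)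
    {p : Polynomial F} (hp : p.Monic) (hd : p.natDegree = d + 1) :
    ∃ L, CoversRoots F L p := by
  classical
  have hder : ∀ x, p.derivative.map (evalAt F x) ≠ 0 := by
    intro x h0
    have : (p.derivative.map (evalAt F x)).coeff d = d + 1 := by
      rw [Polynomial.coeff_map, Polynomial.coeff_derivative, ← hd, hp.coeff_natDegree]
      simp
    rw [h0, Polynomial.coeff_zero] at this
    have : (0 : ℝ) < d + 1 := by positivity
    linarith
  obtain ⟨L, hL⟩ := ih p.derivative (by
    have := Polynomial.natDegree_derivative_le p
    omega)
  -- `±b` bound all roots of `p`; with the roots of `p'` they cut `ℝ` into gaps on which `p` is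
  -- monotone
  set b : (ι → ℝ) → ℝ := fun x => 2 + ∑ k ∈ Finset.range (d + 1),
    (p.coeff k : (ι → ℝ) → ℝ) x ^ 2 with hb
  have hbF : b ∈ F := by
    have : b = (fun _ => (2 : ℝ)) + ∑ k ∈ Finset.range (d + 1), (p.coeff k : (ι → ℝ) → ℝ) ^ 2 := by
      ext x
      simp [hb]
    rw [this]
    exact add_mem (hF.const 2) (sum_mem fun k _ => pow_mem (p.coeff k).2 2)
  set D : Set ((ι → ℝ) → ℝ) := insert b (insert (-b) L) with hD
  have hDfin : D.Finite := (hL.finite.insert _).insert _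
  have hDF : ∀ f ∈ D, f ∈ F := by
    rintro f (rfl | rfl | hf)
    exacts [hbF, neg_mem hbF, hL.subset f hf]
  have hz : ∀ rs ∈ D ×ˢ D, ∃ z ∈ F, ∀ x, rs.1 x < rs.2 x →
      (∀ c ∈ L, rs.1 x < c x → ¬ c x < rs.2 x) →
      (p.map (evalAt F x)).eval (rs.1 x) * (p.map (evalAt F x)).eval (rs.2 x) < 0 →
      z x ∈ Set.Ioo (rs.1 x) (rs.2 x) ∧ (p.map (evalAt F x)).eval (z x) = 0 := fun rs hrs =>
    hF.gapRoot_mem ih hp hd hL hder (hDF _ hrs.1) (hDF _ hrs.2)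
  choose! z hzF hz using hz
  refine ⟨L ∪ z '' (D ×ˢ D), hL.finite.union ((hDfin.prod hDfin).image z), ?_, ?_⟩
  · rintro f (hf | ⟨rs, hrs, rfl⟩)
    exacts [hL.subset f hf, hzF rs hrs]
  intro x t _ h0
  by_cases htL : ∃ r ∈ L, r x = t
  · obtain ⟨r, hr, h⟩ := htL
    exact ⟨r, Or.inl hr, h⟩
  have hroots : ∀ u, (p.map (evalAt F x)).derivative.eval u = 0 → u ∈ (fun f => f x) '' L := by
    intro u hu
    rw [Polynomial.derivative_map] at hu
    obtain ⟨f, hf, hfu⟩ := hL.covers x u (hder x) hu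
    exact ⟨f, hf, hfu⟩
  have hlt : |t| < b x := by
    have := abs_root_lt (hp.map (evalAt F x)) h0
    rw [hp.natDegree_map, hd] at this
    simpa [hb] using this
  obtain ⟨_, ⟨r, hr, rfl⟩, _, ⟨s, hs, rfl⟩, hrt, hts, hgap, hneg⟩ :=
    exists_gap_of_root (C := (fun f => f x) '' L) (D := (fun f => f x) '' D) (b := b x)
      (Set.image_mono fun f hf => by simp [hD, hf]) (hDfin.image _) hroots ⟨b, by simp [hD]⟩
      ⟨-b, by simp [hD]⟩ (abs_lt.1 hlt).1 (abs_lt.1 hlt).2 h0 (by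
        rintro ⟨f, hf, hft⟩
        exact htL ⟨f, hf, hft⟩)
  have hrs : r x < s x := hrt.trans hts
  obtain ⟨hzmem, hz0⟩ := hz (r, s) ⟨hr, hs⟩ x hrs (fun c hc => hgap _ ⟨c, hc, rfl⟩) hneg
  refine ⟨z (r, s), Or.inr ⟨(r, s), ⟨hr, hs⟩, rfl⟩, ?_⟩
  have hmono := strictMonoOn_or_strictAntiOn_of_gap hrs hroots hgap
  have hinj : Set.InjOn (fun t => (p.map (evalAt F x)).eval t) (Set.Icc (r x) (s x)) :=
    hmono.elim (fun h => h.injOn) fun h => h.injOn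
  exact hinj (Set.Ioo_subset_Icc_self hzmem) ⟨hrt.le, hts.le⟩ (by simp only [hz0, h0])

/-- The roots of a polynomial over a maximal tame algebra are given by members of the algebra. -/
theorem exists_coversRoots (hF : IsMaximalTame F) (d : ℕ) :
    ∀ p : Polynomial F, p.natDegree ≤ d → ∃ L, CoversRoots F L p := by
  classical
  induction d with
  | zero =>
    intro p hp
    refine ⟨∅, Set.finite_empty, by simp, fun x t hne h0 => ?_⟩
    rw [Polynomial.eq_C_of_natDegree_le_zero hp] at hne h0
    simp only [Polynomial.map_C, Polynomial.eval_C] at hne h0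
    simp [h0] at hne
  | succ d ih =>
    intro p hp
    -- where the coefficient of degree `d + 1` vanishes, drop it; elsewhere divide by it
    set c : (ι → ℝ) → ℝ := (p.coeff (d + 1)).1 with hc
    set low : Polynomial F := ∑ k ∈ Finset.range (d + 1), Polynomial.C (p.coeff k) * .X ^ k
      with hlow
    set cinv : F := ⟨fun x => (c x)⁻¹, hF.inv (p.coeff (d + 1)).2⟩ with hcinv
    set mon : Polynomial F := .X ^ (d + 1) + Polynomial.C cinv * low with hmon
    have hlowd : low.degree < ((d + 1 : ℕ) : WithBot ℕ) := by
      refine (Polynomial.degree_sum_le _ _).trans_lt ((Finset.sup_lt_iff (by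
        exact WithBot.bot_lt_coe _)).2 fun k hk => ?_)
      exact (Polynomial.degree_C_mul_X_pow_le k _).trans_lt
        (by exact_mod_cast Finset.mem_range.1 hk)
    have hmond : (Polynomial.C cinv * low).degree < ((d + 1 : ℕ) : WithBot ℕ) := by
      rw [← Polynomial.smul_eq_C_mul]
      exact (Polynomial.degree_smul_le _ _).trans_lt hlowd
    have hmonic : mon.Monic := Polynomial.monic_X_pow_add hmond
    have hnd : mon.natDegree = d + 1 := by
      by_cases htriv : Nontrivial F
      · exact Polynomial.natDegree_eq_of_degree_eq_some (by
          rw [hmon, Polynomial.degree_add_eq_left_of_degree_lt] <;>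
            simp only [Polynomial.degree_X_pow]
          exact hmond)
      · exact absurd (inferInstance : Nontrivial F) htriv
    obtain ⟨L₁, h₁⟩ := ih low (Polynomial.natDegree_le_iff_coeff_eq_zero.2 fun N hN =>
      Polynomial.coeff_eq_zero_of_degree_lt (hlowd.trans_le (by exact_mod_cast hN)))
    obtain ⟨L₂, h₂⟩ := hF.coversRoots_monic ih hmonic hnd
    refine ⟨L₁ ∪ L₂, h₁.finite.union h₂.finite, ?_, ?_⟩
    · rintro f (hf | hf)
      exacts [h₁.subset f hf, h₂.subset f hf]
    intro x t hne h0
    have hsplit : p = Polynomial.C (p.coeff (d + 1)) * .X ^ (d + 1) + low := by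
      conv_lhs => rw [Polynomial.as_sum_range_C_mul_X_pow' p (Nat.lt_succ_of_le hp),
        Finset.sum_range_succ, add_comm]
    by_cases hcx : c x = 0
    · have hmap : p.map (evalAt F x) = low.map (evalAt F x) := by
        conv_lhs => rw [hsplit]
        simp [Polynomial.map_add, Polynomial.map_mul, ← hc, hcx]
      rw [hmap] at hne h0
      obtain ⟨r, hr, h⟩ := h₁.covers x t hne h0
      exact ⟨r, Or.inl hr, h⟩
    · have h0' : (mon.map (evalAt F x)).eval t = 0 := by
        have : (p.map (evalAt F x)).eval t = c x * (mon.map (evalAt F x)).eval t := by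
          conv_lhs => rw [hsplit]
          simp only [hmon, hcinv, Polynomial.map_add, Polynomial.map_mul, Polynomial.map_C,
            Polynomial.map_pow, Polynomial.map_X, Polynomial.eval_add, Polynomial.eval_mul,
            Polynomial.eval_C, Polynomial.eval_pow, Polynomial.eval_X, evalAt_apply, ← hc]
          field_simp
        rw [this] at h0
        exact (mul_eq_zero.1 h0).resolve_left hcx
      obtain ⟨r, hr, h⟩ := h₂.covers x t (hmonic.map _).ne_zero h0'
      exact ⟨r, Or.inr hr, h⟩

end IsMaximalTame

end HDDegree

namespace HDDegree

variable {ι κ : Type}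

/-- Extend a point of `ℝ^ι` by one coordinate. -/
def consOpt (x : ι → ℝ) (t : ℝ) : Option ι → ℝ := fun o => o.elim t x

@[simp] lemma consOpt_none (x : ι → ℝ) (t : ℝ) : consOpt x t none = t := rfl

@[simp] lemma consOpt_some (x : ι → ℝ) (t : ℝ) (i : ι) : consOpt x t (some i) = x i := rfl

variable {F : Subalgebra ℝ ((ι → ℝ) → ℝ)}

lemma IsMaximalTame.coord_mem (hF : IsMaximalTame F) (i : ι) : (fun x : ι → ℝ => x i) ∈ F :=
  hF.poly_le (polyFun_coord i)

/-- A polynomial in one more variable, as a univariate polynomial over the function algebra. -/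
noncomputable def toUnivariate (hF : IsMaximalTame F) (p : MvPolynomial (Option ι) ℝ) :
    Polynomial F :=
  MvPolynomial.aeval (fun o : Option ι =>
    o.elim Polynomial.X fun i => Polynomial.C ⟨fun x => x i, hF.coord_mem i⟩) p

lemma eval_toUnivariate (hF : IsMaximalTame F) (p : MvPolynomial (Option ι) ℝ) (x : ι → ℝ)
    (t : ℝ) : ((toUnivariate hF p).map (evalAt F x)).eval t
      = MvPolynomial.aeval (consOpt x t) p := by
  induction p using MvPolynomial.induction_on with
  | C a =>
    simp only [toUnivariate, MvPolynomial.algHom_C, Polynomial.algebraMap_apply,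
      Polynomial.map_C, Polynomial.eval_C]
    rfl
  | add p q hp hq =>
    simp only [toUnivariate, map_add, Polynomial.map_add, Polynomial.eval_add] at hp hq ⊢
    rw [hp, hq]
  | mul_X p o hp =>
    simp only [toUnivariate, map_mul, Polynomial.map_mul, Polynomial.eval_mul,
      MvPolynomial.aeval_X] at hp ⊢
    rw [hp]
    cases o <;> simp

namespace IsSemialgebraic

/-- Membership in a semialgebraic set of `ℝ^(ι+1)` is decided by the signs of finitely many
polynomials, so it is constant on intervals of the last coordinate that contain no root. -/
lemma exists_sign_family (hF : IsMaximalTame F) {A : Set (Option ι → ℝ)}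
    (hA : IsSemialgebraic A) :
    ∃ s : Finset (Polynomial F), ∀ (x : ι → ℝ) (I : Set ℝ), I.OrdConnected →
      (∀ q ∈ s, q.map (evalAt F x) ≠ 0 → ∀ t ∈ I, (q.map (evalAt F x)).eval t ≠ 0) →
      ∀ t ∈ I, ∀ u ∈ I, consOpt x t ∈ A → consOpt x u ∈ A := by
  classical
  induction hA with
  | pos p =>
    refine ⟨{toUnivariate hF p}, fun x I hI h t ht u hu hmem => ?_⟩
    simp only [Set.mem_ofPred_eq, ← eval_toUnivariate hF] at hmem ⊢
    refine pos_of_no_root hI ht hu (h _ (Finset.mem_singleton_self _) fun h0 => ?_) hmem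
    rw [h0, Polynomial.eval_zero] at hmem
    exact lt_irrefl _ hmem
  | compl _ ih =>
    obtain ⟨s, hs⟩ := ih
    exact ⟨s, fun x I hI h t ht u hu hmem hmem' => hmem (hs x I hI h u hu t ht hmem')⟩
  | inter _ _ ih₁ ih₂ =>
    obtain ⟨s₁, hs₁⟩ := ih₁
    obtain ⟨s₂, hs₂⟩ := ih₂
    exact ⟨s₁ ∪ s₂, fun x I hI h t ht u hu hmem =>
      ⟨hs₁ x I hI (fun q hq => h q (Finset.mem_union_left _ hq)) t ht u hu hmem.1,
       hs₂ x I hI (fun q hq => h q (Finset.mem_union_right _ hq)) t ht u hu hmem.2⟩⟩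

lemma subst_tame (hF : IsMaximalTame F) {A : Set (Option ι → ℝ)} (hA : IsSemialgebraic A)
    {f : (ι → ℝ) → ℝ} (hf : f ∈ F) : IsSemialgebraic {x | consOpt x (f x) ∈ A} := by
  induction hA with
  | pos p =>
    have := hF.pos _ (hF.aeval_mem hf (toUnivariate hF p))
    simp only [aeval_apply_eq, eval_toUnivariate] at this
    exact this
  | compl _ ih => exact ih.compl
  | inter _ _ ih₁ ih₂ => exact ih₁.inter ih₂

/-- Points between which a finite set of reals leaves a gap: every real number shares its gap with
an element, a midpoint of two elements, or an element shifted by `±1`. -/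
lemma exists_test_point {C : Set ℝ} (hC : C.Finite) (hne : C.Nonempty) (t : ℝ) :
    ∃ I : Set ℝ, I.OrdConnected ∧ t ∈ I ∧ (∀ c ∈ C, c ∈ I → I = {c}) ∧
      ∃ a ∈ C, ∃ b ∈ C, a ∈ I ∨ (a + b) / 2 ∈ I ∨ a + 1 ∈ I ∨ a - 1 ∈ I := by
  by_cases htC : t ∈ C
  · exact ⟨{t}, Set.ordConnected_singleton, rfl, by rintro c - rfl; rfl, t, htC, t, htC, Or.inl rfl⟩
  by_cases hlo : ∃ r ∈ C, r < t
  · obtain ⟨r, hr, hrt⟩ := hlo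
    by_cases hhi : ∃ s ∈ C, t < s
    · obtain ⟨s, hs, hts⟩ := hhi
      obtain ⟨a, ha, b, hb, -, -, hat, htb, hgap⟩ := exists_bracket hC hr hs hrt hts
      refine ⟨Set.Ioo a b, Set.ordConnected_Ioo, ⟨hat, htb⟩, fun c hc hcI => ?_, a, ha, b, hb,
        Or.inr (Or.inl ⟨by linarith, by linarith⟩)⟩
      exact absurd (hgap c hc hcI.1 hcI.2 ▸ hc) htC
    · push Not at hhi
      obtain ⟨a, haC, ha⟩ := hC.exists_maximal hne
      have ha' : ∀ c ∈ C, c ≤ a := fun c hc => (le_total c a).elim id fun h => ha hc h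
      refine ⟨Set.Ioi a, Set.ordConnected_Ioi, lt_of_le_of_ne (hhi a haC) ?_, fun c hc hcI => ?_,
        a, haC, a, haC, Or.inr (Or.inr (Or.inl (by simp)))⟩
      · rintro rfl
        exact htC haC
      · exact absurd (ha' c hc) (not_le.2 hcI)
  · push Not at hlo
    obtain ⟨a, haC, ha⟩ := hC.exists_minimal hne
    have ha' : ∀ c ∈ C, a ≤ c := fun c hc => (le_total a c).elim id fun h => ha hc h
    refine ⟨Set.Iio a, Set.ordConnected_Iio, lt_of_le_of_ne (hlo a haC) ?_, fun c hc hcI => ?_,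
      a, haC, a, haC, Or.inr (Or.inr (Or.inr (by simp)))⟩
    · rintro rfl
      exact htC haC
    · exact absurd (ha' c hc) (not_le.2 hcI)

/-- Projection along one coordinate preserves semialgebraic sets. -/
theorem exists_consOpt {A : Set (Option ι → ℝ)} (hA : IsSemialgebraic A) :
    IsSemialgebraic {x | ∃ t, consOpt x t ∈ A} := by
  classical
  obtain ⟨F, hF⟩ := exists_isMaximalTame ι
  obtain ⟨s, hs⟩ := hA.exists_sign_family hF
  choose L hL using fun q : Polynomial F => hF.exists_coversRoots q.natDegree q le_rfl
  set C : Set ((ι → ℝ) → ℝ) := insert (fun _ => 0) (⋃ q ∈ s, L q) with hC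
  have hCfin : C.Finite :=
    (s.finite_toSet.biUnion fun q _ => (hL q).finite).insert _
  have hCF : ∀ f ∈ C, f ∈ F := by
    rintro f (rfl | hf)
    · exact hF.const 0
    · simp only [Set.mem_iUnion] at hf
      obtain ⟨q, -, hf⟩ := hf
      exact (hL q).subset f hf
  have hmid : ∀ a ∈ C, ∀ b ∈ C, (fun x => (a x + b x) / 2) ∈ F := fun a ha b hb => by
    have := mul_mem (add_mem (hCF a ha) (hCF b hb)) (hF.const (1 / 2))
    convert this using 1
    ext x
    simp [div_eq_mul_inv]
  have hiff : {x | ∃ t, consOpt x t ∈ A} = {x | ∃ a ∈ C, ∃ b ∈ C, consOpt x (a x) ∈ A ∨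
      consOpt x ((a x + b x) / 2) ∈ A ∨ consOpt x (a x + 1) ∈ A ∨ consOpt x (a x - 1) ∈ A} := by
    ext x
    constructor
    · rintro ⟨t, ht⟩
      obtain ⟨I, hI, htI, hCI, _, ⟨a, ha, rfl⟩, _, ⟨b, hb, rfl⟩, htest⟩ :=
        exists_test_point (hCfin.image fun f => f x) ⟨0, fun _ => 0, by simp [hC], rfl⟩ t
      have hmove : ∀ u ∈ I, consOpt x u ∈ A := by
        intro u hu
        by_cases hpt : ∃ c, I = {c}
        · obtain ⟨c, rfl⟩ := hpt
          rw [Set.mem_singleton_iff] at htI hu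
          rwa [hu, ← htI]
        refine hs x I hI (fun q hq hq0 v hv h0 => ?_) t htI u hu ht
        obtain ⟨r, hr, hrv⟩ := (hL q).covers x v hq0 h0
        exact hpt ⟨v, hCI v ⟨r, Set.mem_insert_of_mem _ (Set.mem_biUnion hq hr), hrv⟩ hv⟩
      exact ⟨a, ha, b, hb, htest.imp (hmove _) (Or.imp (hmove _) (Or.imp (hmove _) (hmove _)))⟩
    · rintro ⟨a, -, b, -, h | h | h | h⟩
      exacts [⟨_, h⟩, ⟨_, h⟩, ⟨_, h⟩, ⟨_, h⟩]
  rw [hiff]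
  refine .exists_mem hCfin fun a ha => .exists_mem hCfin fun b hb => ?_
  exact (hA.subst_tame hF (hCF a ha)).or <| (hA.subst_tame hF (hmid a ha b hb)).or <|
    (hA.subst_tame hF (add_mem (hCF a ha) (hF.const 1))).or
      (hA.subst_tame hF (sub_mem (hCF a ha) (hF.const 1)))

/-- The Tarski–Seidenberg theorem: projections of semialgebraic sets are semialgebraic. -/
theorem exists_fun [Finite κ] : ∀ {ι : Type} {P : (ι → ℝ) → (κ → ℝ) → Prop},
    IsSemialgebraic {v : ι ⊕ κ → ℝ | P (v ∘ Sum.inl) (v ∘ Sum.inr)} →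
    IsSemialgebraic {x | ∃ w, P x w} := by
  induction κ using Finite.induction_empty_option with
  | @of_equiv α β e ih =>
    intro ι P h
    have := @ih ι (fun x w => P x (w ∘ e.symm))
      (h.preimage (g := fun v => Sum.elim (v ∘ Sum.inl) (v ∘ Sum.inr ∘ e.symm)) (by
        rintro (i | k)
        exacts [polyFun_coord _, polyFun_coord _]))
    convert this using 3 with x
    exact ⟨fun ⟨w, hw⟩ => ⟨w ∘ e, by simpa [Function.comp_assoc] using hw⟩, fun ⟨w, hw⟩ => ⟨_, hw⟩⟩
  | h_empty =>
    intro ι P h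
    have := h.preimage (g := fun x : ι → ℝ => Sum.elim x PEmpty.elim) (by
      rintro (i | k)
      exacts [polyFun_coord _, k.elim])
    convert this using 3 with x
    constructor
    · rintro ⟨w, hw⟩
      have : w = PEmpty.elim := Subsingleton.elim _ _
      simpa [this] using hw
    · intro hw
      exact ⟨PEmpty.elim, hw⟩
  | @h_option α _ ih =>
    intro ι P h
    have h1 := (h.preimage (ι := Option (ι ⊕ α))
      (g := fun v => Sum.elim (fun i => v (some (Sum.inl i)))
        (fun o => o.elim (v none) fun a => v (some (Sum.inr a)))) (by
        rintro (i | _ | a)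
        exacts [polyFun_coord _, polyFun_coord _, polyFun_coord _])).exists_consOpt
    have := @ih ι (fun x w => ∃ t, P x fun o => o.elim t w) h1
    convert this using 3 with x
    constructor
    · rintro ⟨w, hw⟩
      refine ⟨w ∘ some, w none, ?_⟩
      convert hw using 1
      ext o
      cases o <;> rfl
    · rintro ⟨w, t, hw⟩
      exact ⟨_, hw⟩

theorem forall_fun [Finite κ] {P : (ι → ℝ) → (κ → ℝ) → Prop}
    (h : IsSemialgebraic {v : ι ⊕ κ → ℝ | P (v ∘ Sum.inl) (v ∘ Sum.inr)}) :
    IsSemialgebraic {x | ∀ w, P x w} := by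
  simpa only [not_exists, not_not] using
    (exists_fun (P := fun x w => ¬ P x w) h.not).not

theorem exists_real {P : (ι → ℝ) → ℝ → Prop}
    (h : IsSemialgebraic {v : Option ι → ℝ | P (v ∘ some) (v none)}) :
    IsSemialgebraic {x | ∃ t, P x t} := h.exists_consOpt

/-- The countable fibres of a semialgebraic family of subsets of `ℝ` have bounded cardinality. -/
theorem exists_bound_real {A : Set (Option ι → ℝ)} (hA : IsSemialgebraic A) :
    ∃ d : ℕ, ∀ x, {t | consOpt x t ∈ A}.Countable → {t | consOpt x t ∈ A}.encard ≤ d := by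
  classical
  obtain ⟨F, hF⟩ := exists_isMaximalTame ι
  obtain ⟨s, hs⟩ := hA.exists_sign_family hF
  refine ⟨∑ q ∈ s, q.natDegree, fun x hx => ?_⟩
  set R : Finset ℝ := s.biUnion fun q => (q.map (evalAt F x)).roots.toFinset with hR
  -- a point of the fibre that is no root would come with a whole interval
  have hsub : {t | consOpt x t ∈ A} ⊆ R := by
    intro t ht
    by_contra htR
    have hopen : (R : Set ℝ)ᶜ ∈ 𝓝 t := R.finite_toSet.isClosed.isOpen_compl.mem_nhds htR
    obtain ⟨ε, hε, hball⟩ := Metric.mem_nhds_iff.1 hopen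
    rw [Real.ball_eq_Ioo] at hball
    have hI : Set.Ioo (t - ε) (t + ε) ⊆ {t | consOpt x t ∈ A} := by
      refine fun u hu => hs x (Set.Ioo (t - ε) (t + ε)) Set.ordConnected_Ioo ?_ t
        ⟨by linarith, by linarith⟩ u hu ht
      intro q hq hq0 v hv h0
      refine hball hv ?_
      simp only [hR, Finset.coe_biUnion, Set.mem_iUnion, Finset.mem_coe, Multiset.mem_toFinset]
      exact ⟨q, hq, (Polynomial.mem_roots hq0).2 h0⟩
    exact (Cardinal.Real.Ioo_countable_iff.1 (hx.mono hI)).not_gt (by linarith)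
  refine (Set.encard_le_encard hsub).trans ?_
  rw [Set.encard_coe_eq_coe_finsetCard]
  refine Nat.cast_le.2 (Finset.card_biUnion_le.trans (Finset.sum_le_sum fun q _ => ?_))
  exact (Multiset.toFinset_card_le _).trans
    ((Polynomial.card_roots' _).trans Polynomial.natDegree_map_le)

/-- The countable fibres of a semialgebraic family have bounded cardinality. -/
theorem exists_bound [Finite κ] {E : (ι → ℝ) → Set (κ → ℝ)}
    (hE : IsSemialgebraic {v : ι ⊕ κ → ℝ | v ∘ Sum.inr ∈ E (v ∘ Sum.inl)}) :
    ∃ d : ℕ, ∀ x, (E x).Countable → (E x).encard ≤ d := by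
  classical
  have : Fintype κ := Fintype.ofFinite κ
  have hproj : ∀ k : κ, ∃ d : ℕ, ∀ x, (E x).Countable →
      ((fun w => w k) '' E x).encard ≤ d := by
    intro k
    have h : IsSemialgebraic {v : Option ι → ℝ | ∃ w ∈ E (v ∘ some), w k = v none} := by
      refine exists_fun (P := fun v w => w ∈ E (v ∘ some) ∧ w k = v none) (.and ?_ ?_)
      · exact hE.preimage (g := fun v : Option ι ⊕ κ → ℝ =>
          Sum.elim (fun i => v (Sum.inl (some i))) (fun k => v (Sum.inr k))) (by
          rintro (i | k)
          exacts [polyFun_coord _, polyFun_coord _])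
      · exact polyFun_eq (polyFun_coord _) (polyFun_coord _)
    obtain ⟨d, hd⟩ := h.exists_bound_real
    exact ⟨d, fun x hx => hd x (hx.image _)⟩
  choose d hd using hproj
  refine ⟨∏ k, d k, fun x hx => ?_⟩
  have hfin : ∀ k, ((fun w => w k) '' E x).Finite := fun k =>
    Set.finite_of_encard_le_coe (hd k x hx)
  have hsub : E x ⊆ (Fintype.piFinset fun k => (hfin k).toFinset : Finset (κ → ℝ)) := by
    intro w hw
    simp only [Finset.mem_coe, Fintype.mem_piFinset, Set.Finite.mem_toFinset]
    exact fun k => ⟨w, hw, rfl⟩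
  refine (Set.encard_le_encard hsub).trans ?_
  rw [Set.encard_coe_eq_coe_finsetCard, Fintype.card_piFinset]
  refine Nat.cast_le.2 (Finset.prod_le_prod' fun k _ => ?_)
  have := hd k x hx
  rw [(hfin k).encard_eq_coe_toFinset_card] at this
  exact_mod_cast this

/-- Off the zero set of a suitable nonzero polynomial, membership in a semialgebraic set is locally
constant. -/
theorem exists_locally_const [Finite ι] {A : Set (ι → ℝ)} (hA : IsSemialgebraic A) :
    ∃ D : MvPolynomial ι ℝ, D ≠ 0 ∧ ∀ x, MvPolynomial.aeval x D ≠ 0 →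
      ∀ᶠ z in 𝓝 x, (z ∈ A ↔ x ∈ A) := by
  induction hA with
  | pos p =>
    have hcont : Continuous fun x : ι → ℝ => MvPolynomial.aeval x p := by
      simpa [MvPolynomial.aeval_eq_eval] using MvPolynomial.continuous_eval p
    by_cases hp : p = 0
    · exact ⟨1, one_ne_zero, fun x _ => by simp [hp]⟩
    refine ⟨p, hp, fun x hx => ?_⟩
    rcases lt_or_gt_of_ne hx with h | h
    · filter_upwards [hcont.continuousAt.eventually_lt continuousAt_const h] with z hz
      exact ⟨fun h' => absurd h' hz.le.not_gt, fun h' => absurd h' h.le.not_gt⟩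
    · filter_upwards [continuousAt_const.eventually_lt hcont.continuousAt h] with z hz
      exact ⟨fun _ => h, fun _ => hz⟩
  | compl _ ih =>
    obtain ⟨D, hD, h⟩ := ih
    exact ⟨D, hD, fun x hx => (h x hx).mono fun z hz => not_congr hz⟩
  | inter _ _ ih₁ ih₂ =>
    obtain ⟨D₁, hD₁, h₁⟩ := ih₁
    obtain ⟨D₂, hD₂, h₂⟩ := ih₂
    refine ⟨D₁ * D₂, mul_ne_zero hD₁ hD₂, fun x hx => ?_⟩
    rw [map_mul] at hx
    filter_upwards [h₁ x (left_ne_zero_of_mul hx), h₂ x (right_ne_zero_of_mul hx)] with z hz₁ hz₂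
    exact and_congr hz₁ hz₂

/-- A semialgebraic null set lies in the zero set of a nonzero polynomial. -/
theorem exists_vanishing_of_null [Fintype ι] {A : Set (ι → ℝ)} (hA : IsSemialgebraic A)
    (hnull : MeasureTheory.volume A = 0) :
    ∃ D : MvPolynomial ι ℝ, D ≠ 0 ∧ ∀ x, MvPolynomial.aeval x D ≠ 0 → x ∉ A := by
  obtain ⟨D, hD, h⟩ := hA.exists_locally_const
  refine ⟨D, hD, fun x hx hxA => ?_⟩
  have hmem : A ∈ 𝓝 x := (h x hx).mono fun z hz => hz.2 hxA
  exact (MeasureTheory.Measure.measure_pos_of_mem_nhds _ hmem).ne' hnull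

end IsSemialgebraic

end HDDegree

namespace HDDegree

variable {ι κ : Type}

/-! ### Gradients, tangent vectors and linear maps -/

lemma grad_add (p q : MvPolynomial ι ℝ) (x : ι → ℝ) : grad (p + q) x = grad p x + grad q x := by
  ext i
  simp [grad]

lemma grad_mul (p q : MvPolynomial ι ℝ) (x : ι → ℝ) : grad (p * q) x
    = MvPolynomial.aeval x p • grad q x + MvPolynomial.aeval x q • grad p x := by
  ext i
  simp [grad, Derivation.leibniz]

lemma mem_vanishingIdeal {S : Set (ι → ℝ)} {p : MvPolynomial ι ℝ} :
    p ∈ MvPolynomial.vanishingIdeal ℝ S ↔ ∀ x ∈ S, MvPolynomial.aeval x p = 0 :=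
  MvPolynomial.mem_vanishingIdeal_iff

variable [Fintype ι] [Fintype κ]

/-- The differential of a polynomial, as a continuous linear form. -/
noncomputable def gradCLM (p : MvPolynomial ι ℝ) (x : ι → ℝ) : (ι → ℝ) →L[ℝ] ℝ :=
  ∑ i, grad p x i • ContinuousLinearMap.proj i

@[simp] lemma gradCLM_apply (p : MvPolynomial ι ℝ) (x a : ι → ℝ) :
    gradCLM p x a = grad p x ⬝ᵥ a := by
  simp [gradCLM, dotProduct]

lemma contDiff_aeval (p : MvPolynomial ι ℝ) {n : WithTop ℕ∞} :
    ContDiff ℝ n fun x : ι → ℝ => MvPolynomial.aeval x p := by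
  induction p using MvPolynomial.induction_on with
  | C a => simpa using contDiff_const
  | add p q hp hq => simpa only [map_add] using hp.add hq
  | mul_X p i hp =>
    simp only [map_mul, MvPolynomial.aeval_X]
    exact hp.mul (contDiff_apply ℝ ℝ i)

lemma continuous_aeval (p : MvPolynomial ι ℝ) :
    Continuous fun x : ι → ℝ => MvPolynomial.aeval x p :=
  (contDiff_aeval p (n := 0)).continuous

lemma hasStrictFDerivAt_aeval (p : MvPolynomial ι ℝ) (x : ι → ℝ) :
    HasStrictFDerivAt (fun x : ι → ℝ => MvPolynomial.aeval x p) (gradCLM p x) x := by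
  classical
  induction p using MvPolynomial.induction_on with
  | C a =>
    simp only [MvPolynomial.algHom_C]
    exact (hasStrictFDerivAt_const _ x).congr_fderiv (ContinuousLinearMap.ext fun a => by
      simp [grad, dotProduct])
  | add p q hp hq =>
    simp only [map_add]
    exact (hp.add hq).congr_fderiv (ContinuousLinearMap.ext fun a => by
      simp [grad_add, add_dotProduct])
  | mul_X p i hp =>
    simp only [map_mul, MvPolynomial.aeval_X]
    refine (hp.mul (hasStrictFDerivAt_apply i x)).congr_fderiv (ContinuousLinearMap.ext fun a => ?_)
    have : grad (MvPolynomial.X i) x ⬝ᵥ a = a i := by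
      simp [grad, dotProduct, MvPolynomial.pderiv_X, Pi.single_apply, apply_ite]
    simp [grad_mul, add_dotProduct, this]

lemma continuous_grad (p : MvPolynomial ι ℝ) : Continuous (grad p) :=
  continuous_pi fun _ => continuous_aeval _

lemma contDiff_grad (p : MvPolynomial ι ℝ) {n : WithTop ℕ∞} : ContDiff ℝ n (grad p) :=
  contDiff_pi.2 fun _ => contDiff_aeval _

/-- Velocities of differentiable families of points of `S` are tangent to `S`. -/
lemma fderiv_mem_tangentSpace {F : Type*} [NormedAddCommGroup F] [NormedSpace ℝ F]
    {S : Set (ι → ℝ)} {φ : F → ι → ℝ} {φ' : F →L[ℝ] ι → ℝ} {u : F} (h : HasFDerivAt φ φ' u)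
    (hS : ∀ᶠ v in 𝓝 u, φ v ∈ S) (a : F) : φ' a ∈ tangentSpace S (φ u) := by
  intro p hp
  have h1 : HasFDerivAt (fun v => MvPolynomial.aeval (φ v) p) ((gradCLM p (φ u)).comp φ') u :=
    (hasStrictFDerivAt_aeval p (φ u)).hasFDerivAt.comp u h
  have h2 : HasFDerivAt (fun v => MvPolynomial.aeval (φ v) p) (0 : F →L[ℝ] ℝ) u :=
    (hasFDerivAt_const (0 : ℝ) u).congr_of_eventuallyEq
      (hS.mono fun v hv => mem_vanishingIdeal.1 hp _ hv)
  simpa using congrArg (fun L => L a) (h1.unique h2)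

lemma exists_comp_linear (L : (ι → ℝ) →ₗ[ℝ] κ → ℝ) (p : MvPolynomial κ ℝ) :
    ∃ q : MvPolynomial ι ℝ, (∀ x, MvPolynomial.aeval x q = MvPolynomial.aeval (L x) p) ∧
      ∀ x a, grad q x ⬝ᵥ a = grad p (L x) ⬝ᵥ L a := by
  classical
  obtain ⟨q, hq⟩ := mem_polyFun.1 (polyFun_aeval p (g := L) fun k => by
    have : (fun x => L x k) = ∑ i, (fun x : ι → ℝ => x i * L (Pi.single i 1) k) := by
      ext x
      conv_lhs => rw [pi_eq_sum_univ' x]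
      simp [Finset.sum_apply]
    rw [this]
    exact sum_mem fun i _ => mul_mem (polyFun_coord i) (polyFun_const _))
  refine ⟨q, fun x => (hq x).symm, fun x a => ?_⟩
  have h1 := (hasStrictFDerivAt_aeval q x).hasFDerivAt
  have h2 := (hasStrictFDerivAt_aeval p (L x)).hasFDerivAt.comp x
    (LinearMap.toContinuousLinearMap L).hasFDerivAt
  have h3 : (fun x => MvPolynomial.aeval x q) = (fun y => MvPolynomial.aeval y p) ∘
    (LinearMap.toContinuousLinearMap L) := funext fun x => (hq x).symm
  rw [h3] at h1
  simpa using congrArg (fun L => L a) (h1.unique h2)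

lemma map_mem_tangentSpace {S : Set (ι → ℝ)} {S' : Set (κ → ℝ)} (L : (ι → ℝ) →ₗ[ℝ] κ → ℝ)
    (hL : ∀ x ∈ S, L x ∈ S') {x a : ι → ℝ} (ha : a ∈ tangentSpace S x) :
    L a ∈ tangentSpace S' (L x) := by
  intro p hp
  obtain ⟨q, hq, hgrad⟩ := exists_comp_linear L p
  rw [← hgrad]
  exact ha q (mem_vanishingIdeal.2 fun z hz => by
    rw [hq]
    exact mem_vanishingIdeal.1 hp _ (hL z hz))

/-! ### Orthogonal decompositions -/

lemma exists_add_orth (T : Submodule ℝ (ι → ℝ)) (v : ι → ℝ) :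
    ∃ a ∈ T, ∃ w, (∀ b ∈ T, w ⬝ᵥ b = 0) ∧ v = a + w := by
  let e : EuclideanSpace ℝ ι ≃ₗ[ℝ] (ι → ℝ) := WithLp.linearEquiv 2 ℝ (ι → ℝ)
  let T' : Submodule ℝ (EuclideanSpace ℝ ι) := T.comap e.toLinearMap
  obtain ⟨a, ha, w, hw, hv⟩ := T'.exists_add_mem_mem_orthogonal (e.symm v)
  refine ⟨e a, ha, e w, fun b hb => ?_, ?_⟩
  · have := (Submodule.mem_orthogonal _ _).1 hw (e.symm b) (by simpa [T'] using hb)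
    rw [EuclideanSpace.inner_eq_star_dotProduct] at this
    simpa [e] using this
  · rw [← map_add, ← hv, e.apply_symm_apply]

lemma dotProduct_self_eq_zero_real {w : ι → ℝ} (h : w ⬝ᵥ w = 0) : w = 0 :=
  dotProduct_self_eq_zero.1 h

/-- A vector orthogonal to the common kernel of finitely many linear forms is a combination of
these forms. -/
lemma exists_coeff_of_orth {σ : Type*} [Fintype σ] (v : σ → ι → ℝ) {w : ι → ℝ}
    (hw : ∀ a, (∀ j, v j ⬝ᵥ a = 0) → w ⬝ᵥ a = 0) : ∃ c : σ → ℝ, w = ∑ j, c j • v j := by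
  obtain ⟨a, ha, b, hb, hab⟩ := exists_add_orth (Submodule.span ℝ (Set.range v)) w
  have hb0 : b = 0 := by
    apply dotProduct_self_eq_zero_real
    have h1 : w ⬝ᵥ b = 0 := hw b fun j => by
      rw [dotProduct_comm]
      exact hb _ (Submodule.subset_span ⟨j, rfl⟩)
    rwa [hab, add_dotProduct, dotProduct_comm a b, hb a ha, zero_add] at h1
  rw [hb0, add_zero] at hab
  rw [hab]
  obtain ⟨c, hc⟩ := (Submodule.mem_span_range_iff_exists_fun ℝ).1 ha
  exact ⟨c, hc.symm⟩

lemma surjective_dotProduct {k : ℕ} {v : Fin k → ι → ℝ} (hv : LinearIndependent ℝ v)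
    (c : Fin k → ℝ) : ∃ a, ∀ j, v j ⬝ᵥ a = c j := by
  have h1 : (Matrix.of v).rank = k := by
    have : LinearIndependent ℝ (Matrix.of v).row := hv
    simpa using this.rank_matrix
  have h2 : LinearMap.range (Matrix.of v).mulVecLin = ⊤ := by
    apply Submodule.eq_top_of_finrank_eq
    rw [Module.finrank_fin_fun]
    exact h1
  obtain ⟨a, ha⟩ := LinearMap.range_eq_top.1 h2 c
  exact ⟨a, fun j => congrFun ha j⟩

/-! ### Local parametrizations of a real algebraic set at its regular points -/

/-- Near a regular point `x₀` the set `S` is the image of a `C¹` chart `φ`, whose differential maps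
onto the tangent space at every point; the gradients of the defining polynomials cut out these
tangent spaces. -/
theorem exists_chart {S : Set (ι → ℝ)} {x₀ : ι → ℝ} (hx₀ : x₀ ∈ S) {k : ℕ}
    {P : Fin k → MvPolynomial ι ℝ} (hP : ∀ j, P j ∈ MvPolynomial.vanishingIdeal ℝ S)
    (hli : LinearIndependent ℝ fun j => grad (P j) x₀) {O : Set (ι → ℝ)} (hO : IsOpen O)
    (hxO : x₀ ∈ O) (hOS : ∀ z ∈ O, (∀ j, MvPolynomial.aeval z (P j) = 0) → z ∈ S) :
    ∃ (K : Submodule ℝ (ι → ℝ)) (φ : K → ι → ℝ) (U : Set K), IsOpen U ∧ 0 ∈ U ∧ φ 0 = x₀ ∧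
      Module.finrank ℝ K + k = Fintype.card ι ∧
      (∀ u ∈ U, ContDiffAt ℝ 1 φ u ∧ φ u ∈ S ∧
        (∀ a ∈ tangentSpace S (φ u), ∃ b, fderiv ℝ φ u b = a) ∧
        ∀ a, (∀ j, grad (P j) (φ u) ⬝ᵥ a = 0) → a ∈ tangentSpace S (φ u)) ∧
      ∀ᶠ x in 𝓝 x₀, x ∈ S → ∃ u ∈ U, φ u = x := by
  classical
  set Pm : (ι → ℝ) → Fin k → ℝ := fun z j => MvPolynomial.aeval z (P j) with hPm
  set Pm' : (ι → ℝ) → (ι → ℝ) →L[ℝ] Fin k → ℝ :=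
    fun z => ContinuousLinearMap.pi fun j => gradCLM (P j) z with hPm'
  set K : Submodule ℝ (ι → ℝ) := LinearMap.ker (Pm' x₀).toLinearMap with hK
  obtain ⟨prl, hprl⟩ := LinearMap.exists_leftInverse_of_injective K.subtype K.ker_subtype
  set pr : (ι → ℝ) →L[ℝ] K := LinearMap.toContinuousLinearMap prl with hpr
  have hprK : ∀ a (ha : a ∈ K), pr a = ⟨a, ha⟩ := fun a ha =>
    LinearMap.congr_fun hprl ⟨a, ha⟩
  -- `Θ` is a local diffeomorphism at `x₀`; the chart is its inverse on `{0} × K`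
  set Θ : (ι → ℝ) → (Fin k → ℝ) × K := fun z => (Pm z, pr (z - x₀)) with hΘ
  set Θ' : (ι → ℝ) → (ι → ℝ) →L[ℝ] (Fin k → ℝ) × K := fun z => (Pm' z).prod pr with hΘ'
  have hΘsmooth : ContDiff ℝ 1 Θ :=
    (contDiff_pi.2 fun j => contDiff_aeval (P j)).prodMk
      (pr.contDiff.comp (contDiff_id.sub contDiff_const))
  have hΘder : ∀ z, HasFDerivAt Θ (Θ' z) z := fun z =>
    (hasFDerivAt_pi.2 fun j => (hasStrictFDerivAt_aeval (P j) z).hasFDerivAt).prodMk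
      (pr.hasFDerivAt.comp z ((hasFDerivAt_id z).sub_const x₀))
  have hsurj : ∀ c, ∃ a, Pm' x₀ a = c := fun c => by
    obtain ⟨a, ha⟩ := surjective_dotProduct hli c
    exact ⟨a, funext fun j => by simpa [hPm'] using ha j⟩
  have hbij : Function.Bijective (Θ' x₀) := by
    constructor
    · rw [injective_iff_map_eq_zero]
      intro a ha
      have h1 : a ∈ K := congrArg Prod.fst ha
      have h2 : pr a = 0 := congrArg Prod.snd ha
      rw [hprK a h1] at h2
      exact congrArg Subtype.val h2
    · rintro ⟨c, u⟩
      obtain ⟨a, ha⟩ := hsurj c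
      refine ⟨a + (u - pr a : K), Prod.ext ?_ ?_⟩
      · change Pm' x₀ (a + (u - pr a : K)) = c
        have : Pm' x₀ ((u - pr a : K) : ι → ℝ) = 0 := (u - pr a).2
        rw [map_add, this, ha, add_zero]
      · change pr (a + (u - pr a : K)) = u
        rw [map_add, hprK _ (u - pr a).2]
        exact add_sub_cancel _ _
  let A : (ι → ℝ) ≃L[ℝ] (Fin k → ℝ) × K :=
    (LinearEquiv.ofBijective (Θ' x₀).toLinearMap hbij).toContinuousLinearEquiv
  have hA : (A : (ι → ℝ) →L[ℝ] (Fin k → ℝ) × K) = Θ' x₀ := by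
    ext1 a
    rfl
  have hder₀ : HasFDerivAt Θ (A : (ι → ℝ) →L[ℝ] (Fin k → ℝ) × K) x₀ := hA ▸ hΘder x₀
  set e := hΘsmooth.contDiffAt.toOpenPartialHomeomorph Θ hder₀ one_ne_zero with he
  have heΘ : ∀ z, e z = Θ z := fun z => rfl
  have hsrc : x₀ ∈ e.source := hΘsmooth.contDiffAt.mem_toOpenPartialHomeomorph_source hder₀ _
  have hΘ₀ : Θ x₀ = (0, 0) := by
    refine Prod.ext (funext fun j => ?_) ?_
    · exact mem_vanishingIdeal.1 (hP j) x₀ hx₀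
    · simp [hΘ]
  have htgt : ((0, 0) : (Fin k → ℝ) × K) ∈ e.target := by
    rw [← hΘ₀]
    exact e.map_source hsrc
  have hsymm₀ : e.symm (0, 0) = x₀ := by
    rw [← hΘ₀]
    exact e.left_inv hsrc
  have hsmooth₀ : ContDiffAt ℝ 1 e.symm (0, 0) := by
    refine e.contDiffAt_symm (f₀' := A) htgt ?_ hΘsmooth.contDiffAt
    rw [hsymm₀]
    exact hder₀
  have hcont : Continuous fun u : K => ((0, u) : (Fin k → ℝ) × K) := by fun_prop
  have hgood : ∀ᶠ w in 𝓝 ((0, 0) : (Fin k → ℝ) × K), w ∈ e.target ∧ ContDiffAt ℝ 1 e.symm w ∧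
      e.symm w ∈ O ∧ LinearIndependent ℝ fun j => grad (P j) (e.symm w) := by
    refine Filter.Eventually.and (e.open_target.mem_nhds htgt)
      ((hsmooth₀.eventually (by simp)).and ?_)
    have hc₀ : Filter.Tendsto e.symm (𝓝 (0, 0)) (𝓝 x₀) := hsymm₀ ▸ hsmooth₀.continuousAt
    refine hc₀.eventually (p := fun z => z ∈ O ∧ LinearIndependent ℝ fun j => grad (P j) z) ?_
    refine Filter.Eventually.and (hO.mem_nhds hxO) ?_
    have hc : Continuous fun z => fun j => grad (P j) z :=
      continuous_pi fun j => continuous_grad (P j)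
    exact hc.continuousAt.eventually (isOpen_setOfPred_linearIndependent.mem_nhds hli)
  obtain ⟨U, hUgood, hUo, hU0⟩ := eventually_nhds_iff.1
    ((hcont.tendsto (0 : K)).eventually hgood)
  have hΘφ : ∀ u ∈ U, Θ (e.symm (0, u)) = (0, u) := fun u hu => e.right_inv (hUgood u hu).1
  have hφS : ∀ u ∈ U, e.symm (0, u) ∈ S := fun u hu =>
    hOS _ (hUgood u hu).2.2.1 fun j => congrFun (congrArg Prod.fst (hΘφ u hu)) j
  refine ⟨K, fun u => e.symm (0, u), U, hUo, hU0, hsymm₀, ?_, fun u hu => ?_, ?_⟩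
  · have h1 := (Pm' x₀).toLinearMap.finrank_range_add_finrank_ker
    rw [LinearMap.range_eq_top.2 hsurj, finrank_top, Module.finrank_fin_fun,
      Module.finrank_fintype_fun_eq_card] at h1
    rw [← h1, add_comm]
  · obtain ⟨hut, hsm, -, hliu⟩ := hUgood u hu
    have hinl : ContDiff ℝ 1 fun u : K => ((0, u) : (Fin k → ℝ) × K) :=
      contDiff_const.prodMk contDiff_id
    have hφsm : ContDiffAt ℝ 1 (fun u : K => e.symm (0, u)) u := hsm.comp u hinl.contDiffAt
    have hnear : ∀ᶠ v in 𝓝 u, e.symm (0, v) ∈ S := by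
      filter_upwards [hUo.mem_nhds hu] with v hv using hφS v hv
    have hφd := (hφsm.differentiableAt one_ne_zero).hasFDerivAt
    -- the kernel of the differentials of the `P j` is the range of the differential of the chart
    have hker : ∀ a, (∀ j, grad (P j) (e.symm (0, u)) ⬝ᵥ a = 0) →
        fderiv ℝ (fun u : K => e.symm (0, u)) u (pr a) = a := by
      intro a ha
      have hd1 := (hsm.differentiableAt one_ne_zero).hasFDerivAt
      have hinl' : HasFDerivAt (fun u : K => ((0, u) : (Fin k → ℝ) × K))
          (ContinuousLinearMap.inr ℝ (Fin k → ℝ) K) u :=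
        (hasFDerivAt_const _ u).prodMk (hasFDerivAt_id u)
      have hφd2 := (HasFDerivAt.comp u (f := fun u : K => ((0, u) : (Fin k → ℝ) × K)) hd1 hinl')
      have hd1' : HasFDerivAt e.symm (fderiv ℝ e.symm (0, u)) (Θ (e.symm (0, u))) := by
        rw [hΘφ u hu]
        exact hd1
      have hcomp := hd1'.comp (e.symm (0, u)) (hΘder (e.symm (0, u)))
      have hid : HasFDerivAt (e.symm ∘ Θ) (ContinuousLinearMap.id ℝ (ι → ℝ)) (e.symm (0, u)) :=
        (hasFDerivAt_id _).congr_of_eventuallyEq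
          (Filter.eventuallyEq_of_mem (e.open_source.mem_nhds (e.map_target hut))
            fun z hz => e.left_inv hz)
      have heq := congrArg (fun L => L a) (hcomp.unique hid)
      have hΘa : Θ' (e.symm (0, u)) a = (0, pr a) :=
        Prod.ext (funext fun j => by simpa [hΘ', hPm'] using ha j) rfl
      rw [hφd.unique hφd2]
      simpa [hΘa] using heq
    refine ⟨hφsm, hφS u hu, fun a ha => ⟨pr a, hker a fun j => ha _ (hP j)⟩, fun a ha => ?_⟩
    rw [← hker a ha]
    exact fderiv_mem_tangentSpace hφd hnear _
  · have hUn : U ∈ 𝓝 (pr (x₀ - x₀)) := by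
      rw [sub_self, map_zero]
      exact hUo.mem_nhds hU0
    have hpc : Continuous fun x => pr (x - x₀) := by fun_prop
    filter_upwards [e.open_source.mem_nhds hsrc, hpc.continuousAt.eventually hUn] with x hx hxU hxS
    refine ⟨pr (x - x₀), hxU, ?_⟩
    have : Θ x = (0, pr (x - x₀)) :=
      Prod.ext (funext fun j => mem_vanishingIdeal.1 (hP j) x hxS) rfl
    rw [← this]
    exact e.left_inv hx

end HDDegree

namespace HDDegree

variable {ι κ : Type} [Fintype ι] [Fintype κ]

/-! ### The regularity criterion -/

/-- The vectors orthogonal to a subspace of `ℝ^ι`. -/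
def orthVec (T : Submodule ℝ (ι → ℝ)) : Submodule ℝ (ι → ℝ) where
  carrier := {w | ∀ a ∈ T, w ⬝ᵥ a = 0}
  zero_mem' := by simp
  add_mem' := by
    intro v w hv hw a ha
    rw [add_dotProduct, hv a ha, hw a ha, add_zero]
  smul_mem' := by
    intro c v hv a ha
    rw [smul_dotProduct, hv a ha, smul_zero]

section Param

variable {F : Type*} [NormedAddCommGroup F] [NormedSpace ℝ F]
  [FiniteDimensional ℝ F]

/-- If `S` contains a family of points through `x` whose velocities exhaust the tangent space, then
all points near `x` are normal translates of points of `S` near `x`. -/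
lemma eventually_exists_normal {S : Set (ι → ℝ)} {φ : F → ι → ℝ} {φ' : F →L[ℝ] ι → ℝ}
    (hφ : HasStrictFDerivAt φ φ' 0) (hS : ∀ᶠ u in 𝓝 0, φ u ∈ S)
    (hT : ∀ a ∈ tangentSpace S (φ 0), ∃ b, φ' b = a) {O : Set (ι → ℝ)} (hO : O ∈ 𝓝 (φ 0)) :
    ∀ᶠ z in 𝓝 (φ 0), ∃ m ∈ S, m ∈ O ∧ z - m ∈ orthVec (tangentSpace S (φ 0)) := by
  have := FiniteDimensional.complete ℝ F
  set N := orthVec (tangentSpace S (φ 0)) with hN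
  have hH : HasStrictFDerivAt (fun q : F × N => φ q.1 + (q.2 : ι → ℝ))
      (φ'.comp (ContinuousLinearMap.fst ℝ F N) +
        N.subtypeL.comp (ContinuousLinearMap.snd ℝ F N)) ((0, 0) : F × N) :=
    (HasStrictFDerivAt.comp ((0, 0) : F × N) (f := Prod.fst) hφ hasStrictFDerivAt_fst).add
      (N.subtypeL.hasStrictFDerivAt.comp _ hasStrictFDerivAt_snd)
  have hsurj : (φ'.comp (ContinuousLinearMap.fst ℝ F N) +
      N.subtypeL.comp (ContinuousLinearMap.snd ℝ F N)).range = ⊤ := by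
    refine LinearMap.range_eq_top.2 fun v => ?_
    obtain ⟨a, ha, w, hw, rfl⟩ := exists_add_orth (tangentSpace S (φ 0)) v
    obtain ⟨b, rfl⟩ := hT a ha
    exact ⟨(b, ⟨w, hw⟩), rfl⟩
  have hmap := hH.map_nhds_eq_of_surj hsurj
  have hzero : φ (0 : F) + ((0 : N) : ι → ℝ) = φ 0 := by simp
  simp only [hzero] at hmap
  rw [← hmap, Filter.eventually_map]
  have hfst : Filter.Tendsto (Prod.fst : F × N → F) (𝓝 (0, 0)) (𝓝 0) :=
    continuous_fst.tendsto (0, 0)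
  filter_upwards [hfst.eventually hS, hfst.eventually (hφ.continuousAt.eventually hO)]
    with q hq hqO
  exact ⟨φ q.1, hq, hqO, by simp⟩

end Param

/-- If the differentials at `x` of finitely many polynomials have no common zero in `N`, then near
`x` these polynomials separate points that differ by an element of `N`. -/
lemma eventually_eq_of_sub_mem (P : κ → MvPolynomial ι ℝ) (x : ι → ℝ) (N : Submodule ℝ (ι → ℝ))
    (hN : ∀ w ∈ N, (∀ j, grad (P j) x ⬝ᵥ w = 0) → w = 0) :
    ∃ O ∈ 𝓝 x, ∀ a ∈ O, ∀ b ∈ O, a - b ∈ N →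
      (∀ j, MvPolynomial.aeval a (P j) = MvPolynomial.aeval b (P j)) → a = b := by
  set f' : (ι → ℝ) →L[ℝ] κ → ℝ := ContinuousLinearMap.pi fun j => gradCLM (P j) x with hf'
  have hf : HasStrictFDerivAt (fun z (j : κ) => MvPolynomial.aeval z (P j)) f' x :=
    hasStrictFDerivAt_pi.2 fun j => hasStrictFDerivAt_aeval (P j) x
  obtain ⟨K, hK, hanti⟩ := (f'.toLinearMap.comp N.subtype).exists_antilipschitzWith (by
    rw [LinearMap.ker_eq_bot']
    intro w hw
    refine Subtype.ext (hN w w.2 fun j => ?_)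
    simpa [hf'] using congrFun hw j)
  have hbound : ∀ w ∈ N, ‖w‖ ≤ K * ‖f' w‖ := fun w hw => by
    have := hanti.le_mul_norm (map_zero _) ⟨w, hw⟩
    exact this
  have hc : (0 : ℝ) < 1 / (2 * K) := by positivity
  have hev := hf.isLittleO.bound hc
  rw [nhds_prod_eq] at hev
  obtain ⟨pa, hpa, pb, hpb, hev⟩ := Filter.eventually_prod_iff.1 hev
  refine ⟨{z | pa z} ∩ {z | pb z}, Filter.inter_mem hpa hpb, fun a ha b hb hab heq => ?_⟩
  have h1 := hev ha.1 hb.2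
  have h2 : (fun j => MvPolynomial.aeval a (P j)) = fun j => MvPolynomial.aeval b (P j) :=
    funext heq
  simp only [h2, sub_self, zero_sub, norm_neg] at h1
  have h3 := hbound _ hab
  have hK' : (0 : ℝ) < K := hK
  have h4 : ‖a - b‖ ≤ 1 / 2 * ‖a - b‖ := by
    calc ‖a - b‖ ≤ K * ‖f' (a - b)‖ := h3
      _ ≤ K * (1 / (2 * K) * ‖a - b‖) := by gcongr
      _ = 1 / 2 * ‖a - b‖ := by field_simp
  have h5 : ‖a - b‖ = 0 := le_antisymm (by linarith) (norm_nonneg _)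
  exact sub_eq_zero.1 (norm_eq_zero.1 h5)

/-- Polynomials whose differentials cut out the tangent space define `S` near a point where all
nearby points are normal translates of points of `S`. -/
lemma eventually_mem_of_normal {S : Set (ι → ℝ)} {x : ι → ℝ}
    (h : ∀ O ∈ 𝓝 x, ∀ᶠ z in 𝓝 x, ∃ m ∈ S, m ∈ O ∧ z - m ∈ orthVec (tangentSpace S x))
    (P : κ → MvPolynomial ι ℝ) (hP : ∀ j, P j ∈ MvPolynomial.vanishingIdeal ℝ S)
    (hPT : ∀ a, (∀ j, grad (P j) x ⬝ᵥ a = 0) → a ∈ tangentSpace S x) :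
    ∀ᶠ z in 𝓝 x, (∀ j, MvPolynomial.aeval z (P j) = 0) → z ∈ S := by
  obtain ⟨O, hO, hsep⟩ := eventually_eq_of_sub_mem P x (orthVec (tangentSpace S x))
    fun w hw hw0 => dotProduct_self_eq_zero_real (hw w (hPT w hw0))
  filter_upwards [h O hO, hO] with z ⟨m, hm, hmO, hzm⟩ hzO hz
  rw [hsep z hzO m hmO hzm fun j => by rw [hz j, mem_vanishingIdeal.1 (hP j) m hm]]
  exact hm

/-- A point is regular if all points near it are normal translates of nearby points of `S`. -/
theorem mem_regularLocus_of_normal {S : Set (ι → ℝ)} {x : ι → ℝ} (hxS : x ∈ S)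
    (h : ∀ O ∈ 𝓝 x, ∀ᶠ z in 𝓝 x, ∃ m ∈ S, m ∈ O ∧ z - m ∈ orthVec (tangentSpace S x)) :
    x ∈ regularLocus S := by
  set G : Set (ι → ℝ) := (fun p => grad p x) '' MvPolynomial.vanishingIdeal ℝ S with hG
  obtain ⟨b, hbG, hspan, hli⟩ := exists_linearIndependent ℝ G
  have : Finite b := hli.finite
  obtain ⟨k, ⟨e⟩⟩ := Finite.exists_equiv_fin b
  have hP : ∀ j : Fin k, ∃ p ∈ MvPolynomial.vanishingIdeal ℝ S, grad p x = e.symm j :=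
    fun j => hbG (e.symm j).2
  choose P hPI hPg using hP
  refine ⟨hxS, k, P, hPI, ?_, ?_⟩
  · simp only [hPg]
    exact hli.comp _ e.symm.injective
  have hPT : ∀ a, (∀ j, grad (P j) x ⬝ᵥ a = 0) → a ∈ tangentSpace S x := by
    intro a ha p hp
    have hmem : grad p x ∈ Submodule.span ℝ b := by
      rw [hspan]
      exact Submodule.subset_span ⟨p, hp, rfl⟩
    refine Submodule.span_induction (p := fun v _ => v ⬝ᵥ a = 0) ?_ (by simp) ?_ ?_ hmem
    · intro v hv
      have := ha (e ⟨v, hv⟩)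
      rwa [hPg, Equiv.symm_apply_apply] at this
    · intro v w _ _ hv hw
      rw [add_dotProduct, hv, hw, add_zero]
    · intro c v _ hv
      rw [smul_dotProduct, hv, smul_zero]
  obtain ⟨O, hO, hOo, hxO⟩ := eventually_nhds_iff.1
    (eventually_mem_of_normal h P hPI hPT)
  exact ⟨O, hOo, hxO, hO⟩

section Param

variable {F : Type*} [NormedAddCommGroup F] [NormedSpace ℝ F]
  [FiniteDimensional ℝ F]

/-- A point is regular if some strictly differentiable family of points of `S` through it has
velocities that exhaust the tangent space. -/
theorem mem_regularLocus_of_param {S : Set (ι → ℝ)} {φ : F → ι → ℝ} {φ' : F →L[ℝ] ι → ℝ}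
    (hφ : HasStrictFDerivAt φ φ' 0) (hS : ∀ᶠ u in 𝓝 0, φ u ∈ S)
    (hT : ∀ a ∈ tangentSpace S (φ 0), ∃ b, φ' b = a) : φ 0 ∈ regularLocus S :=
  mem_regularLocus_of_normal hS.self_of_nhds fun _ hO => eventually_exists_normal hφ hS hT hO

end Param

/-- At a regular point there is a parametrization whose velocities exhaust the tangent space. -/
theorem exists_param_of_mem_regularLocus {S : Set (ι → ℝ)} {x : ι → ℝ}
    (hx : x ∈ regularLocus S) :
    ∃ (K : Submodule ℝ (ι → ℝ)) (φ : K → ι → ℝ) (φ' : K →L[ℝ] ι → ℝ), φ 0 = x ∧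
      HasStrictFDerivAt φ φ' 0 ∧ (∀ᶠ u in 𝓝 0, φ u ∈ S) ∧
      ∀ a ∈ tangentSpace S x, ∃ b, φ' b = a := by
  obtain ⟨hxS, k, P, hP, hli, O, hO, hxO, hOS⟩ := hx
  obtain ⟨K, φ, U, hU, h0, hφ0, -, hφ, -⟩ := exists_chart hxS hP hli hO hxO hOS
  refine ⟨K, φ, fderiv ℝ φ 0, hφ0, (hφ 0 h0).1.hasStrictFDerivAt one_ne_zero, ?_, ?_⟩
  · filter_upwards [hU.mem_nhds h0] with u hu using (hφ u hu).2.1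
  · have := (hφ 0 h0).2.2.1
    rwa [hφ0] at this

lemma map_mem_regularLocus {S : Set (ι → ℝ)} {S' : Set (κ → ℝ)} (L : (ι → ℝ) ≃ₗ[ℝ] κ → ℝ)
    (hL : ∀ x, L x ∈ S' ↔ x ∈ S) {x : ι → ℝ} (hx : x ∈ regularLocus S) :
    L x ∈ regularLocus S' := by
  obtain ⟨K, φ, φ', rfl, hφ, hS, hT⟩ := exists_param_of_mem_regularLocus hx
  let L' := LinearMap.toContinuousLinearMap L.toLinearMap
  refine mem_regularLocus_of_param (φ := fun u => L' (φ u))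
    (L'.hasStrictFDerivAt.comp 0 hφ) (hS.mono fun u hu => (hL _).2 hu) fun a ha => ?_
  have h1 := map_mem_tangentSpace (S' := S) L.symm.toLinearMap
    (fun z hz => (hL _).1 (by simpa using hz)) ha
  obtain ⟨b, hb⟩ := hT (L.symm a) (by simpa [L'] using h1)
  exact ⟨b, by simp [L', hb]⟩

/-! ### Generators of the vanishing ideal -/

/-- Finitely many polynomials generating the vanishing ideal define `S` and its tangent spaces. -/
lemma exists_generators {S : Set (ι → ℝ)} (hS : IsRealAlgebraic S) :
    ∃ (m : ℕ) (f : Fin m → MvPolynomial ι ℝ), (∀ j, f j ∈ MvPolynomial.vanishingIdeal ℝ S) ∧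
      (∀ x, x ∈ S ↔ ∀ j, MvPolynomial.aeval x (f j) = 0) ∧
      ∀ x ∈ S, ∀ a, a ∈ tangentSpace S x ↔ ∀ j, grad (f j) x ⬝ᵥ a = 0 := by
  obtain ⟨s, hs⟩ : (MvPolynomial.vanishingIdeal ℝ S).FG := IsNoetherian.noetherian _
  refine ⟨s.card, fun j => (s.equivFin.symm j : MvPolynomial ι ℝ), fun j => ?_, fun x => ?_, ?_⟩
  · rw [← hs]
    exact Ideal.subset_span (s.equivFin.symm j).2
  · constructor
    · exact fun hx j => mem_vanishingIdeal.1 (by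
        rw [← hs]
        exact Ideal.subset_span (s.equivFin.symm j).2) x hx
    · intro hx
      obtain ⟨I, rfl⟩ := hS
      rw [MvPolynomial.mem_zeroLocus_iff]
      intro p hp
      have hp' : p ∈ MvPolynomial.vanishingIdeal ℝ (MvPolynomial.zeroLocus ℝ I) :=
        mem_vanishingIdeal.2 fun z hz => MvPolynomial.mem_zeroLocus_iff.1 hz p hp
      rw [← hs] at hp'
      refine Submodule.span_induction (p := fun q _ => MvPolynomial.aeval x q = 0) ?_ (by simp)
        ?_ ?_ hp'
      · intro q hq
        simpa using hx (s.equivFin ⟨q, hq⟩)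
      · intro q r _ _ hq hr
        rw [map_add, hq, hr, add_zero]
      · intro c q _ hq
        rw [smul_eq_mul, map_mul, hq, mul_zero]
  · intro x hx a
    constructor
    · exact fun ha j => ha _ (by
        rw [← hs]
        exact Ideal.subset_span (s.equivFin.symm j).2)
    · intro ha p hp
      have hp' := hp
      rw [← hs] at hp'
      have key : p ∈ MvPolynomial.vanishingIdeal ℝ S ∧ grad p x ⬝ᵥ a = 0 := by
        refine Submodule.span_induction
          (p := fun q _ => q ∈ MvPolynomial.vanishingIdeal ℝ S ∧ grad q x ⬝ᵥ a = 0)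
          ?_ ⟨zero_mem _, by simp [grad, dotProduct]⟩ ?_ ?_ hp'
        · intro q hq
          refine ⟨?_, by simpa using ha (s.equivFin ⟨q, hq⟩)⟩
          rw [← hs]
          exact Ideal.subset_span hq
        · rintro q r _ _ ⟨hq, hq'⟩ ⟨hr, hr'⟩
          exact ⟨add_mem hq hr, by rw [grad_add, add_dotProduct, hq', hr', add_zero]⟩
        · rintro c q _ ⟨hq, hq'⟩
          refine ⟨Ideal.mul_mem_left _ c hq, ?_⟩
          rw [smul_eq_mul, grad_mul, mem_vanishingIdeal.1 hq x hx, add_dotProduct,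
            smul_dotProduct, hq', zero_smul, zero_dotProduct, smul_zero, add_zero]
      exact key.2

end HDDegree

namespace HDDegree

variable {ι κ : Type}

/-! ### Counting functions of semialgebraic families -/

lemma le_encard_iff_exists_injective {α : Type*} {s : Set α} {k : ℕ} :
    (k : ℕ∞) ≤ s.encard ↔ ∃ w : Fin k → α, (∀ i, w i ∈ s) ∧ Function.Injective w := by
  constructor
  · intro h
    obtain ⟨t, hts, htk⟩ := Set.exists_subset_encard_eq h
    have hfin : t.Finite := Set.finite_of_encard_eq_coe htk
    have hcard : hfin.toFinset.card = k := by
      rw [hfin.encard_eq_coe_toFinset_card] at htk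
      exact_mod_cast htk
    refine ⟨fun i => (hfin.toFinset.equivFinOfCardEq hcard).symm i, fun i => ?_, ?_⟩
    · exact hts (hfin.mem_toFinset.1 (Subtype.coe_prop _))
    · exact Subtype.val_injective.comp (Equiv.injective _)
  · rintro ⟨w, hw, hinj⟩
    calc (k : ℕ∞) = (Set.range w).encard := by
          rw [← Set.image_univ, hinj.encard_image, Set.encard_univ]
          simp
      _ ≤ s.encard := Set.encard_le_encard (Set.range_subset_iff.2 hw)

lemma IsSemialgebraic.le_encard [Finite κ] {E : (ι → ℝ) → Set (κ → ℝ)}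
    (hE : IsSemialgebraic {v : ι ⊕ κ → ℝ | v ∘ Sum.inr ∈ E (v ∘ Sum.inl)}) (k : ℕ) :
    IsSemialgebraic {y | (k : ℕ∞) ≤ (E y).encard} := by
  have h : IsSemialgebraic {y | ∃ w : Fin k × κ → ℝ, (∀ i, (fun j => w (i, j)) ∈ E y) ∧
      ∀ i j, i ≠ j → ∃ c, w (i, c) ≠ w (j, c)} := by
    refine .exists_fun (P := fun y w => (∀ i, (fun j => w (i, j)) ∈ E y) ∧
      ∀ i j, i ≠ j → ∃ c, w (i, c) ≠ w (j, c)) (.and (.forall_fin fun i => ?_)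
      (.forall_fin fun i => .forall_fin fun j => .imp (.of_prop _) (.exists_fin fun c => .not ?_)))
    · exact hE.preimage (g := fun v : ι ⊕ (Fin k × κ) → ℝ =>
        Sum.elim (fun a => v (Sum.inl a)) (fun b => v (Sum.inr (i, b)))) (by
        rintro (a | b)
        exacts [polyFun_coord _, polyFun_coord _])
    · exact .polyFun_eq (polyFun_coord _) (polyFun_coord _)
  convert h using 3 with y
  rw [le_encard_iff_exists_injective]
  constructor
  · rintro ⟨w, hw, hinj⟩
    refine ⟨fun q => w q.1 q.2, hw, fun i j hij => ?_⟩
    by_contra hcon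
    push Not at hcon
    exact hij (hinj (funext hcon))
  · rintro ⟨w, hw, hne⟩
    refine ⟨fun i j => w (i, j), hw, fun i j hij => ?_⟩
    by_contra hcon
    obtain ⟨c, hc⟩ := hne i j hcon
    exact hc (congrFun hij c)

/-- If almost all fibres of a semialgebraic family are countable, then off a hypersurface the number
of points of the fibre is finite and locally constant. -/
theorem exists_encard_locally_const [Fintype ι] [Finite κ] {E : (ι → ℝ) → Set (κ → ℝ)}
    (hE : IsSemialgebraic {v : ι ⊕ κ → ℝ | v ∘ Sum.inr ∈ E (v ∘ Sum.inl)})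
    (hcount : ∀ᵐ y, (E y).Countable) :
    ∃ D : MvPolynomial ι ℝ, D ≠ 0 ∧ ∀ y, MvPolynomial.aeval y D ≠ 0 →
      ∃ k : ℕ, ∀ᶠ z in 𝓝 y, (E z).encard = k := by
  obtain ⟨d, hd⟩ := hE.exists_bound
  choose D hD0 hD using fun k => (hE.le_encard k).exists_locally_const
  obtain ⟨D', hD'0, hD'⟩ := (hE.le_encard (d + 1)).exists_vanishing_of_null (by
    refine MeasureTheory.measure_mono_null (fun y hy => ?_) hcount
    intro hc
    have h1 : ((d + 1 : ℕ) : ℕ∞) ≤ d := le_trans hy (hd y hc)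
    have h2 : d + 1 ≤ d := by exact_mod_cast h1
    omega)
  refine ⟨D' * ∏ k ∈ Finset.range (d + 2), D k,
    mul_ne_zero hD'0 (Finset.prod_ne_zero_iff.2 fun k _ => hD0 k), fun y hy => ?_⟩
  rw [map_mul, map_prod] at hy
  have hle : ¬ ((d + 1 : ℕ) : ℕ∞) ≤ (E y).encard := hD' y (left_ne_zero_of_mul hy)
  have hk : ∀ k ∈ Finset.range (d + 2), ∀ᶠ z in 𝓝 y,
      ((k : ℕ∞) ≤ (E z).encard ↔ (k : ℕ∞) ≤ (E y).encard) := fun k hk =>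
    hD k y (Finset.prod_ne_zero_iff.1 (right_ne_zero_of_mul hy) k hk)
  have hfin : (E y).encard ≠ ⊤ := by
    intro h
    rw [h] at hle
    exact hle le_top
  obtain ⟨l, hl⟩ := ENat.ne_top_iff_exists.1 hfin
  refine ⟨l, ?_⟩
  rw [← hl] at hle hk
  have hld : l < d + 1 := by
    rw [not_le] at hle
    exact_mod_cast hle
  filter_upwards [hk l (Finset.mem_range.2 (by omega)), hk (l + 1) (Finset.mem_range.2 (by omega))]
    with z h1 h2
  refine le_antisymm ?_ (h1.2 le_rfl)
  by_contra hcon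
  rw [not_le] at hcon
  have h3 := h2.1 (by
    push_cast
    exact Order.add_one_le_of_lt hcon)
  have : l + 1 ≤ l := by exact_mod_cast h3
  omega

/-! ### Semialgebraicity of the critical point correspondence -/

variable [Fintype ι]

lemma IsRealAlgebraic.isSemialgebraic {S : Set (ι → ℝ)} (hS : IsRealAlgebraic S) :
    IsSemialgebraic S := by
  obtain ⟨m, f, -, hf, -⟩ := exists_generators hS
  have : IsSemialgebraic {x | ∀ j, MvPolynomial.aeval x (f j) = 0} :=
    .forall_fin fun j => .polyFun_eq (mem_polyFun.2 ⟨f j, fun _ => rfl⟩) (polyFun_const 0)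
  convert this using 1
  ext x
  exact hf x

/-- Regularity can be tested on subfamilies of a fixed finite family of polynomials, in balls. -/
lemma mem_regularLocus_iff {S : Set (ι → ℝ)} {m : ℕ} {f : Fin m → MvPolynomial ι ℝ}
    (hfI : ∀ j, f j ∈ MvPolynomial.vanishingIdeal ℝ S)
    (hfT : ∀ x ∈ S, ∀ a, a ∈ tangentSpace S x ↔ ∀ j, grad (f j) x ⬝ᵥ a = 0) {x : ι → ℝ} :
    x ∈ regularLocus S ↔ x ∈ S ∧ ∃ (k : Fin (m + 1)) (b : Fin k → Fin m),
      LinearIndependent ℝ (fun j => grad (f (b j)) x) ∧ ∃ ε : ℝ, 0 < ε ∧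
        ∀ z : ι → ℝ, ∑ i, (z i - x i) ^ 2 < ε →
          (∀ j, MvPolynomial.aeval z (f (b j)) = 0) → z ∈ S := by
  constructor
  · intro hx
    have hxS : x ∈ S := hx.1
    refine ⟨hxS, ?_⟩
    obtain ⟨K, φ, φ', rfl, hφ, hS, hT⟩ := exists_param_of_mem_regularLocus hx
    obtain ⟨σ, b, hb, hspan, hli⟩ :=
      exists_linearIndependent' ℝ fun j => grad (f j) (φ 0)
    have : Finite σ := Finite.of_injective b hb
    have : Fintype σ := Fintype.ofFinite σ
    have hcard : Fintype.card σ < m + 1 := by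
      have := Fintype.card_le_of_injective b hb
      rw [Fintype.card_fin] at this
      omega
    let e := (Fintype.equivFin σ).symm
    refine ⟨⟨Fintype.card σ, hcard⟩, b ∘ e, hli.comp e e.injective, ?_⟩
    have hPT : ∀ a, (∀ j, grad (f ((b ∘ e) j)) (φ 0) ⬝ᵥ a = 0) → a ∈ tangentSpace S (φ 0) := by
      intro a ha
      rw [hfT _ hxS]
      intro j
      have hmem : grad (f j) (φ 0) ∈
          Submodule.span ℝ (Set.range ((fun j => grad (f j) (φ 0)) ∘ b)) := by
        rw [hspan]
        exact Submodule.subset_span ⟨j, rfl⟩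
      refine Submodule.span_induction (p := fun v _ => v ⬝ᵥ a = 0) ?_ (by simp) ?_ ?_ hmem
      · rintro _ ⟨s, rfl⟩
        simpa using ha (e.symm s)
      · intro v w _ _ hv hw
        rw [add_dotProduct, hv, hw, add_zero]
      · intro c v _ hv
        rw [smul_dotProduct, hv, smul_zero]
    obtain ⟨δ, hδ, hball⟩ := Metric.eventually_nhds_iff.1
      (eventually_mem_of_normal (fun O hO => eventually_exists_normal hφ hS hT hO)
        (fun j => f ((b ∘ e) j)) (fun j => hfI _) hPT)
    refine ⟨δ ^ 2, by positivity, fun z hz hz0 => hball ?_ hz0⟩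
    rw [dist_pi_lt_iff hδ]
    intro i
    have h1 : (z i - φ 0 i) ^ 2 ≤ ∑ i, (z i - φ 0 i) ^ 2 :=
      Finset.single_le_sum (f := fun i => (z i - φ 0 i) ^ 2) (fun _ _ => sq_nonneg _)
        (Finset.mem_univ i)
    rw [Real.dist_eq]
    exact abs_lt_of_sq_lt_sq (h1.trans_lt hz) hδ.le
  · rintro ⟨hxS, k, b, hli, ε, hε, hz⟩
    refine ⟨hxS, k, fun j => f (b j), fun j => hfI _, hli, {z | ∑ i, (z i - x i) ^ 2 < ε}, ?_,
      by simpa using hε, hz⟩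
    exact isOpen_lt (by fun_prop) continuous_const

lemma isSemialgebraic_regularLocus {S : Set (ι → ℝ)} (hS : IsRealAlgebraic S) :
    IsSemialgebraic (regularLocus S) := by
  obtain ⟨m, f, hfI, -, hfT⟩ := exists_generators hS
  have : IsSemialgebraic {x | x ∈ S ∧ ∃ (k : Fin (m + 1)) (b : Fin k → Fin m),
      (∀ c : Fin k → ℝ, (∀ i, ∑ j, c j * grad (f (b j)) x i = 0) → ∀ j, c j = 0) ∧
      ∃ ε : ℝ, 0 < ε ∧ ∀ z : ι → ℝ, ∑ i, (z i - x i) ^ 2 < ε →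
          (∀ j, MvPolynomial.aeval z (f (b j)) = 0) → z ∈ S} := by
    refine hS.isSemialgebraic.and (.exists_fin fun k => .exists_fin fun b => .and ?_ ?_)
    · refine .forall_fun (P := fun x c => (∀ i, ∑ j, c j * grad (f (b j)) x i = 0) →
        ∀ j, c j = 0) (.imp (.forall_fin fun i => .polyFun_eq ?_ (polyFun_const 0))
        (.forall_fin fun j => .polyFun_eq (polyFun_coord _) (polyFun_const 0)))
      have : (fun v : ι ⊕ Fin k → ℝ => ∑ j, (v ∘ Sum.inr) j * grad (f (b j)) (v ∘ Sum.inl) i)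
          = ∑ j, (fun v : ι ⊕ Fin k → ℝ => v (Sum.inr j)) *
            fun v => grad (f (b j)) (v ∘ Sum.inl) i := by
        ext v
        simp
      rw [this]
      exact sum_mem fun j _ => mul_mem (polyFun_coord _)
        (polyFun_aeval _ fun k => polyFun_coord _)
    · refine .exists_real (P := fun x ε => 0 < ε ∧ ∀ z : ι → ℝ, ∑ i, (z i - x i) ^ 2 < ε →
        (∀ j, MvPolynomial.aeval z (f (b j)) = 0) → z ∈ S) (.and (.polyFun_pos (polyFun_coord _))
        (.forall_fun (P := fun v z => ∑ i, (z i - (v ∘ some) i) ^ 2 < v none →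
        (∀ j, MvPolynomial.aeval z (f (b j)) = 0) → z ∈ S) (.imp (.polyFun_lt ?_ (polyFun_coord _))
        (.imp (.forall_fin fun j => .polyFun_eq (polyFun_aeval _ fun k => polyFun_coord _)
          (polyFun_const 0)) (hS.isSemialgebraic.preimage fun k => polyFun_coord _)))))
      have : (fun v : Option ι ⊕ ι → ℝ => ∑ i, ((v ∘ Sum.inr) i - ((v ∘ Sum.inl) ∘ some) i) ^ 2)
          = ∑ i, ((fun v : Option ι ⊕ ι → ℝ => v (Sum.inr i)) -
            fun v => v (Sum.inl (some i))) ^ 2 := by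
        ext v
        simp
      rw [this]
      exact sum_mem fun j _ => pow_mem (sub_mem (polyFun_coord _) (polyFun_coord _)) 2
  convert this using 1
  ext x
  rw [mem_regularLocus_iff hfI hfT]
  simp only [Fintype.linearIndependent_iff, funext_iff, Finset.sum_apply, Pi.smul_apply,
    smul_eq_mul, Pi.zero_apply]
  rfl

/-- The family of the tangent spaces of `S`, a subset of `ℝ^ι × ℝ^ι`, is semialgebraic. -/
lemma isSemialgebraic_tangent {S : Set (ι → ℝ)} (hS : IsRealAlgebraic S) :
    IsSemialgebraic {v : ι ⊕ ι → ℝ | v ∘ Sum.inl ∈ S ∧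
      v ∘ Sum.inr ∈ tangentSpace S (v ∘ Sum.inl)} := by
  obtain ⟨m, f, -, -, hfT⟩ := exists_generators hS
  have : IsSemialgebraic {v : ι ⊕ ι → ℝ | v ∘ Sum.inl ∈ S ∧
      ∀ j, grad (f j) (v ∘ Sum.inl) ⬝ᵥ (v ∘ Sum.inr) = 0} := by
    refine (hS.isSemialgebraic.preimage fun k => polyFun_coord _).and
      (.forall_fin fun j => .polyFun_eq ?_ (polyFun_const 0))
    have : (fun v : ι ⊕ ι → ℝ => grad (f j) (v ∘ Sum.inl) ⬝ᵥ (v ∘ Sum.inr))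
        = ∑ i, (fun v : ι ⊕ ι → ℝ => grad (f j) (v ∘ Sum.inl) i) * fun v => v (Sum.inr i) := by
      ext v
      simp [dotProduct]
    rw [this]
    exact sum_mem fun j _ => mul_mem (polyFun_aeval _ fun k => polyFun_coord _) (polyFun_coord _)
  convert this using 3 with v
  exact and_congr_right fun h => hfT _ h _

lemma isSemialgebraic_edCritical {S : Set (ι → ℝ)} (hS : IsRealAlgebraic S) :
    IsSemialgebraic {v : ι ⊕ ι → ℝ | v ∘ Sum.inr ∈ edCritical S (v ∘ Sum.inl)} := by
  have : IsSemialgebraic {v : ι ⊕ ι → ℝ | v ∘ Sum.inr ∈ regularLocus S ∧ ∀ a : ι → ℝ,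
      (v ∘ Sum.inr ∈ S ∧ a ∈ tangentSpace S (v ∘ Sum.inr)) →
        (v ∘ Sum.inr - v ∘ Sum.inl) ⬝ᵥ a = 0} := by
    refine ((isSemialgebraic_regularLocus hS).preimage fun k => polyFun_coord _).and
      (.forall_fun (P := fun v a => (v ∘ Sum.inr ∈ S ∧ a ∈ tangentSpace S (v ∘ Sum.inr)) →
        (v ∘ Sum.inr - v ∘ Sum.inl) ⬝ᵥ a = 0) (.imp ?_ (.polyFun_eq ?_ (polyFun_const 0))))
    · exact (isSemialgebraic_tangent hS).preimage (g := fun v : (ι ⊕ ι) ⊕ ι → ℝ =>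
        Sum.elim (fun i => v (Sum.inl (Sum.inr i))) fun i => v (Sum.inr i)) (by
        rintro (i | i)
        exacts [polyFun_coord _, polyFun_coord _])
    · have : (fun v : (ι ⊕ ι) ⊕ ι → ℝ => ((v ∘ Sum.inl) ∘ Sum.inr - (v ∘ Sum.inl) ∘ Sum.inl) ⬝ᵥ
          (v ∘ Sum.inr)) = ∑ i, ((fun v : (ι ⊕ ι) ⊕ ι → ℝ => v (Sum.inl (Sum.inr i))) -
            fun v => v (Sum.inl (Sum.inl i))) * fun v => v (Sum.inr i) := by
        ext v
        simp [dotProduct]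
      rw [this]
      exact sum_mem fun j _ =>
        mul_mem (sub_mem (polyFun_coord _) (polyFun_coord _)) (polyFun_coord _)
  convert this using 3 with v
  exact and_congr_right fun h => forall_congr' fun a =>
    ⟨fun h1 h2 => h1 h2.2, fun h1 h2 => h1 ⟨h.1, h2⟩⟩

lemma polyFun_dotProduct (l : ι → ℝ) {g : (κ → ℝ) → ι → ℝ}
    (hg : ∀ i, (fun v => g v i) ∈ polyFun κ) : (fun v => l ⬝ᵥ g v) ∈ polyFun κ := by
  have : (fun v => l ⬝ᵥ g v) = ∑ i, (fun _ => l i) * fun v => g v i := by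
    ext v
    simp [dotProduct]
  rw [this]
  exact sum_mem fun i _ => mul_mem (polyFun_const _) (hg i)

/-- Data points with a critical point that lies on the hyperplane `l = 0` at which `S` is not
tangent to this hyperplane. -/
def transverseData (S : Set (ι → ℝ)) (l : ι → ℝ) : Set (ι → ℝ) :=
  {y | ∃ x ∈ edCritical S y, l ⬝ᵥ x = 0 ∧ ∃ a ∈ tangentSpace S x, l ⬝ᵥ a ≠ 0}

lemma isSemialgebraic_transverseData {S : Set (ι → ℝ)} (hS : IsRealAlgebraic S) (l : ι → ℝ) :
    IsSemialgebraic (transverseData S l) := by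
  have : IsSemialgebraic {y : ι → ℝ | ∃ x : ι → ℝ, x ∈ edCritical S y ∧ l ⬝ᵥ x = 0 ∧
      ∃ a : ι → ℝ, (x ∈ S ∧ a ∈ tangentSpace S x) ∧ ¬ l ⬝ᵥ a = 0} := by
    refine .exists_fun (P := fun y x => x ∈ edCritical S y ∧ l ⬝ᵥ x = 0 ∧
      ∃ a : ι → ℝ, (x ∈ S ∧ a ∈ tangentSpace S x) ∧ ¬ l ⬝ᵥ a = 0)
      ((isSemialgebraic_edCritical hS).and <| .and
        (.polyFun_eq (polyFun_dotProduct l fun i => polyFun_coord _) (polyFun_const 0))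
        (.exists_fun (P := fun v a => (v ∘ Sum.inr ∈ S ∧ a ∈ tangentSpace S (v ∘ Sum.inr)) ∧
          ¬ l ⬝ᵥ a = 0) (.and ?_ (.not (.polyFun_eq (polyFun_dotProduct l fun i =>
            polyFun_coord _) (polyFun_const 0))))))
    exact (isSemialgebraic_tangent hS).preimage (g := fun v : (ι ⊕ ι) ⊕ ι → ℝ =>
      Sum.elim (fun i => v (Sum.inl (Sum.inr i))) fun i => v (Sum.inr i)) (by
      rintro (i | i)
      exacts [polyFun_coord _, polyFun_coord _])
  convert this using 1
  ext y
  exact ⟨fun ⟨x, hx, h0, a, ha, hne⟩ => ⟨x, hx, h0, a, ⟨hx.1.1, ha⟩, hne⟩,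
    fun ⟨x, hx, h0, a, ha, hne⟩ => ⟨x, hx, h0, a, ha.2, hne⟩⟩

end HDDegree

namespace HDDegree

variable {ι : Type} [Fintype ι]

/-! ### Generic data: Sard's theorem for the normal bundle -/

lemma countable_of_isolated {E : Type*} [TopologicalSpace E] [SecondCountableTopology E]
    {Z : Set E} (hZ : ∀ v ∈ Z, ∀ᶠ w in 𝓝 v, w ∈ Z → w = v) : Z.Countable := by
  obtain ⟨t, htZ, htc, hcov⟩ := TopologicalSpace.countable_cover_nhdsWithin
    (f := fun v => {w | w ∈ Z → w = v}) (s := Z)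
    fun v hv => mem_nhdsWithin_of_mem_nhds (hZ v hv)
  refine htc.mono fun w hw => ?_
  obtain ⟨v, hv, hwv⟩ := Set.mem_iUnion₂.1 (hcov hw)
  rw [show w = v from hwv hw]
  exact hv

lemma det_eq_zero_of_apply_eq_zero {E : Type*} [NormedAddCommGroup E] [NormedSpace ℝ E]
    [FiniteDimensional ℝ E] (A : E →L[ℝ] E) {w : E} (hw : w ≠ 0) (hA : A w = 0) : A.det = 0 := by
  by_contra hdet
  exact hw ((A.toContinuousLinearEquivOfDetNeZero hdet).injective (by simpa using hA))

/-- Near a regular point, the critical points of almost every data point are countable, and those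
at which `S` is transverse to a hyperplane through them occur for almost no data point. -/
lemma exists_nhds_generic {S : Set (ι → ℝ)} {x₀ : ι → ℝ} (hx₀ : x₀ ∈ regularLocus S) :
    ∃ O ∈ 𝓝 x₀, (∀ᵐ y, (edCritical S y ∩ O).Countable) ∧ ∀ l : ι → ℝ,
      MeasureTheory.volume {y | ∃ x ∈ edCritical S y, x ∈ O ∧ l ⬝ᵥ x = 0 ∧
        ∃ a ∈ tangentSpace S x, l ⬝ᵥ a ≠ 0} = 0 := by
  obtain ⟨hxS, k, P, hP, hli, O, hO, hxO, hOS⟩ := hx₀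
  obtain ⟨K, φ, U, hU, h0, hφ0, hdim, hφ, hcov⟩ := exists_chart hxS hP hli hO hxO hOS
  have hrank : Module.finrank ℝ (ι → ℝ) = Module.finrank ℝ (K × (Fin k → ℝ)) := by
    rw [Module.finrank_prod, Module.finrank_fin_fun, hdim, Module.finrank_fintype_fun_eq_card]
  let e : (ι → ℝ) ≃L[ℝ] K × (Fin k → ℝ) := ContinuousLinearEquiv.ofFinrankEq hrank
  let π : (ι → ℝ) →L[ℝ] K := (ContinuousLinearMap.fst ℝ K (Fin k → ℝ)).comp e.toContinuousLinearMap
  let c : Fin k → (ι → ℝ) →L[ℝ] ℝ := fun j =>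
    (ContinuousLinearMap.proj j).comp
      ((ContinuousLinearMap.snd ℝ K (Fin k → ℝ)).comp e.toContinuousLinearMap)
  -- the endpoint map of the normal bundle, in the coordinates of the chart
  let Ψ : (ι → ℝ) → ι → ℝ := fun v => φ (π v) + ∑ j, c j v • grad (P j) (φ (π v))
  let W : Set (ι → ℝ) := π ⁻¹' U
  have hφπ : ∀ v ∈ W, ContDiffAt ℝ 1 (fun v => φ (π v)) v := fun v hv =>
    (hφ _ hv).1.comp v π.contDiff.contDiffAt
  have hΨ : ∀ v ∈ W, ContDiffAt ℝ 1 Ψ v := fun v hv =>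
    (hφπ v hv).add (ContDiffAt.sum fun j _ => (c j).contDiff.contDiffAt.smul
      ((contDiff_grad (P j)).contDiffAt.comp v (hφπ v hv)))
  have hΨd : ∀ v ∈ W, HasFDerivAt Ψ (fderiv ℝ Ψ v) v := fun v hv =>
    ((hΨ v hv).differentiableAt one_ne_zero).hasFDerivAt
  have hrep : ∀ y, ∀ x ∈ edCritical S y, (x ∈ S → ∃ u ∈ U, φ u = x) →
      ∃ v ∈ W, φ (π v) = x ∧ Ψ v = y := by
    intro y x hx hxU
    obtain ⟨u, hu, rfl⟩ := hxU hx.1.1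
    obtain ⟨d, hd⟩ := exists_coeff_of_orth (fun j => grad (P j) (φ u)) (w := y - φ u)
      fun a ha => by
        have := hx.2 a ((hφ u hu).2.2.2 a ha)
        rw [← neg_sub, neg_dotProduct, this, neg_zero]
    have hπ : π (e.symm (u, d)) = u := by simp [π]
    have hc : ∀ j, c j (e.symm (u, d)) = d j := fun j => by simp [c]
    refine ⟨e.symm (u, d), ?_, by rw [hπ], ?_⟩
    · change π (e.symm (u, d)) ∈ U
      rwa [hπ]
    · simp only [Ψ, hπ, hc, ← hd]
      abel
  refine ⟨{x | x ∈ S → ∃ u ∈ U, φ u = x}, hcov, ?_, fun l => ?_⟩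
  · have hnull := MeasureTheory.addHaar_image_eq_zero_of_det_fderivWithin_eq_zero
      MeasureTheory.volume (f := Ψ) (s := {v | v ∈ W ∧ (fderiv ℝ Ψ v).det = 0})
      (f' := fderiv ℝ Ψ) (fun v hv => (hΨd v hv.1).hasFDerivWithinAt) (fun v hv => hv.2)
    filter_upwards [MeasureTheory.compl_mem_ae_iff.2 hnull] with y hy
    have hZ : {v | v ∈ W ∧ Ψ v = y}.Countable := by
      refine countable_of_isolated fun v hv => ?_
      have hdet : (fderiv ℝ Ψ v).det ≠ 0 := fun h => hy ⟨v, ⟨hv.1, h⟩, hv.2⟩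
      have hstrict : HasStrictFDerivAt Ψ
          (((fderiv ℝ Ψ v).toContinuousLinearEquivOfDetNeZero hdet :
            (ι → ℝ) ≃L[ℝ] (ι → ℝ)) : (ι → ℝ) →L[ℝ] (ι → ℝ)) v := by
        rw [ContinuousLinearMap.coe_toContinuousLinearEquivOfDetNeZero]
        exact (hΨ v hv.1).hasStrictFDerivAt one_ne_zero
      filter_upwards [hstrict.eventually_left_inverse] with w hw hwZ
      rw [← hw, hwZ.2, ← hv.2]
      exact hstrict.eventually_left_inverse.self_of_nhds
    refine (hZ.image fun v => φ (π v)).mono ?_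
    rintro x ⟨hx, hxU⟩
    obtain ⟨v, hv, h1, h2⟩ := hrep y x hx hxU
    exact ⟨v, ⟨hv, h2⟩, h1⟩
  · set s : Set (ι → ℝ) := {v | v ∈ W ∧ l ⬝ᵥ φ (π v) = 0 ∧
      ∃ a ∈ tangentSpace S (φ (π v)), l ⬝ᵥ a ≠ 0} with hs
    let lin : (ι → ℝ) →L[ℝ] ℝ := LinearMap.toContinuousLinearMap
      { toFun := fun a => l ⬝ᵥ a
        map_add' := fun a b => dotProduct_add l a b
        map_smul' := fun r a => dotProduct_smul r l a }
    have hlin : ∀ a, lin a = l ⬝ᵥ a := fun a => rfl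
    let f' : (ι → ℝ) → (ι → ℝ) →L[ℝ] ℝ := fun v => lin.comp ((fderiv ℝ φ (π v)).comp π)
    have hf' : ∀ v ∈ W, HasFDerivAt (fun v => lin (φ (π v))) (f' v) v := fun v hv =>
      lin.hasFDerivAt.comp v ((((hφ _ hv).1.differentiableAt one_ne_zero).hasFDerivAt).comp v
        π.hasFDerivAt)
    have hw : ∀ v ∈ s, ∃ w, f' v w = -1 := by
      rintro v ⟨hv, -, a, ha, hla⟩
      obtain ⟨b, hb⟩ := (hφ _ hv).2.2.1 a ha
      refine ⟨(-(l ⬝ᵥ a)⁻¹) • e.symm (b, 0), ?_⟩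
      have hπ : π (e.symm (b, 0)) = b := by simp [π]
      have : f' v (e.symm (b, 0)) = l ⬝ᵥ a := by
        simp only [f', ContinuousLinearMap.comp_apply, hπ, hb, hlin]
      rw [map_smul, this, smul_eq_mul, neg_mul, inv_mul_cancel₀ hla]
    choose! w hw using hw
    -- `l ∘ φ` vanishes on `s`, so along `s` the derivative of `Ψ` may be modified by its multiples
    let A : (ι → ℝ) → (ι → ℝ) →L[ℝ] (ι → ℝ) := fun v =>
      (fderiv ℝ Ψ v).comp (ContinuousLinearMap.id ℝ _ + (f' v).smulRight (w v))
    have hA : ∀ v ∈ s, HasFDerivWithinAt Ψ (A v) s v := by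
      intro v hv
      have hz : ∀ z ∈ s, lin (φ (π z)) = 0 := fun z hz => hz.2.1
      have h1 : HasFDerivAt (fun z => z + lin (φ (π z)) • w v)
          (ContinuousLinearMap.id ℝ _ + (f' v).smulRight (w v)) v :=
        (hasFDerivAt_id v).add ((hf' v hv.1).smul_const (w v))
      have h2 : HasFDerivAt Ψ (fderiv ℝ Ψ v) (v + lin (φ (π v)) • w v) := by
        rw [hz v hv, zero_smul, add_zero]
        exact hΨd v hv.1
      refine (HasFDerivAt.comp v h2 h1).hasFDerivWithinAt.congr (fun z hzs => ?_) ?_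
      · simp [hz z hzs]
      · simp [hz v hv]
    have hdet : ∀ v ∈ s, (A v).det = 0 := by
      intro v hv
      refine det_eq_zero_of_apply_eq_zero (A v) (w := w v) ?_ ?_
      · intro h
        have := hw v hv
        rw [h, map_zero] at this
        norm_num at this
      · simp [A, hw v hv]
    refine MeasureTheory.measure_mono_null ?_
      (MeasureTheory.addHaar_image_eq_zero_of_det_fderivWithin_eq_zero
        MeasureTheory.volume hA hdet)
    rintro y ⟨x, hx, hxU, hlx, a, ha, hla⟩
    obtain ⟨v, hv, rfl, h2⟩ := hrep y x hx hxU
    exact ⟨v, ⟨hv, hlx, a, ha, hla⟩, h2⟩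

/-- Off a hypersurface, the number of critical points is finite and locally constant, and at every
critical point on one of finitely many given hyperplanes, the set is tangent to the hyperplane. -/
theorem exists_generic_polynomial {S : Set (ι → ℝ)} (hS : IsRealAlgebraic S) {σ : Type*}
    [Fintype σ] (l : σ → ι → ℝ) :
    ∃ D : MvPolynomial ι ℝ, D ≠ 0 ∧ ∀ y, MvPolynomial.aeval y D ≠ 0 →
      (∃ k : ℕ, ∀ᶠ z in 𝓝 y, (edCritical S z).encard = k) ∧ ∀ s, y ∉ transverseData S (l s) := by
  choose! O hO hcount hnull using fun x (hx : x ∈ regularLocus S) => exists_nhds_generic hx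
  obtain ⟨t, htS, htc, hcov⟩ := TopologicalSpace.countable_cover_nhdsWithin (f := O)
    fun x hx => mem_nhdsWithin_of_mem_nhds (hO x hx)
  have hc : ∀ᵐ y, (edCritical S y).Countable := by
    filter_upwards [(MeasureTheory.ae_ball_iff htc).2 fun x hx => hcount x (htS hx)] with y hy
    refine (htc.biUnion hy).mono fun x hx => ?_
    obtain ⟨z, hz, hxz⟩ := Set.mem_iUnion₂.1 (hcov hx.1)
    exact Set.mem_iUnion₂.2 ⟨z, hz, hx, hxz⟩
  have hn : ∀ s, MeasureTheory.volume (transverseData S (l s)) = 0 := by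
    intro s
    refine MeasureTheory.measure_mono_null ?_ ((MeasureTheory.measure_biUnion_null_iff htc).2
      fun x hx => hnull x (htS hx) (l s))
    rintro y ⟨x, hx, hlx, ha⟩
    obtain ⟨z, hz, hxz⟩ := Set.mem_iUnion₂.1 (hcov hx.1)
    exact Set.mem_iUnion₂.2 ⟨z, hz, x, hx, hxz, hlx, ha⟩
  obtain ⟨D, hD0, hD⟩ := exists_encard_locally_const (isSemialgebraic_edCritical hS) hc
  choose D' hD'0 hD' using fun s =>
    (isSemialgebraic_transverseData hS (l s)).exists_vanishing_of_null (hn s)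
  refine ⟨D * ∏ s, D' s, mul_ne_zero hD0 (Finset.prod_ne_zero_iff.2 fun s _ => hD'0 s),
    fun y hy => ?_⟩
  rw [map_mul, map_prod] at hy
  exact ⟨hD y (left_ne_zero_of_mul hy), fun s => hD' s y
    (Finset.prod_ne_zero_iff.1 (right_ne_zero_of_mul hy) s (Finset.mem_univ s))⟩

end HDDegree

namespace HDDegree

/-! ### Rectangular diagonal matrices -/

variable {n t : ℕ}

lemma unitary_mul_conjTranspose {U : Matrix (Fin n) (Fin n) ℂ}
    (hU : U ∈ Matrix.unitaryGroup (Fin n) ℂ) : U * Uᴴ = 1 := Matrix.mem_unitaryGroup_iff.1 hU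

lemma unitary_conjTranspose_mul {U : Matrix (Fin n) (Fin n) ℂ}
    (hU : U ∈ Matrix.unitaryGroup (Fin n) ℂ) : Uᴴ * U = 1 := Matrix.mem_unitaryGroup_iff'.1 hU

lemma unitary_conjTranspose_mem {U : Matrix (Fin n) (Fin n) ℂ}
    (hU : U ∈ Matrix.unitaryGroup (Fin n) ℂ) : Uᴴ ∈ Matrix.unitaryGroup (Fin n) ℂ :=
  Matrix.mem_unitaryGroup_iff.2 (by
    rw [Matrix.star_eq_conjTranspose, Matrix.conjTranspose_conjTranspose]
    exact unitary_conjTranspose_mul hU)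

lemma rectDiag_apply (x : Fin n → ℝ) (i : Fin n) (j : Fin t) :
    rectDiag t x i j = if (i : ℕ) = (j : ℕ) then (x i : ℂ) else 0 := rfl

/-- The real-linear embedding of `ℝ^n` as the space of real rectangular diagonal matrices. -/
noncomputable def rectDiagL (n t : ℕ) : (Fin n → ℝ) →ₗ[ℝ] Matrix (Fin n) (Fin t) ℂ where
  toFun := rectDiag t
  map_add' x y := by
    ext i j
    simp only [rectDiag_apply, Matrix.add_apply, Pi.add_apply]
    split_ifs <;> simp
  map_smul' c x := by
    ext i j
    simp only [rectDiag_apply, Matrix.smul_apply, Pi.smul_apply]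
    split_ifs <;> simp

@[simp] lemma rectDiagL_apply (x : Fin n → ℝ) : rectDiagL n t x = rectDiag t x := rfl

lemma rectDiag_castLE (hnt : n ≤ t) (x : Fin n → ℝ) (i k : Fin n) :
    rectDiag t x i (Fin.castLE hnt k) = if i = k then (x i : ℂ) else 0 := by
  simp [rectDiag_apply, Fin.ext_iff]

/-- Right multiplication by the adjoint of a diagonal matrix scales the first columns. -/
lemma mul_rectDiag_conjTranspose_apply (hnt : n ≤ t) {m : ℕ} (A : Matrix (Fin m) (Fin t) ℂ)
    (x : Fin n → ℝ) (i : Fin m) (k : Fin n) :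
    (A * (rectDiag t x)ᴴ) i k = A i (Fin.castLE hnt k) * x k := by
  rw [Matrix.mul_apply, Finset.sum_eq_single (Fin.castLE hnt k)]
  · rw [Matrix.conjTranspose_apply, rectDiag_castLE]
    simp
  · intro j _ hj
    rw [Matrix.conjTranspose_apply, rectDiag_apply, if_neg, star_zero, mul_zero]
    intro h
    exact hj (Fin.ext h.symm)
  · simp

/-- Left multiplication by a diagonal matrix scales the rows. -/
lemma rectDiag_mul_apply (hnt : n ≤ t) {m : ℕ} (A : Matrix (Fin t) (Fin m) ℂ)
    (x : Fin n → ℝ) (i : Fin n) (k : Fin m) :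
    (rectDiag t x * A) i k = x i * A (Fin.castLE hnt i) k := by
  rw [Matrix.mul_apply, Finset.sum_eq_single (Fin.castLE hnt i)]
  · rw [rectDiag_castLE]
    simp
  · intro j _ hj
    rw [rectDiag_apply, if_neg, zero_mul]
    intro h
    exact hj (Fin.ext h.symm)
  · simp

lemma mul_rectDiag_apply (hnt : n ≤ t) {m : ℕ} (A : Matrix (Fin m) (Fin n) ℂ)
    (x : Fin n → ℝ) (i : Fin m) (k : Fin n) :
    (A * rectDiag t x) i (Fin.castLE hnt k) = A i k * x k := by
  rw [Matrix.mul_apply, Finset.sum_eq_single k]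
  · rw [rectDiag_castLE]
    simp
  · intro j _ hj
    rw [rectDiag_castLE, if_neg hj, mul_zero]
  · simp

lemma mul_rectDiag_apply_of_le {m : ℕ} (A : Matrix (Fin m) (Fin n) ℂ)
    (x : Fin n → ℝ) (i : Fin m) (j : Fin t) (hj : n ≤ j) :
    (A * rectDiag t x) i j = 0 := by
  rw [Matrix.mul_apply]
  refine Finset.sum_eq_zero fun k _ => ?_
  rw [rectDiag_apply, if_neg, mul_zero]
  have := k.2
  omega

lemma rectDiag_mul_conjTranspose (hnt : n ≤ t) (x y : Fin n → ℝ) :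
    rectDiag t x * (rectDiag t y)ᴴ = Matrix.diagonal fun i => ((x i * y i : ℝ) : ℂ) := by
  ext i k
  rw [mul_rectDiag_conjTranspose_apply hnt, rectDiag_castLE, Matrix.diagonal_apply]
  split_ifs with h
  · rw [h]
    simp
  · simp

lemma rectDiag_conjTranspose_mul (x y : Fin n → ℝ) :
    (rectDiag t x)ᴴ * rectDiag t y =
      Matrix.diagonal fun j : Fin t => if h : (j : ℕ) < n then ((x ⟨j, h⟩ * y ⟨j, h⟩ : ℝ) : ℂ)
        else 0 := by
  ext j k
  rw [Matrix.mul_apply, Matrix.diagonal_apply]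
  simp only [Matrix.conjTranspose_apply, rectDiag_apply]
  by_cases hj : (j : ℕ) < n
  · rw [Finset.sum_eq_single ⟨j, hj⟩]
    · by_cases hjk : j = k
      · subst hjk
        simp [hj]
      · have : ¬ (j : ℕ) = k := fun h => hjk (Fin.ext h)
        simp [hjk, this]
    · intro i _ hi
      rw [if_neg, star_zero, zero_mul]
      exact fun h => hi (Fin.ext h)
    · simp
  · rw [Finset.sum_eq_zero]
    · simp [hj]
    · intro i _
      rw [if_neg, star_zero, zero_mul]
      have := i.2
      omega

/-! ### The singular value decomposition -/

open ComplexOrder in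
/-- Every complex matrix with at most as many rows as columns has a singular value decomposition. -/
theorem exists_svd (hnt : n ≤ t) (A : Matrix (Fin n) (Fin t) ℂ) :
    ∃ U ∈ Matrix.unitaryGroup (Fin n) ℂ, ∃ V ∈ Matrix.unitaryGroup (Fin t) ℂ,
      ∃ y : Fin n → ℝ, A = U * rectDiag t y * Vᴴ := by
  classical
  have hA : (A * Aᴴ).IsHermitian := Matrix.isHermitian_mul_conjTranspose_self A
  set U : Matrix (Fin n) (Fin n) ℂ := hA.eigenvectorUnitary.1 with hU
  have hUmem : U ∈ Matrix.unitaryGroup (Fin n) ℂ := hA.eigenvectorUnitary.2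
  set B : Matrix (Fin n) (Fin t) ℂ := Uᴴ * A with hB
  have hBB : B * Bᴴ = Matrix.diagonal fun i => (hA.eigenvalues i : ℂ) := by
    have h1 : A * Aᴴ = U * Matrix.diagonal (fun i => (hA.eigenvalues i : ℂ)) * Uᴴ := by
      conv_lhs => rw [hA.spectral_theorem, Unitary.conjStarAlgAut_apply]
      rfl
    calc B * Bᴴ = Uᴴ * (A * Aᴴ) * U := by
          rw [hB, Matrix.conjTranspose_mul, Matrix.conjTranspose_conjTranspose]
          simp only [Matrix.mul_assoc]
      _ = Uᴴ * (U * Matrix.diagonal (fun i => (hA.eigenvalues i : ℂ)) * Uᴴ) * U :=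
          congrArg (fun M => Uᴴ * M * U) h1
      _ = Uᴴ * U * Matrix.diagonal (fun i => (hA.eigenvalues i : ℂ)) * (Uᴴ * U) := by
          simp only [Matrix.mul_assoc]
      _ = _ := by
          rw [unitary_conjTranspose_mul hUmem, Matrix.one_mul, Matrix.mul_one]
  have hrow : ∀ i k, ∑ j, B i j * star (B k j) = if i = k then (hA.eigenvalues i : ℂ) else 0 := by
    intro i k
    have := congrFun (congrFun hBB i) k
    rwa [Matrix.mul_apply, Matrix.diagonal_apply] at this
  have hnn : ∀ i, 0 ≤ hA.eigenvalues i :=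
    (Matrix.posSemidef_self_mul_conjTranspose A).eigenvalues_nonneg
  set y : Fin n → ℝ := fun i => Real.sqrt (hA.eigenvalues i) with hy
  have hyy : ∀ i, y i * y i = hA.eigenvalues i := fun i => Real.mul_self_sqrt (hnn i)
  let v : Fin t → EuclideanSpace ℂ (Fin t) := fun j => if h : (j : ℕ) < n then
    WithLp.toLp 2 fun l => ((y ⟨j, h⟩)⁻¹ : ℂ) * star (B ⟨j, h⟩ l) else 0
  let s : Set (Fin t) := {j | ∃ h : (j : ℕ) < n, y ⟨j, h⟩ ≠ 0}
  have hv : Orthonormal ℂ (s.domRestrict v) := by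
    rw [orthonormal_iff_ite]
    rintro ⟨j, hj, hj0⟩ ⟨k, hk, hk0⟩
    simp only [Set.domRestrict_apply, v, hj, hk, dif_pos, EuclideanSpace.inner_eq_star_dotProduct]
    simp only [dotProduct, Pi.star_apply, star_mul', star_star]
    have hreal : ∀ r : ℝ, star (r : ℂ) = r := Complex.conj_ofReal
    have h1 : ∀ l, ((y ⟨k, hk⟩)⁻¹ : ℂ) * star (B ⟨k, hk⟩ l) *
          (star ((y ⟨j, hj⟩)⁻¹ : ℂ) * B ⟨j, hj⟩ l)
        = ((y ⟨k, hk⟩)⁻¹ : ℂ) * ((y ⟨j, hj⟩)⁻¹ : ℂ) * (B ⟨j, hj⟩ l * star (B ⟨k, hk⟩ l)) := by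
      intro l
      rw [star_inv₀, hreal]
      ring
    simp only [h1, ← Finset.mul_sum, hrow]
    by_cases hjk : j = k
    · subst hjk
      have hyc : (y ⟨j, hj⟩ : ℂ) ≠ 0 := by exact_mod_cast hj0
      simp only [if_true, ← hyy]
      push_cast
      field_simp
    · have h2 : ¬ (⟨j, hj⟩ : Fin n) = ⟨k, hk⟩ := fun h => hjk (Fin.ext (Fin.mk.inj h))
      simp [hjk, h2]
  obtain ⟨b, hb⟩ := hv.exists_orthonormalBasis_extension_of_card_eq (by simp)
  set V : Matrix (Fin t) (Fin t) ℂ := (EuclideanSpace.basisFun (Fin t) ℂ).toBasis.toMatrix b with hV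
  have hVmem : V ∈ Matrix.unitaryGroup (Fin t) ℂ :=
    (EuclideanSpace.basisFun (Fin t) ℂ).toMatrix_orthonormalBasis_mem_unitary b
  have hVapp : ∀ l j, V l j = b j l := fun l j => by
    simp [hV, Module.Basis.toMatrix_apply]
  refine ⟨U, hUmem, V, hVmem, y, ?_⟩
  have hBV : B = rectDiag t y * Vᴴ := by
    ext i l
    rw [rectDiag_mul_apply hnt, Matrix.conjTranspose_apply, hVapp]
    by_cases hi : y i = 0
    · have h0 : ∑ j, B i j * star (B i j) = 0 := by
        rw [hrow, if_pos rfl, ← hyy, hi]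
        simp
      have h1 : ∑ j, ‖B i j‖ ^ 2 = 0 := by
        have : ((∑ j, ‖B i j‖ ^ 2 : ℝ) : ℂ) = ∑ j, B i j * star (B i j) := by
          push_cast
          refine Finset.sum_congr rfl fun j _ => ?_
          rw [RCLike.star_def, Complex.mul_conj, Complex.normSq_eq_norm_sq]
          push_cast
          rfl
        rw [h0] at this
        exact_mod_cast this
      have h2 := (Finset.sum_eq_zero_iff_of_nonneg fun j _ => sq_nonneg ‖B i j‖).1 h1 l
        (Finset.mem_univ l)
      rw [hi, norm_eq_zero.1 (pow_eq_zero_iff two_ne_zero |>.1 h2)]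
      simp
    · have hmem : Fin.castLE hnt i ∈ s := ⟨i.2, hi⟩
      have hyc : (y i : ℂ) ≠ 0 := by exact_mod_cast hi
      rw [hb _ hmem]
      simp [v, hyc]
  rw [Matrix.mul_assoc, ← hBV, hB, ← Matrix.mul_assoc, unitary_mul_conjTranspose hUmem,
    Matrix.one_mul]

end HDDegree

namespace HDDegree

variable {n t : ℕ}

/-! ### Unitarily invariant polynomials -/

/-- Averaging over sign changes produces a polynomial in the squares of the coordinates. -/
lemma exists_sum_signs (p : MvPolynomial (Fin n) ℝ) :
    ∃ r : MvPolynomial (Fin n) ℝ, ∀ z : Fin n → ℝ,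
      ∑ ε : Fin n → ℤˣ, MvPolynomial.aeval (fun i => ((ε i : ℤ) : ℝ) * z i) p
        = MvPolynomial.aeval (fun i => z i ^ 2) r := by
  classical
  induction p using MvPolynomial.induction_on' with
  | monomial u a =>
    refine ⟨MvPolynomial.C a * ∏ i, if Even (u i) then 2 * MvPolynomial.X i ^ (u i / 2) else 0,
      fun z => ?_⟩
    have h1 : ∀ ε : Fin n → ℤˣ, MvPolynomial.aeval (fun i => ((ε i : ℤ) : ℝ) * z i)
        (MvPolynomial.monomial u a) = a * ∏ i, (((ε i : ℤ) : ℝ) * z i) ^ u i := by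
      intro ε
      rw [MvPolynomial.aeval_monomial, Finsupp.prod_fintype _ _ fun i => pow_zero _]
      rfl
    have h2 := Finset.prod_univ_sum (fun _ : Fin n => (Finset.univ : Finset ℤˣ))
      fun i e => (((e : ℤ) : ℝ) * z i) ^ u i
    rw [Fintype.piFinset_univ] at h2
    simp only [h1, ← Finset.mul_sum, ← h2, map_mul, map_prod]
    congr 1
    · simp
    · refine Finset.prod_congr rfl fun i _ => ?_
      have huniv : (Finset.univ : Finset ℤˣ) = {1, -1} := rfl
      rw [huniv, Finset.sum_pair (by decide)]
      by_cases hu : Even (u i)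
      · obtain ⟨m, hm⟩ := hu
        have hm2 : u i / 2 = m := by omega
        rw [if_pos ⟨m, hm⟩, hm2, hm]
        simp only [map_mul, map_pow, MvPolynomial.aeval_X, map_ofNat]
        push_cast
        rw [← two_mul, pow_mul, pow_mul]
        simp
        ring
      · rw [if_neg hu]
        have := (Nat.not_even_iff_odd.1 hu).neg_pow (z i)
        simp [this]
  | add p q hp hq =>
    obtain ⟨r, hr⟩ := hp
    obtain ⟨s, hs⟩ := hq
    exact ⟨r + s, fun z => by simp only [map_add, Finset.sum_add_distrib, hr, hs]⟩

/-- A polynomial invariant under signed permutations is a polynomial in the elementary symmetric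
polynomials of the squares of the coordinates. -/
lemma exists_esymm_of_invariant {q : MvPolynomial (Fin n) ℝ}
    (hq : ∀ (ε : Fin n → ℤˣ) (π : Equiv.Perm (Fin n)) (z : Fin n → ℝ),
      MvPolynomial.aeval (signedPerm ε π z) q = MvPolynomial.aeval z q) :
    ∃ s : MvPolynomial (Fin n) ℝ, ∀ z : Fin n → ℝ, MvPolynomial.aeval z q =
      MvPolynomial.aeval (fun k : Fin n => MvPolynomial.aeval (fun i => z i ^ 2)
        (MvPolynomial.esymm (Fin n) ℝ (k + 1))) s := by
  classical
  obtain ⟨r, hr⟩ := exists_sum_signs q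
  have hr' : ∀ z : Fin n → ℝ, MvPolynomial.aeval (fun i => z i ^ 2) r
      = (Fintype.card (Fin n → ℤˣ) : ℝ) * MvPolynomial.aeval z q := by
    intro z
    rw [← hr]
    have : ∀ ε : Fin n → ℤˣ, MvPolynomial.aeval (fun i => ((ε i : ℤ) : ℝ) * z i) q
        = MvPolynomial.aeval z q := fun ε => hq ε 1 z
    simp only [this, Finset.sum_const, Finset.card_univ, nsmul_eq_mul]
  set R : MvPolynomial (Fin n) ℝ := ∑ π : Equiv.Perm (Fin n), MvPolynomial.rename π r with hR
  have hRsymm : R.IsSymmetric := by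
    intro τ
    rw [hR, map_sum]
    simp only [MvPolynomial.rename_rename]
    exact Fintype.sum_equiv (Equiv.mulLeft τ) _ _ fun π => rfl
  have hReval : ∀ z : Fin n → ℝ, MvPolynomial.aeval (fun i => z i ^ 2) R
      = (Fintype.card (Equiv.Perm (Fin n)) : ℝ) * ((Fintype.card (Fin n → ℤˣ) : ℝ) *
        MvPolynomial.aeval z q) := by
    intro z
    rw [hR, map_sum]
    have : ∀ π : Equiv.Perm (Fin n), MvPolynomial.aeval (fun i => z i ^ 2)
        (MvPolynomial.rename π r) = (Fintype.card (Fin n → ℤˣ) : ℝ) * MvPolynomial.aeval z q := by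
      intro π
      rw [MvPolynomial.aeval_rename]
      have h1 := hr' (signedPerm 1 π z)
      rw [hq] at h1
      rw [← h1]
      congr 2
      ext i
      simp [signedPerm]
    simp only [this, Finset.sum_const, Finset.card_univ, nsmul_eq_mul]
  obtain ⟨s, hs⟩ := MvPolynomial.esymmAlgHom_surjective (R := ℝ) (σ := Fin n) (n := n) (by simp)
    ⟨R, hRsymm⟩
  have hs' : R = MvPolynomial.aeval (fun k : Fin n => MvPolynomial.esymm (Fin n) ℝ (k + 1)) s := by
    rw [← MvPolynomial.esymmAlgHom_apply, hs]
  set N : ℝ := (Fintype.card (Equiv.Perm (Fin n)) : ℝ) * (Fintype.card (Fin n → ℤˣ) : ℝ) with hN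
  have hN0 : N ≠ 0 := mul_ne_zero (by exact_mod_cast Fintype.card_ne_zero)
    (by exact_mod_cast Fintype.card_ne_zero)
  refine ⟨MvPolynomial.C N⁻¹ * s, fun z => ?_⟩
  have h1 := hReval z
  rw [hs', MvPolynomial.comp_aeval_apply, ← mul_assoc, ← hN] at h1
  rw [map_mul, h1]
  simp only [MvPolynomial.algHom_C, Algebra.algebraMap_self, RingHom.id_apply]
  field_simp

/-- Substituting functions with polynomial real and imaginary parts into a complex polynomial gives
a function of the same kind. -/
lemma polyFun_re_im {κ τ : Type} (p : MvPolynomial τ ℂ) {g : (κ → ℝ) → τ → ℂ}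
    (hg : ∀ i, (fun v => (g v i).re) ∈ polyFun κ ∧ (fun v => (g v i).im) ∈ polyFun κ) :
    (fun v => (MvPolynomial.eval (g v) p).re) ∈ polyFun κ ∧
      (fun v => (MvPolynomial.eval (g v) p).im) ∈ polyFun κ := by
  induction p using MvPolynomial.induction_on with
  | C a =>
    simp only [MvPolynomial.eval_C]
    exact ⟨polyFun_const _, polyFun_const _⟩
  | add p q hp hq =>
    simp only [map_add, Complex.add_re, Complex.add_im]
    exact ⟨add_mem hp.1 hq.1, add_mem hp.2 hq.2⟩
  | mul_X p i hp =>
    simp only [map_mul, MvPolynomial.eval_X, Complex.mul_re, Complex.mul_im]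
    exact ⟨sub_mem (mul_mem hp.1 (hg i).1) (mul_mem hp.2 (hg i).2),
      add_mem (mul_mem hp.1 (hg i).2) (mul_mem hp.2 (hg i).1)⟩

lemma polyFun_charpoly_coeff (n t k : ℕ) :
    (fun v : RealIdx n t → ℝ =>
      ((((realCoords n t).symm v) * ((realCoords n t).symm v)ᴴ).charpoly.coeff k).re)
      ∈ polyFun (RealIdx n t) := by
  have h := (polyFun_re_im ((Matrix.charpoly.univ ℂ (Fin n)).coeff k)
    (g := fun (v : RealIdx n t → ℝ) (q : Fin n × Fin n) =>
      (((realCoords n t).symm v) * ((realCoords n t).symm v)ᴴ) q.1 q.2) fun q => by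
    have hre : ∀ i j, (fun v : RealIdx n t → ℝ => ((realCoords n t).symm v i j).re)
        ∈ polyFun (RealIdx n t) := fun i j => polyFun_coord (Sum.inl (i, j))
    have him : ∀ i j, (fun v : RealIdx n t → ℝ => ((realCoords n t).symm v i j).im)
        ∈ polyFun (RealIdx n t) := fun i j => polyFun_coord (Sum.inr (i, j))
    have hsum : ∀ f : Fin t → (RealIdx n t → ℝ) → ℝ, (∀ j, f j ∈ polyFun (RealIdx n t)) →
        (fun v => ∑ j, f j v) ∈ polyFun (RealIdx n t) := fun f hf => by
      have := sum_mem (S := polyFun (RealIdx n t)) (t := Finset.univ) fun j _ => hf j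
      convert this using 1
      ext v
      simp
    constructor
    · simp only [Matrix.mul_apply, Matrix.conjTranspose_apply, Complex.re_sum, Complex.mul_re,
        RCLike.star_def, Complex.conj_re, Complex.conj_im]
      exact hsum _ fun j => sub_mem (mul_mem (hre _ _) (hre _ _))
        (mul_mem (him _ _) (neg_mem (him _ _)))
    · simp only [Matrix.mul_apply, Matrix.conjTranspose_apply, Complex.im_sum, Complex.mul_im,
        RCLike.star_def, Complex.conj_re, Complex.conj_im]
      exact hsum _ fun j => add_mem (mul_mem (hre _ _) (neg_mem (him _ _)))
        (mul_mem (him _ _) (hre _ _))).1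
  convert h using 4 with v
  have := Matrix.charpoly.univ_coeff_eval₂Hom (n := Fin n) (RingHom.id ℂ)
    (fun q => (((realCoords n t).symm v) * ((realCoords n t).symm v)ᴴ) q.1 q.2) k
  rw [MvPolynomial.eval, this]
  rfl

lemma charpoly_svd (hnt : n ≤ t) {U : Matrix (Fin n) (Fin n) ℂ}
    (hU : U ∈ Matrix.unitaryGroup (Fin n) ℂ) {V : Matrix (Fin t) (Fin t) ℂ}
    (hV : V ∈ Matrix.unitaryGroup (Fin t) ℂ) (z : Fin n → ℝ) :
    ((U * rectDiag t z * Vᴴ) * (U * rectDiag t z * Vᴴ)ᴴ).charpoly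
      = ((Finset.univ.val.map fun i => z i ^ 2).map fun a : ℝ =>
        (Polynomial.X - Polynomial.C a)).prod.map (algebraMap ℝ ℂ) := by
  have h1 : (U * rectDiag t z * Vᴴ) * (U * rectDiag t z * Vᴴ)ᴴ
      = U * Matrix.diagonal (fun i => ((z i * z i : ℝ) : ℂ)) * Uᴴ := by
    rw [← rectDiag_mul_conjTranspose hnt]
    simp only [Matrix.conjTranspose_mul, Matrix.conjTranspose_conjTranspose, Matrix.mul_assoc]
    rw [← Matrix.mul_assoc Vᴴ, unitary_conjTranspose_mul hV, Matrix.one_mul]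
  rw [h1, Matrix.charpoly_mul_comm, ← Matrix.mul_assoc, unitary_conjTranspose_mul hU,
    Matrix.one_mul, Matrix.charpoly_diagonal, Polynomial.map_multiset_prod]
  simp only [Multiset.map_map, Function.comp_def, Polynomial.map_sub, Polynomial.map_X,
    Polynomial.map_C]
  refine Finset.prod_congr rfl fun i _ => ?_
  simp [pow_two]

/-- A polynomial invariant under signed permutations extends from the singular values to a
polynomial function of the matrix. -/
theorem exists_lift (hnt : n ≤ t) {q : MvPolynomial (Fin n) ℝ}
    (hq : ∀ (ε : Fin n → ℤˣ) (π : Equiv.Perm (Fin n)) (z : Fin n → ℝ),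
      MvPolynomial.aeval (signedPerm ε π z) q = MvPolynomial.aeval z q) :
    ∃ Q : MvPolynomial (RealIdx n t) ℝ, ∀ U ∈ Matrix.unitaryGroup (Fin n) ℂ,
      ∀ V ∈ Matrix.unitaryGroup (Fin t) ℂ, ∀ z : Fin n → ℝ,
        MvPolynomial.aeval (realCoords n t (U * rectDiag t z * Vᴴ)) Q
          = MvPolynomial.aeval z q := by
  obtain ⟨s, hs⟩ := exists_esymm_of_invariant hq
  obtain ⟨Q, hQ⟩ := mem_polyFun.1 (polyFun_aeval s
    (g := fun (v : RealIdx n t → ℝ) (k : Fin n) => (-1) ^ (k + 1 : ℕ) *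
      ((((realCoords n t).symm v) * ((realCoords n t).symm v)ᴴ).charpoly.coeff (n - (k + 1))).re)
    fun k => mul_mem (polyFun_const _) (polyFun_charpoly_coeff n t _))
  refine ⟨Q, fun U hU V hV z => ?_⟩
  rw [← hQ, hs]
  congr 2
  ext k
  have hk := k.2
  have hcard : Multiset.card (Finset.univ.val.map fun i : Fin n => z i ^ 2) = n := by simp
  rw [LinearEquiv.symm_apply_apply, charpoly_svd hnt hU hV, Polynomial.coeff_map,
    Multiset.prod_X_sub_C_coeff _ (by rw [hcard]; omega), hcard,
    MvPolynomial.aeval_esymm_eq_multiset_esymm]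
  have h3 : n - (n - (k + 1 : ℕ)) = k + 1 := by omega
  rw [h3, Complex.coe_algebraMap, Complex.ofReal_re, ← mul_assoc, ← mul_pow]
  simp

/-! ### Symmetrization -/

lemma exists_comp_signedPerm (p : MvPolynomial (Fin n) ℝ) (ε : Fin n → ℤˣ)
    (π : Equiv.Perm (Fin n)) : ∃ q : MvPolynomial (Fin n) ℝ,
      ∀ z, MvPolynomial.aeval z q = MvPolynomial.aeval (signedPerm ε π z) p := by
  obtain ⟨q, hq⟩ := mem_polyFun.1 (polyFun_aeval p (g := signedPerm ε π) fun k =>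
    mul_mem (polyFun_const _) (polyFun_coord _))
  exact ⟨q, fun z => (hq z).symm⟩

lemma signedPerm_comp (ε ε' : Fin n → ℤˣ) (π π' : Equiv.Perm (Fin n)) (z : Fin n → ℝ) :
    signedPerm ε π (signedPerm ε' π' z) = signedPerm (fun i => ε i * ε' (π i)) (π' * π) z := by
  ext i
  simp [signedPerm, mul_assoc]

/-- Right translation by a fixed element permutes the group of signed permutations. -/
lemma bijective_signedPerm_mul (ε' : Fin n → ℤˣ) (π' : Equiv.Perm (Fin n)) :
    Function.Bijective fun g : (Fin n → ℤˣ) × Equiv.Perm (Fin n) =>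
      ((fun i => g.1 i * ε' (g.2 i), π' * g.2) : (Fin n → ℤˣ) × Equiv.Perm (Fin n)) := by
  rw [← Finite.injective_iff_bijective]
  rintro ⟨ε₁, π₁⟩ ⟨ε₂, π₂⟩ h
  obtain ⟨h1, h2⟩ := Prod.mk.inj h
  have h3 : π₁ = π₂ := mul_left_cancel h2
  subst h3
  refine Prod.ext (funext fun i => ?_) rfl
  exact mul_right_cancel (congrFun h1 i)

/-- A set invariant under signed permutations is preserved by each of them. -/
lemma IsAbsolutelySymmetric.signedPerm_mem {S : Set (Fin n → ℝ)} (hS : IsAbsolutelySymmetric S)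
    (ε : Fin n → ℤˣ) (π : Equiv.Perm (Fin n)) {x : Fin n → ℝ} (hx : x ∈ S) :
    signedPerm ε π x ∈ S := by
  rw [← hS ε π]
  exact ⟨x, hx, rfl⟩

/-- Sum of the squares of the translates of a polynomial, lifted to matrices. -/
lemma exists_lift_sum_sq (hnt : n ≤ t) (p : MvPolynomial (Fin n) ℝ) :
    ∃ Q : MvPolynomial (RealIdx n t) ℝ, ∀ U ∈ Matrix.unitaryGroup (Fin n) ℂ,
      ∀ V ∈ Matrix.unitaryGroup (Fin t) ℂ, ∀ z : Fin n → ℝ,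
        MvPolynomial.aeval (realCoords n t (U * rectDiag t z * Vᴴ)) Q
          = ∑ g : (Fin n → ℤˣ) × Equiv.Perm (Fin n),
            MvPolynomial.aeval (signedPerm g.1 g.2 z) p ^ 2 := by
  choose c hc using exists_comp_signedPerm p
  have hval : ∀ z : Fin n → ℝ, MvPolynomial.aeval z (∑ g : (Fin n → ℤˣ) × Equiv.Perm (Fin n),
      c g.1 g.2 ^ 2) = ∑ g : (Fin n → ℤˣ) × Equiv.Perm (Fin n),
        MvPolynomial.aeval (signedPerm g.1 g.2 z) p ^ 2 := fun z => by
    simp only [map_sum, map_pow, hc]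
  obtain ⟨Q, hQ⟩ := exists_lift hnt (q := ∑ g : (Fin n → ℤˣ) × Equiv.Perm (Fin n), c g.1 g.2 ^ 2)
    fun ε π z => by
      rw [hval, hval]
      simp only [signedPerm_comp]
      exact Fintype.sum_bijective _ (bijective_signedPerm_mul ε π) _ _ fun g => rfl
  exact ⟨Q, fun U hU V hV z => by rw [hQ U hU V hV, hval]⟩

/-- Product of the translates of a polynomial, lifted to matrices. -/
lemma exists_lift_prod (hnt : n ≤ t) (p : MvPolynomial (Fin n) ℝ) :
    ∃ Q : MvPolynomial (RealIdx n t) ℝ, ∀ U ∈ Matrix.unitaryGroup (Fin n) ℂ,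
      ∀ V ∈ Matrix.unitaryGroup (Fin t) ℂ, ∀ z : Fin n → ℝ,
        MvPolynomial.aeval (realCoords n t (U * rectDiag t z * Vᴴ)) Q
          = ∏ g : (Fin n → ℤˣ) × Equiv.Perm (Fin n),
            MvPolynomial.aeval (signedPerm g.1 g.2 z) p := by
  choose c hc using exists_comp_signedPerm p
  have hval : ∀ z : Fin n → ℝ, MvPolynomial.aeval z (∏ g : (Fin n → ℤˣ) × Equiv.Perm (Fin n),
      c g.1 g.2) = ∏ g : (Fin n → ℤˣ) × Equiv.Perm (Fin n),
        MvPolynomial.aeval (signedPerm g.1 g.2 z) p := fun z => by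
    simp only [map_prod, hc]
  obtain ⟨Q, hQ⟩ := exists_lift hnt (q := ∏ g : (Fin n → ℤˣ) × Equiv.Perm (Fin n), c g.1 g.2)
    fun ε π z => by
      rw [hval, hval]
      simp only [signedPerm_comp]
      exact Fintype.prod_bijective _ (bijective_signedPerm_mul ε π) _ _ fun g => rfl
  exact ⟨Q, fun U hU V hV z => by rw [hQ U hU V hV, hval]⟩

/-- Membership of a matrix in `σ⁻¹(S)` can be read off from any singular value decomposition; the
matrices in `σ⁻¹(S)` are the zeros of one polynomial. -/
lemma exists_polynomial_sigmaInv (hnt : n ≤ t) {S : Set (Fin n → ℝ)} (hS : IsRealAlgebraic S)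
    (hsym : IsAbsolutelySymmetric S) :
    ∃ Q : MvPolynomial (RealIdx n t) ℝ, ∀ U ∈ Matrix.unitaryGroup (Fin n) ℂ,
      ∀ V ∈ Matrix.unitaryGroup (Fin t) ℂ, ∀ z : Fin n → ℝ,
        MvPolynomial.aeval (realCoords n t (U * rectDiag t z * Vᴴ)) Q = 0 ↔ z ∈ S := by
  obtain ⟨m, f, hfI, hfS, -⟩ := exists_generators hS
  obtain ⟨Q, hQ⟩ := exists_lift_sum_sq hnt (∑ j, f j ^ 2)
  refine ⟨Q, fun U hU V hV z => ?_⟩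
  have hzero : ∀ z : Fin n → ℝ, MvPolynomial.aeval z (∑ j, f j ^ 2) = 0 ↔ z ∈ S := by
    intro z
    rw [hfS, map_sum, Finset.sum_eq_zero_iff_of_nonneg fun j _ => by
      rw [map_pow]
      positivity]
    simp
  rw [hQ U hU V hV, Finset.sum_eq_zero_iff_of_nonneg fun g _ => sq_nonneg _]
  simp only [pow_eq_zero_iff two_ne_zero, hzero, Finset.mem_univ, true_imp_iff]
  constructor
  · intro h
    convert h (1, 1)
    ext i
    simp [signedPerm]
  · exact fun h g => hsym.signedPerm_mem _ _ h

lemma mem_sigmaInv_iff (hnt : n ≤ t) {S : Set (Fin n → ℝ)} (hS : IsRealAlgebraic S)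
    (hsym : IsAbsolutelySymmetric S) {U : Matrix (Fin n) (Fin n) ℂ}
    (hU : U ∈ Matrix.unitaryGroup (Fin n) ℂ) {V : Matrix (Fin t) (Fin t) ℂ}
    (hV : V ∈ Matrix.unitaryGroup (Fin t) ℂ) (z : Fin n → ℝ) :
    U * rectDiag t z * Vᴴ ∈ sigmaInv t S ↔ z ∈ S := by
  obtain ⟨Q, hQ⟩ := exists_polynomial_sigmaInv hnt hS hsym
  refine ⟨fun ⟨x, hx, U', hU', V', hV', h⟩ => ?_, fun h => ⟨z, h, U, hU, V, hV, rfl⟩⟩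
  rw [← hQ U hU V hV z, h, hQ U' hU' V' hV' x]
  exact hx

theorem isRealAlgebraic_sigmaInv (hnt : n ≤ t) {S : Set (Fin n → ℝ)} (hS : IsRealAlgebraic S)
    (hsym : IsAbsolutelySymmetric S) : IsRealAlgebraic (realCoords n t '' sigmaInv t S) := by
  obtain ⟨Q, hQ⟩ := exists_polynomial_sigmaInv hnt hS hsym
  refine ⟨Ideal.span {Q}, ?_⟩
  ext v
  obtain ⟨A, rfl⟩ := (realCoords n t).surjective v
  obtain ⟨U, hU, V, hV, z, rfl⟩ := exists_svd hnt A
  rw [(realCoords n t).injective.mem_set_image, mem_sigmaInv_iff hnt hS hsym hU hV,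
    ← hQ U hU V hV z, MvPolynomial.zeroLocus_span]
  simp

end HDDegree

namespace HDDegree

variable {n t : ℕ}

/-! ### The Hermitian inner product in real coordinates -/

/-- The real part of the Hermitian inner product is the standard inner product of `ℝ^{2nt}`. -/
lemma realCoords_dotProduct (A B : Matrix (Fin n) (Fin t) ℂ) :
    realCoords n t A ⬝ᵥ realCoords n t B = (Matrix.trace (A * Bᴴ)).re := by
  simp only [realCoords, LinearEquiv.coe_mk, LinearMap.coe_mk, AddHom.coe_mk, dotProduct,
    Fintype.sum_sum_type, Sum.elim_inl, Sum.elim_inr, Matrix.trace, Matrix.diag_apply,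
    Matrix.mul_apply, Matrix.conjTranspose_apply, Complex.re_sum, RCLike.star_def,
    Complex.mul_re, Complex.conj_re, Complex.conj_im, Fintype.sum_prod_type,
    ← Finset.sum_add_distrib]
  refine Finset.sum_congr rfl fun i _ => Finset.sum_congr rfl fun j _ => ?_
  ring

lemma mem_matTangentSpace {M : Set (Matrix (Fin n) (Fin t) ℂ)} {X A : Matrix (Fin n) (Fin t) ℂ} :
    A ∈ matTangentSpace M X ↔
      realCoords n t A ∈ tangentSpace (realCoords n t '' M) (realCoords n t X) := Iff.rfl

/-- HD critical points are ED critical points in real coordinates. -/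
lemma mem_hdCritical_iff {M : Set (Matrix (Fin n) (Fin t) ℂ)} {X Y : Matrix (Fin n) (Fin t) ℂ} :
    X ∈ hdCritical M Y ↔
      realCoords n t X ∈ edCritical (realCoords n t '' M) (realCoords n t Y) := by
  have key : ∀ A, (Matrix.trace ((Y - X) * Aᴴ)).re = 0 ↔
      (realCoords n t X - realCoords n t Y) ⬝ᵥ realCoords n t A = 0 := fun A => by
    rw [← realCoords_dotProduct, map_sub, ← neg_sub, neg_dotProduct, neg_eq_zero]
  constructor
  · refine fun ⟨h1, h2⟩ => ⟨h1, fun a ha => ?_⟩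
    obtain ⟨A, rfl⟩ := (realCoords n t).surjective a
    exact (key A).1 (h2 A ha)
  · exact fun ⟨h1, h2⟩ => ⟨h1, fun A hA => (key A).2 (h2 _ hA)⟩

/-! ### Unitary equivalences -/

/-- The linear automorphism `A ↦ U A V^*` of the space of matrices. -/
noncomputable def unitaryEquiv {U : Matrix (Fin n) (Fin n) ℂ}
    (hU : U ∈ Matrix.unitaryGroup (Fin n) ℂ) {V : Matrix (Fin t) (Fin t) ℂ}
    (hV : V ∈ Matrix.unitaryGroup (Fin t) ℂ) :
    Matrix (Fin n) (Fin t) ℂ ≃ₗ[ℝ] Matrix (Fin n) (Fin t) ℂ where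
  toFun A := U * A * Vᴴ
  invFun A := Uᴴ * A * V
  map_add' A B := by rw [Matrix.mul_add, Matrix.add_mul]
  map_smul' c A := by rw [Matrix.mul_smul, Matrix.smul_mul, RingHom.id_apply]
  left_inv A := by
    simp only [Matrix.mul_assoc, unitary_conjTranspose_mul hV, Matrix.mul_one]
    rw [← Matrix.mul_assoc, unitary_conjTranspose_mul hU, Matrix.one_mul]
  right_inv A := by
    simp only [Matrix.mul_assoc, unitary_mul_conjTranspose hV, Matrix.mul_one]
    rw [← Matrix.mul_assoc, unitary_mul_conjTranspose hU, Matrix.one_mul]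

lemma unitaryEquiv_apply {U : Matrix (Fin n) (Fin n) ℂ}
    (hU : U ∈ Matrix.unitaryGroup (Fin n) ℂ) {V : Matrix (Fin t) (Fin t) ℂ}
    (hV : V ∈ Matrix.unitaryGroup (Fin t) ℂ) (A : Matrix (Fin n) (Fin t) ℂ) :
    unitaryEquiv hU hV A = U * A * Vᴴ := rfl

lemma trace_unitaryEquiv {U : Matrix (Fin n) (Fin n) ℂ}
    (hU : U ∈ Matrix.unitaryGroup (Fin n) ℂ) {V : Matrix (Fin t) (Fin t) ℂ}
    (hV : V ∈ Matrix.unitaryGroup (Fin t) ℂ) (A B : Matrix (Fin n) (Fin t) ℂ) :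
    Matrix.trace ((U * A * Vᴴ) * (U * B * Vᴴ)ᴴ) = Matrix.trace (A * Bᴴ) := by
  have h : (U * A * Vᴴ) * (U * B * Vᴴ)ᴴ = U * (A * Bᴴ * Uᴴ) := by
    simp only [Matrix.conjTranspose_mul, Matrix.conjTranspose_conjTranspose, Matrix.mul_assoc]
    rw [← Matrix.mul_assoc Vᴴ, unitary_conjTranspose_mul hV, Matrix.one_mul]
  rw [h, Matrix.trace_mul_comm, Matrix.mul_assoc, unitary_conjTranspose_mul hU, Matrix.mul_one]

/-- `σ⁻¹(S)` is invariant under unitary equivalences. -/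
lemma unitaryEquiv_mem_sigmaInv {S : Set (Fin n → ℝ)} {U : Matrix (Fin n) (Fin n) ℂ}
    (hU : U ∈ Matrix.unitaryGroup (Fin n) ℂ) {V : Matrix (Fin t) (Fin t) ℂ}
    (hV : V ∈ Matrix.unitaryGroup (Fin t) ℂ) {A : Matrix (Fin n) (Fin t) ℂ}
    (hA : A ∈ sigmaInv t S) : U * A * Vᴴ ∈ sigmaInv t S := by
  obtain ⟨x, hx, U', hU', V', hV', rfl⟩ := hA
  refine ⟨x, hx, U * U', mul_mem hU hU', V * V', mul_mem hV hV', ?_⟩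
  simp only [Matrix.conjTranspose_mul, Matrix.mul_assoc]

/-- A linear isometry preserving `S` transports ED critical points. -/
lemma map_mem_edCritical {ι : Type} [Fintype ι] {S : Set (ι → ℝ)} (L : (ι → ℝ) ≃ₗ[ℝ] ι → ℝ)
    (hL : ∀ x, L x ∈ S ↔ x ∈ S) (hiso : ∀ a b, L a ⬝ᵥ L b = a ⬝ᵥ b) {x y : ι → ℝ}
    (hx : x ∈ edCritical S y) : L x ∈ edCritical S (L y) := by
  refine ⟨map_mem_regularLocus L hL hx.1, fun a ha => ?_⟩
  have h1 := map_mem_tangentSpace (S' := S) L.symm.toLinearMap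
    (fun z hz => (hL _).1 (by simpa using hz)) ha
  have h2 := hx.2 (L.symm a) (by simpa using h1)
  rwa [← hiso, map_sub, L.apply_symm_apply] at h2

/-- HD critical points are equivariant under unitary equivalences. -/
lemma unitary_mem_hdCritical {S : Set (Fin n → ℝ)} {U : Matrix (Fin n) (Fin n) ℂ}
    (hU : U ∈ Matrix.unitaryGroup (Fin n) ℂ) {V : Matrix (Fin t) (Fin t) ℂ}
    (hV : V ∈ Matrix.unitaryGroup (Fin t) ℂ) {X Y : Matrix (Fin n) (Fin t) ℂ}
    (hX : X ∈ hdCritical (sigmaInv t S) Y) :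
    U * X * Vᴴ ∈ hdCritical (sigmaInv t S) (U * Y * Vᴴ) := by
  rw [mem_hdCritical_iff] at hX ⊢
  have h := map_mem_edCritical
    ((realCoords n t).symm.trans ((unitaryEquiv hU hV).trans (realCoords n t))) ?_ ?_ hX
  · simpa [unitaryEquiv_apply] using h
  · intro x
    obtain ⟨A, rfl⟩ := (realCoords n t).surjective x
    simp only [LinearEquiv.trans_apply, LinearEquiv.symm_apply_apply,
      (realCoords n t).injective.mem_set_image]
    refine ⟨fun h => ?_, fun h => unitaryEquiv_mem_sigmaInv hU hV h⟩
    have h1 := unitaryEquiv_mem_sigmaInv (unitary_conjTranspose_mem hU)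
      (unitary_conjTranspose_mem hV) h
    rw [Matrix.conjTranspose_conjTranspose] at h1
    rwa [← (unitaryEquiv hU hV).symm_apply_apply A]
  · intro a b
    obtain ⟨A, rfl⟩ := (realCoords n t).surjective a
    obtain ⟨B, rfl⟩ := (realCoords n t).surjective b
    simp only [LinearEquiv.trans_apply, LinearEquiv.symm_apply_apply, realCoords_dotProduct,
      unitaryEquiv_apply, trace_unitaryEquiv hU hV]

/-! ### Tangent vectors to unitary orbits -/

section Orbit

attribute [local instance] Matrix.linftyOpNormedAddCommGroup Matrix.linftyOpNormedSpace
  Matrix.linftyOpNormedRing Matrix.linftyOpNormedAlgebra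

lemma exp_skew_mem_unitaryGroup (Z : Matrix (Fin n) (Fin n) ℂ) :
    NormedSpace.exp (Z - Zᴴ) ∈ Matrix.unitaryGroup (Fin n) ℂ := by
  have h : (Z - Zᴴ)ᴴ = -(Z - Zᴴ) := by
    rw [Matrix.conjTranspose_sub, Matrix.conjTranspose_conjTranspose, neg_sub]
  rw [Matrix.mem_unitaryGroup_iff, Matrix.star_eq_conjTranspose, ← Matrix.exp_conjTranspose, h,
    ← Matrix.exp_add_of_commute _ _ (Commute.neg_right (Commute.refl (Z - Zᴴ))), add_neg_cancel,
    NormedSpace.exp_zero]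

/-- The linear map `Z ↦ Z - Z^*` onto the skew-Hermitian matrices. -/
noncomputable def skewPart (n : ℕ) : Matrix (Fin n) (Fin n) ℂ →ₗ[ℝ] Matrix (Fin n) (Fin n) ℂ where
  toFun Z := Z - Zᴴ
  map_add' Z W := by
    rw [Matrix.conjTranspose_add]
    abel
  map_smul' c Z := by
    rw [Matrix.conjTranspose_smul, star_trivial, smul_sub, RingHom.id_apply]

/-- Matrix multiplication as a continuous bilinear map. -/
noncomputable def matMulL (l m k : ℕ) : Matrix (Fin l) (Fin m) ℂ →L[ℝ]
    Matrix (Fin m) (Fin k) ℂ →L[ℝ] Matrix (Fin l) (Fin k) ℂ :=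
  (LinearMap.mk₂ ℝ (fun A B => A * B) (fun _ _ _ => Matrix.add_mul _ _ _)
    (fun _ _ _ => Matrix.smul_mul _ _ _) (fun _ _ _ => Matrix.mul_add _ _ _)
    (fun _ _ _ => Matrix.mul_smul _ _ _)).toContinuousBilinearMap

lemma hasStrictFDerivAt_exp_skew : HasStrictFDerivAt
    (fun Z : Matrix (Fin n) (Fin n) ℂ => NormedSpace.exp (Z - Zᴴ))
    (LinearMap.toContinuousLinearMap (skewPart n)) 0 := by
  have h1 := hasStrictFDerivAt_exp_zero (𝕂 := ℝ) (𝔸 := Matrix (Fin n) (Fin n) ℂ)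
  have h2 := (LinearMap.toContinuousLinearMap (skewPart n)).hasStrictFDerivAt (x := 0)
  have h3 : LinearMap.toContinuousLinearMap (skewPart n) 0 = 0 := map_zero _
  rw [← h3] at h1
  exact h1.comp 0 h2

/-- Moving a family of matrices by unitary equivalences adds the orbit directions to its
velocities. -/
lemma exists_orbit_deriv {F : Type*} [NormedAddCommGroup F] [NormedSpace ℝ F]
    {G : F → Matrix (Fin n) (Fin t) ℂ} {G' : F →L[ℝ] Matrix (Fin n) (Fin t) ℂ}
    (hG : HasStrictFDerivAt G G' 0) :
    ∃ Ψ' : F × (Matrix (Fin n) (Fin n) ℂ × Matrix (Fin t) (Fin t) ℂ) →L[ℝ] RealIdx n t → ℝ,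
      HasStrictFDerivAt (fun q => realCoords n t
        (NormedSpace.exp (q.2.1 - q.2.1ᴴ) * G q.1 * NormedSpace.exp (q.2.2 - q.2.2ᴴ))) Ψ' 0 ∧
      ∀ b Z W, Ψ' (b, (Z, W)) =
        realCoords n t (G' b + (Z - Zᴴ) * G 0 + G 0 * (W - Wᴴ)) := by
  have hZ : HasStrictFDerivAt
      (fun q : F × (Matrix (Fin n) (Fin n) ℂ × Matrix (Fin t) (Fin t) ℂ) =>
        NormedSpace.exp (q.2.1 - q.2.1ᴴ)) _ 0 :=
    HasStrictFDerivAt.comp (0 : F × (Matrix (Fin n) (Fin n) ℂ × Matrix (Fin t) (Fin t) ℂ))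
      (f := fun q => q.2.1) hasStrictFDerivAt_exp_skew
      hasStrictFDerivAt_snd.fst
  have hW : HasStrictFDerivAt
      (fun q : F × (Matrix (Fin n) (Fin n) ℂ × Matrix (Fin t) (Fin t) ℂ) =>
        NormedSpace.exp (q.2.2 - q.2.2ᴴ)) _ 0 :=
    HasStrictFDerivAt.comp (0 : F × (Matrix (Fin n) (Fin n) ℂ × Matrix (Fin t) (Fin t) ℂ))
      (f := fun q => q.2.2) hasStrictFDerivAt_exp_skew
      hasStrictFDerivAt_snd.snd
  have hGq : HasStrictFDerivAt
      (fun q : F × (Matrix (Fin n) (Fin n) ℂ × Matrix (Fin t) (Fin t) ℂ) => G q.1) _ 0 :=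
    HasStrictFDerivAt.comp (0 : F × (Matrix (Fin n) (Fin n) ℂ × Matrix (Fin t) (Fin t) ℂ))
      (f := Prod.fst) hG hasStrictFDerivAt_fst
  have h1 := (matMulL n n t).hasStrictFDerivAt_of_bilinear hZ hGq
  have h2 := (matMulL n t t).hasStrictFDerivAt_of_bilinear h1 hW
  have h3 := (LinearMap.toContinuousLinearMap (realCoords n t).toLinearMap).hasStrictFDerivAt.comp
    (0 : F × (Matrix (Fin n) (Fin n) ℂ × Matrix (Fin t) (Fin t) ℂ)) h2
  refine ⟨_, h3, fun b Z W => ?_⟩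
  change realCoords n t (NormedSpace.exp ((0 : Matrix (Fin n) (Fin n) ℂ) - 0ᴴ) * G 0 * (W - Wᴴ) +
    (NormedSpace.exp ((0 : Matrix (Fin n) (Fin n) ℂ) - 0ᴴ) * G' b + (Z - Zᴴ) * G 0) *
      NormedSpace.exp ((0 : Matrix (Fin t) (Fin t) ℂ) - 0ᴴ)) = _
  rw [Matrix.conjTranspose_zero, Matrix.conjTranspose_zero, sub_self, sub_self,
    NormedSpace.exp_zero, NormedSpace.exp_zero, Matrix.one_mul, Matrix.one_mul, Matrix.mul_one,
    add_comm]

/-- The directions of the unitary orbit through `X ∈ σ⁻¹(S)` are tangent to `σ⁻¹(S)`. -/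
lemma orbit_mem_matTangentSpace {S : Set (Fin n → ℝ)} {X : Matrix (Fin n) (Fin t) ℂ}
    (hX : X ∈ sigmaInv t S) (Z : Matrix (Fin n) (Fin n) ℂ) (W : Matrix (Fin t) (Fin t) ℂ) :
    (Z - Zᴴ) * X + X * (W - Wᴴ) ∈ matTangentSpace (sigmaInv t S) X := by
  obtain ⟨Ψ', hΨ, hΨ'⟩ := exists_orbit_deriv (n := n) (t := t) (F := ℝ)
    (hasStrictFDerivAt_const X (0 : ℝ))
  have h := fderiv_mem_tangentSpace (S := realCoords n t '' sigmaInv t S) hΨ.hasFDerivAt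
    (Filter.Eventually.of_forall fun q => ⟨_, by
      have := unitaryEquiv_mem_sigmaInv (exp_skew_mem_unitaryGroup q.2.1)
        (unitary_conjTranspose_mem (exp_skew_mem_unitaryGroup q.2.2)) hX
      rwa [Matrix.conjTranspose_conjTranspose] at this, rfl⟩) (0, (Z, W))
  have h1 := hΨ' 0 Z W
  rw [zero_apply, zero_add] at h1
  rw [mem_matTangentSpace, ← h1]
  convert h using 2
  · simp
  · rfl

end Orbit

end HDDegree

namespace HDDegree

variable {n t : ℕ}

/-! ### Matrices with Hermitian products -/

/-- A square matrix orthogonal to all skew-Hermitian matrices is Hermitian. -/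
lemma conjTranspose_eq_of_orth_skew {m : ℕ} {H : Matrix (Fin m) (Fin m) ℂ}
    (h : ∀ Z : Matrix (Fin m) (Fin m) ℂ, (Matrix.trace (H * (Z - Zᴴ)ᴴ)).re = 0) : Hᴴ = H := by
  have h1 := h H
  have h2 : (Matrix.trace (Hᴴ * (H - Hᴴ)ᴴ)).re = 0 := by
    have : Hᴴ * (H - Hᴴ)ᴴ = ((H - Hᴴ) * H)ᴴ := (Matrix.conjTranspose_mul _ _).symm
    rw [this, Matrix.trace_conjTranspose, Matrix.trace_mul_comm, RCLike.star_def,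
      Complex.conj_re, ← neg_eq_zero, ← Complex.neg_re, ← Matrix.trace_neg, ← mul_neg, neg_sub]
    rwa [Matrix.conjTranspose_sub, Matrix.conjTranspose_conjTranspose] at h1
  have h3 : realCoords m m (H - Hᴴ) = 0 := dotProduct_self_eq_zero_real (by
    rw [realCoords_dotProduct, Matrix.sub_mul, Matrix.trace_sub, Complex.sub_re, h1, h2, sub_zero])
  exact (sub_eq_zero.1 ((realCoords m m).map_eq_zero_iff.1 h3)).symm

/-- A matrix orthogonal to the directions of the unitary orbit of `X` has Hermitian products
with `X`. -/
lemma hermitian_of_orth_orbit {B X : Matrix (Fin n) (Fin t) ℂ}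
    (h : ∀ (Z : Matrix (Fin n) (Fin n) ℂ) (W : Matrix (Fin t) (Fin t) ℂ),
      (Matrix.trace (B * ((Z - Zᴴ) * X + X * (W - Wᴴ))ᴴ)).re = 0) :
    (B * Xᴴ)ᴴ = B * Xᴴ ∧ (Xᴴ * B)ᴴ = Xᴴ * B := by
  constructor
  · refine conjTranspose_eq_of_orth_skew fun Z => ?_
    have := h Z 0
    rwa [Matrix.conjTranspose_zero, sub_zero, Matrix.mul_zero, add_zero, Matrix.conjTranspose_mul,
      ← Matrix.mul_assoc] at this
  · refine conjTranspose_eq_of_orth_skew fun W => ?_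
    have := h 0 W
    rwa [Matrix.conjTranspose_zero, sub_zero, Matrix.zero_mul, zero_add, Matrix.conjTranspose_mul,
      ← Matrix.mul_assoc, Matrix.trace_mul_comm, ← Matrix.mul_assoc] at this

/-- The entries of `z` are nonzero and their squares are distinct: the singular values of
`diag(z)` are simple and positive. -/
def HasSimpleSquares (z : Fin n → ℝ) : Prop :=
  (∀ i, z i ≠ 0) ∧ ∀ i j, i ≠ j → z i ^ 2 ≠ z j ^ 2

/-- A matrix with Hermitian products with a diagonal matrix with simple singular values is real
diagonal. -/
lemma eq_rectDiag_of_hermitian (hnt : n ≤ t) {y : Fin n → ℝ} (hy : HasSimpleSquares y)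
    {A : Matrix (Fin n) (Fin t) ℂ} (h1 : (rectDiag t y * Aᴴ)ᴴ = rectDiag t y * Aᴴ)
    (h2 : (Aᴴ * rectDiag t y)ᴴ = Aᴴ * rectDiag t y) : ∃ x : Fin n → ℝ, A = rectDiag t x := by
  have e1 : ∀ i k : Fin n, A i (Fin.castLE hnt k) * y k = y i * star (A k (Fin.castLE hnt i)) := by
    intro i k
    have := congrFun (congrFun h1 i) k
    rwa [Matrix.conjTranspose_mul, Matrix.conjTranspose_conjTranspose,
      mul_rectDiag_conjTranspose_apply hnt, rectDiag_mul_apply hnt] at this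
  have e2 : ∀ (j : Fin t) (k : Fin n), y k * star (A k j) = (rectDiag t y)ᴴ.mulVec
      (fun i => A i (Fin.castLE hnt k)) j := by
    intro j k
    have := congrFun (congrFun h2 j) (Fin.castLE hnt k)
    rw [mul_rectDiag_apply hnt, Matrix.conjTranspose_mul, Matrix.conjTranspose_conjTranspose,
      Matrix.conjTranspose_apply] at this
    rw [mul_comm, ← this]
    rfl
  have e3 : ∀ i k : Fin n, y k * star (A k (Fin.castLE hnt i)) = y i * A i (Fin.castLE hnt k) := by
    intro i k
    rw [e2, Matrix.mulVec, dotProduct, Finset.sum_eq_single i]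
    · simp [rectDiag_castLE]
    · intro l _ hl
      simp [rectDiag_castLE, hl]
    · simp
  have hyc : ∀ i, (y i : ℂ) ≠ 0 := fun i => by exact_mod_cast hy.1 i
  refine ⟨fun i => (A i (Fin.castLE hnt i)).re, ?_⟩
  ext i j
  rw [rectDiag_apply]
  by_cases hj : (j : ℕ) < n
  · obtain ⟨k, rfl⟩ : ∃ k : Fin n, j = Fin.castLE hnt k := ⟨⟨j, hj⟩, rfl⟩
    by_cases hik : i = k
    · subst hik
      have h3 := e3 i i
      have h4 := mul_left_cancel₀ (hyc i) h3
      simpa using (Complex.conj_eq_iff_re.1 h4).symm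
    · have h3 := e1 i k
      have h4 := e3 i k
      have h5 : ((y k : ℂ) ^ 2 - (y i : ℂ) ^ 2) * A i (Fin.castLE hnt k) = 0 := by
        linear_combination (y k : ℂ) * h3 + (y i : ℂ) * h4
      have h6 : ((y k : ℂ) ^ 2 - (y i : ℂ) ^ 2) ≠ 0 := by
        rw [sub_ne_zero]
        exact_mod_cast hy.2 k i (Ne.symm hik)
      rw [(mul_eq_zero.1 h5).resolve_left h6, if_neg]
      simpa [Fin.ext_iff] using hik
  · rw [if_neg (by have := i.2; omega)]
    have h3 := e2 j i
    rw [Matrix.mulVec, dotProduct, Finset.sum_eq_zero] at h3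
    · simpa [hyc i] using h3
    · intro l _
      have := l.2
      rw [Matrix.conjTranspose_apply, rectDiag_apply, if_neg (by omega)]
      simp

/-- A matrix with Hermitian products with `Y` is diagonalized by any singular value decomposition
of `Y`, provided the singular values of `Y` are simple and positive. -/
lemma exists_diag_of_hermitian (hnt : n ≤ t) {U : Matrix (Fin n) (Fin n) ℂ}
    (hU : U ∈ Matrix.unitaryGroup (Fin n) ℂ) {V : Matrix (Fin t) (Fin t) ℂ}
    (hV : V ∈ Matrix.unitaryGroup (Fin t) ℂ) {y : Fin n → ℝ} (hy : HasSimpleSquares y)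
    {X : Matrix (Fin n) (Fin t) ℂ}
    (h1 : ((U * rectDiag t y * Vᴴ) * Xᴴ)ᴴ = (U * rectDiag t y * Vᴴ) * Xᴴ)
    (h2 : (Xᴴ * (U * rectDiag t y * Vᴴ))ᴴ = Xᴴ * (U * rectDiag t y * Vᴴ)) :
    ∃ x : Fin n → ℝ, X = U * rectDiag t x * Vᴴ := by
  have e1 : rectDiag t y * (Uᴴ * X * V)ᴴ = Uᴴ * ((U * rectDiag t y * Vᴴ) * Xᴴ) * U := by
    simp only [Matrix.conjTranspose_mul, Matrix.conjTranspose_conjTranspose, Matrix.mul_assoc]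
    rw [← Matrix.mul_assoc Uᴴ U, unitary_conjTranspose_mul hU, Matrix.one_mul]
  have e2 : (Uᴴ * X * V)ᴴ * rectDiag t y = Vᴴ * (Xᴴ * (U * rectDiag t y * Vᴴ)) * V := by
    simp only [Matrix.conjTranspose_mul, Matrix.conjTranspose_conjTranspose, Matrix.mul_assoc]
    rw [unitary_conjTranspose_mul hV, Matrix.mul_one]
  obtain ⟨x, hx⟩ := eq_rectDiag_of_hermitian hnt hy (A := Uᴴ * X * V)
    (by
      rw [e1, Matrix.conjTranspose_mul, Matrix.conjTranspose_mul, h1,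
        Matrix.conjTranspose_conjTranspose, ← Matrix.mul_assoc])
    (by
      rw [e2, Matrix.conjTranspose_mul, Matrix.conjTranspose_mul, h2,
        Matrix.conjTranspose_conjTranspose, ← Matrix.mul_assoc])
  exact ⟨x, by rw [← hx]; exact ((unitaryEquiv hU hV).apply_symm_apply X).symm⟩

end HDDegree

namespace HDDegree

variable {n t : ℕ}

/-! ### Restriction of polynomials to lines -/

/-- Restriction of a polynomial to a line, with its derivative. -/
lemma exists_line_polynomial {ι : Type} [Fintype ι] (p : MvPolynomial ι ℝ) (v w : ι → ℝ) :
    ∃ q : Polynomial ℝ, (∀ s, q.eval s = MvPolynomial.aeval (v + s • w) p) ∧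
      ∀ s, q.derivative.eval s = grad p (v + s • w) ⬝ᵥ w := by
  have hev : ∀ s, (MvPolynomial.aeval (fun i => Polynomial.C (v i) + Polynomial.X *
      Polynomial.C (w i)) p : Polynomial ℝ).eval s = MvPolynomial.aeval (v + s • w) p := by
    intro s
    rw [← Polynomial.coe_aeval_eq_eval, MvPolynomial.comp_aeval_apply]
    congr 2
    ext i
    simp
    ring
  refine ⟨_, hev, fun s => ?_⟩
  have h1 := (MvPolynomial.aeval (fun i => Polynomial.C (v i) + Polynomial.X *
      Polynomial.C (w i)) p : Polynomial ℝ).hasDerivAt s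
  have h2 : HasDerivAt (fun s : ℝ => v + s • w) w s := by
    simpa using ((hasDerivAt_id s).smul_const w).const_add v
  have h3 := (hasStrictFDerivAt_aeval p (v + s • w)).hasFDerivAt.comp_hasDerivAt s h2
  have h4 : (fun s => (MvPolynomial.aeval (fun i => Polynomial.C (v i) + Polynomial.X *
      Polynomial.C (w i)) p : Polynomial ℝ).eval s) =
      (fun z => MvPolynomial.aeval z p) ∘ fun s : ℝ => v + s • w := funext hev
  rw [h4] at h1
  simpa using h1.unique h3

/-- A polynomial that does not vanish at `v + w` does not vanish at the points `v + s w`, with `s`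
small and nonzero. -/
lemma eventually_line_ne_zero {ι : Type} [Fintype ι] {p : MvPolynomial ι ℝ} {v w : ι → ℝ}
    (h : MvPolynomial.aeval (v + w) p ≠ 0) :
    ∀ᶠ s : ℝ in 𝓝[≠] 0, MvPolynomial.aeval (v + s • w) p ≠ 0 := by
  obtain ⟨q, hq, -⟩ := exists_line_polynomial p v w
  have hq0 : q ≠ 0 := by
    rintro rfl
    have := hq 1
    rw [one_smul, Polynomial.eval_zero] at this
    exact h this.symm
  have hfin : (q.roots.toFinset : Set ℝ).Finite := Finset.finite_toSet _
  have h1 : ∀ᶠ s : ℝ in 𝓝[≠] 0, s ∉ (q.roots.toFinset : Set ℝ) \ {0} := by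
    refine nhdsWithin_le_nhds ((hfin.subset Set.sdiff_subset).isClosed.isOpen_compl.mem_nhds ?_)
    simp
  filter_upwards [h1, self_mem_nhdsWithin] with s hs hs0 hz
  refine hs ⟨?_, hs0⟩
  rw [Finset.mem_coe, Multiset.mem_toFinset, Polynomial.mem_roots hq0, Polynomial.IsRoot, hq, hz]

/-- The non-vanishing locus of a nonzero polynomial is dense. -/
lemma dense_aeval_ne_zero {ι : Type} [Fintype ι] {p : MvPolynomial ι ℝ} {v₀ : ι → ℝ}
    (h : MvPolynomial.aeval v₀ p ≠ 0) : Dense {v : ι → ℝ | MvPolynomial.aeval v p ≠ 0} := by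
  intro v
  have h1 := eventually_line_ne_zero (p := p) (v := v) (w := v₀ - v) (by simpa using h)
  have h2 : Filter.Tendsto (fun s : ℝ => v + s • (v₀ - v)) (𝓝[≠] 0) (𝓝 v) := by
    have : ContinuousAt (fun s : ℝ => v + s • (v₀ - v)) 0 := by fun_prop
    simpa [ContinuousAt] using this.mono_left nhdsWithin_le_nhds
  exact mem_closure_of_tendsto h2 h1

/-! ### Matrices with simple singular values -/

/-- A polynomial whose non-vanishing locus consists of the vectors with simple squares. -/
lemma exists_simple_polynomial (n : ℕ) : ∃ D : MvPolynomial (Fin n) ℝ,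
    ∀ z, MvPolynomial.aeval z D ≠ 0 ↔ HasSimpleSquares z := by
  classical
  refine ⟨(∏ i, MvPolynomial.X i) *
    ∏ i, ∏ j, if i = j then 1 else (MvPolynomial.X i ^ 2 - MvPolynomial.X j ^ 2), fun z => ?_⟩
  simp only [map_mul, map_prod, MvPolynomial.aeval_X, mul_ne_zero_iff, Finset.prod_ne_zero_iff,
    Finset.mem_univ, true_imp_iff, HasSimpleSquares]
  refine and_congr Iff.rfl (forall_congr' fun i => forall_congr' fun j => ?_)
  by_cases h : i = j
  · simp [h]
  · simp [h, sub_eq_zero]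

lemma HasSimpleSquares.signedPerm {z : Fin n → ℝ} (hz : HasSimpleSquares z) (ε : Fin n → ℤˣ)
    (π : Equiv.Perm (Fin n)) : HasSimpleSquares (signedPerm ε π z) := by
  have hsq : ∀ i, HDDegree.signedPerm ε π z i ^ 2 = z (π i) ^ 2 := fun i => by
    rcases Int.units_eq_one_or (ε i) with h | h <;> simp [HDDegree.signedPerm, h]
  refine ⟨fun i => ?_, fun i j hij => ?_⟩
  · rw [← pow_ne_zero_iff two_ne_zero, hsq, pow_ne_zero_iff two_ne_zero]
    exact hz.1 _
  · rw [hsq, hsq]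
    exact hz.2 _ _ fun h => hij (π.injective h)

lemma exists_hasSimpleSquares (n : ℕ) : ∃ z : Fin n → ℝ, HasSimpleSquares z := by
  refine ⟨fun i => (i : ℝ) + 1, fun i => by positivity, fun i j hij h => hij ?_⟩
  rw [sq_eq_sq₀ (by positivity) (by positivity)] at h
  exact Fin.ext (by exact_mod_cast add_right_cancel h)

/-- Simplicity of the singular values is the non-vanishing of a polynomial of the matrix. -/
lemma exists_lift_simple (hnt : n ≤ t) :
    ∃ Q : MvPolynomial (RealIdx n t) ℝ, ∀ U ∈ Matrix.unitaryGroup (Fin n) ℂ,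
      ∀ V ∈ Matrix.unitaryGroup (Fin t) ℂ, ∀ z : Fin n → ℝ,
        MvPolynomial.aeval (realCoords n t (U * rectDiag t z * Vᴴ)) Q ≠ 0
          ↔ HasSimpleSquares z := by
  obtain ⟨D, hD⟩ := exists_simple_polynomial n
  obtain ⟨Q, hQ⟩ := exists_lift_prod hnt D
  refine ⟨Q, fun U hU V hV z => ?_⟩
  rw [hQ U hU V hV, Finset.prod_ne_zero_iff]
  simp only [hD, Finset.mem_univ, true_imp_iff]
  refine ⟨fun h => ?_, fun h g => h.signedPerm _ _⟩
  convert h (1, 1)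
  ext i
  simp [signedPerm]

/-! ### Simultaneous singular value decompositions -/

lemma isCompact_unitaryGroup (m : ℕ) :
    IsCompact (Matrix.unitaryGroup (Fin m) ℂ : Set (Matrix (Fin m) (Fin m) ℂ)) := by
  have hcl : IsClosed (Matrix.unitaryGroup (Fin m) ℂ : Set (Matrix (Fin m) (Fin m) ℂ)) := by
    have : (Matrix.unitaryGroup (Fin m) ℂ : Set (Matrix (Fin m) (Fin m) ℂ))
        = {U | U * Uᴴ = 1} := by
      ext U
      exact Matrix.mem_unitaryGroup_iff
    rw [this]
    exact isClosed_eq (by fun_prop) continuous_const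
  have hbox : IsCompact (Set.pi Set.univ fun _ : Fin m => Set.pi Set.univ fun _ : Fin m =>
      Metric.closedBall (0 : ℂ) 1) :=
    isCompact_univ_pi fun _ => isCompact_univ_pi fun _ => isCompact_closedBall 0 1
  refine hbox.of_isClosed_subset hcl fun U hU i _ j _ => ?_
  rw [mem_closedBall_zero_iff]
  exact entry_norm_bound_of_unitary hU i j

instance compactSpace_unitaryGroup (m : ℕ) : CompactSpace (Matrix.unitaryGroup (Fin m) ℂ) :=
  isCompact_iff_compactSpace.1 (isCompact_unitaryGroup m)

lemma isClosed_range_rectDiag (n t : ℕ) :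
    IsClosed {A : Matrix (Fin n) (Fin t) ℂ | ∃ x : Fin n → ℝ, A = rectDiag t x} := by
  have h : {A : Matrix (Fin n) (Fin t) ℂ | ∃ x : Fin n → ℝ, A = rectDiag t x}
      = ((rectDiagL n t).range : Set (Matrix (Fin n) (Fin t) ℂ)) := by
    ext A
    exact ⟨fun ⟨x, hx⟩ => ⟨x, hx.symm⟩, fun ⟨x, hx⟩ => ⟨x, hx.symm⟩⟩
  rw [h]
  exact Submodule.closed_of_finiteDimensional _

/-- The pairs of matrices with a simultaneous singular value decomposition form a closed set, by
compactness of the unitary groups. -/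
lemma isClosed_simultaneous_svd (n t : ℕ) :
    IsClosed {P : Matrix (Fin n) (Fin t) ℂ × Matrix (Fin n) (Fin t) ℂ |
      ∃ U ∈ Matrix.unitaryGroup (Fin n) ℂ, ∃ V ∈ Matrix.unitaryGroup (Fin t) ℂ,
        ∃ x y : Fin n → ℝ, P.1 = U * rectDiag t x * Vᴴ ∧ P.2 = U * rectDiag t y * Vᴴ} := by
  let T := (Matrix.unitaryGroup (Fin n) ℂ × Matrix.unitaryGroup (Fin t) ℂ) ×
    (Matrix (Fin n) (Fin t) ℂ × Matrix (Fin n) (Fin t) ℂ)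
  let f : T → Matrix (Fin n) (Fin t) ℂ := fun q => (q.1.1 : Matrix (Fin n) (Fin n) ℂ)ᴴ * q.2.1 *
    (q.1.2 : Matrix (Fin t) (Fin t) ℂ)
  let g : T → Matrix (Fin n) (Fin t) ℂ := fun q => (q.1.1 : Matrix (Fin n) (Fin n) ℂ)ᴴ * q.2.2 *
    (q.1.2 : Matrix (Fin t) (Fin t) ℂ)
  have hf : Continuous f := by fun_prop
  have hg : Continuous g := by fun_prop
  have hcl := ((isClosed_range_rectDiag n t).preimage hf).inter
    ((isClosed_range_rectDiag n t).preimage hg)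
  have himg := isClosedMap_snd_of_compactSpace _ hcl
  convert himg using 1
  ext ⟨A, B⟩
  constructor
  · rintro ⟨U, hU, V, hV, x, y, h1, h2⟩
    refine ⟨((⟨U, hU⟩, ⟨V, hV⟩), (A, B)), ⟨⟨x, ?_⟩, ⟨y, ?_⟩⟩, rfl⟩
    · have := (unitaryEquiv hU hV).symm_apply_apply (rectDiag t x)
      rw [unitaryEquiv_apply, ← h1] at this
      exact this
    · have := (unitaryEquiv hU hV).symm_apply_apply (rectDiag t y)
      rw [unitaryEquiv_apply, ← h2] at this
      exact this
  · rintro ⟨⟨⟨⟨U, hU⟩, ⟨V, hV⟩⟩, P⟩, ⟨⟨x, hx⟩, ⟨y, hy⟩⟩, rfl⟩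
    refine ⟨U, hU, V, hV, x, y, ?_, ?_⟩
    · rw [← hx]
      exact ((unitaryEquiv hU hV).apply_symm_apply _).symm
    · rw [← hy]
      exact ((unitaryEquiv hU hV).apply_symm_apply _).symm

/-- A matrix `B` with Hermitian products with `diag(x)` has a singular value decomposition in common
with it.  For generic small `s` the matrix `diag(x) + (1 - s) B + s diag(b)` has simple
singular values and its decomposition also diagonalizes `diag(x)`; then `s` tends to `0`. -/
theorem exists_simultaneous_svd (hnt : n ≤ t) (x : Fin n → ℝ) {B : Matrix (Fin n) (Fin t) ℂ}
    (h1 : (B * (rectDiag t x)ᴴ)ᴴ = B * (rectDiag t x)ᴴ)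
    (h2 : ((rectDiag t x)ᴴ * B)ᴴ = (rectDiag t x)ᴴ * B) :
    ∃ U ∈ Matrix.unitaryGroup (Fin n) ℂ, ∃ V ∈ Matrix.unitaryGroup (Fin t) ℂ,
      ∃ x' b : Fin n → ℝ, rectDiag t x = U * rectDiag t x' * Vᴴ ∧ B = U * rectDiag t b * Vᴴ := by
  obtain ⟨z, hz⟩ := exists_hasSimpleSquares n
  obtain ⟨Q, hQ⟩ := exists_lift_simple (t := t) hnt
  set X := rectDiag t x with hX
  set C := rectDiag t (z - x) with hC
  have hXC : X + C = rectDiag t z := by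
    rw [hX, hC, ← rectDiagL_apply, ← rectDiagL_apply, ← map_add, add_sub_cancel, rectDiagL_apply]
  have hev := eventually_line_ne_zero (p := Q) (v := realCoords n t (X + B))
    (w := realCoords n t (C - B)) (by
      rw [← map_add, show X + B + (C - B) =
          (1 : Matrix (Fin n) (Fin n) ℂ) * rectDiag t z * (1 : Matrix (Fin t) (Fin t) ℂ)ᴴ by
        rw [Matrix.conjTranspose_one, Matrix.mul_one, Matrix.one_mul, ← hXC]
        abel]
      exact (hQ 1 (one_mem _) 1 (one_mem _) z).2 hz)
  have htend : Filter.Tendsto (fun s : ℝ => (X, B + s • (C - B))) (𝓝[≠] 0) (𝓝 (X, B)) := by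
    have : ContinuousAt (fun s : ℝ => (X, B + s • (C - B))) 0 := by fun_prop
    simpa [ContinuousAt] using this.mono_left nhdsWithin_le_nhds
  have hXX1 : (X * Xᴴ)ᴴ = X * Xᴴ := by
    rw [Matrix.conjTranspose_mul, Matrix.conjTranspose_conjTranspose]
  have hXX2 : (Xᴴ * X)ᴴ = Xᴴ * X := by
    rw [Matrix.conjTranspose_mul, Matrix.conjTranspose_conjTranspose]
  have hC1 : (C * Xᴴ)ᴴ = C * Xᴴ := by
    rw [hC, hX, rectDiag_mul_conjTranspose hnt, Matrix.diagonal_conjTranspose]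
    congr 1
    ext i
    simp
  have hC2 : (Xᴴ * C)ᴴ = Xᴴ * C := by
    rw [hC, hX, rectDiag_conjTranspose_mul, Matrix.diagonal_conjTranspose]
    congr 1
    ext i
    simp only [Pi.star_apply]
    split_ifs <;> simp
  refine (isClosed_simultaneous_svd n t).mem_of_tendsto htend ?_
  filter_upwards [hev] with s hs
  obtain ⟨U, hU, V, hV, y, hy⟩ := exists_svd hnt (X + (B + s • (C - B)))
  have hs' : realCoords n t (X + B) + s • realCoords n t (C - B)
      = realCoords n t (U * rectDiag t y * Vᴴ) := by
    rw [← hy, ← map_smul, ← map_add, add_assoc]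
  rw [hs', hQ U hU V hV] at hs
  obtain ⟨x', hx'⟩ := exists_diag_of_hermitian hnt hU hV hs (X := X)
    (by
      rw [← hy]
      simp only [Matrix.add_mul, Matrix.sub_mul, Matrix.smul_mul, Matrix.conjTranspose_add,
        Matrix.conjTranspose_sub, Matrix.conjTranspose_smul, star_trivial, h1, hXX1, hC1])
    (by
      rw [← hy]
      simp only [Matrix.mul_add, Matrix.mul_sub, Matrix.mul_smul, Matrix.conjTranspose_add,
        Matrix.conjTranspose_sub, Matrix.conjTranspose_smul, star_trivial, h2, hXX2, hC2])
  refine ⟨U, hU, V, hV, x', y - x', hx', ?_⟩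
  rw [← rectDiagL_apply, map_sub, rectDiagL_apply, rectDiagL_apply, Matrix.mul_sub, Matrix.sub_mul,
    ← hy, ← hx']
  abel

end HDDegree

namespace HDDegree

variable {n t : ℕ}

/-! ### Uniqueness of singular values -/

lemma exists_perm_of_map_eq {α : Type*} [DecidableEq α] {f g : Fin n → α}
    (h : Finset.univ.val.map f = Finset.univ.val.map g) :
    ∃ π : Equiv.Perm (Fin n), ∀ i, g (π i) = f i := by
  have hcard : ∀ a, Nonempty ({i // f i = a} ≃ {i // g i = a}) := fun a => by
    rw [← Fintype.card_eq, Fintype.card_subtype, Fintype.card_subtype]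
    have h1 := congrArg (Multiset.count a) h
    simp only [Multiset.count_map, eq_comm (a := a)] at h1
    exact h1
  exact ⟨Equiv.ofFiberEquiv fun a => (hcard a).some, fun i => Equiv.ofFiberEquiv_map _ i⟩

/-- Real singular values are unique up to signed permutations. -/
lemma exists_signedPerm_of_svd_eq (hnt : n ≤ t) {U U' : Matrix (Fin n) (Fin n) ℂ}
    (hU : U ∈ Matrix.unitaryGroup (Fin n) ℂ) (hU' : U' ∈ Matrix.unitaryGroup (Fin n) ℂ)
    {V V' : Matrix (Fin t) (Fin t) ℂ} (hV : V ∈ Matrix.unitaryGroup (Fin t) ℂ)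
    (hV' : V' ∈ Matrix.unitaryGroup (Fin t) ℂ) {x x' : Fin n → ℝ}
    (h : U * rectDiag t x * Vᴴ = U' * rectDiag t x' * V'ᴴ) :
    ∃ ε π, x' = signedPerm ε π x := by
  have h1 := charpoly_svd hnt hU hV x
  rw [h, charpoly_svd hnt hU' hV' x'] at h1
  have h2 := Polynomial.map_injective _ (algebraMap ℝ ℂ).injective h1
  have h3 := congrArg Polynomial.roots h2
  rw [Polynomial.roots_multiset_prod_X_sub_C, Polynomial.roots_multiset_prod_X_sub_C] at h3
  obtain ⟨π, hπ⟩ := exists_perm_of_map_eq h3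
  refine ⟨fun i => if x' i = x (π i) then 1 else -1, π, funext fun i => ?_⟩
  simp only [signedPerm]
  split_ifs with hi
  · simp [hi]
  · have := (sq_eq_sq_iff_eq_or_eq_neg.1 (hπ i).symm).resolve_left hi
    simp [this]

/-- A vector `a` is compatible with `x` if it satisfies all linear relations `a i = ± a j` with
`x i = ± x j`; equivalently, `a` is fixed by every signed permutation that fixes `x`. -/
def IsCompatible (x a : Fin n → ℝ) : Prop :=
  ∀ i j, (x i = x j → a i = a j) ∧ (x i = -x j → a i = -a j)

/-- A singular value decomposition of `diag(x)` also decomposes `diag(a)` when `a` is compatible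
with `x`. -/
lemma rectDiag_eq_of_isCompatible (hnt : n ≤ t) {U : Matrix (Fin n) (Fin n) ℂ}
    (hU : U ∈ Matrix.unitaryGroup (Fin n) ℂ) {V : Matrix (Fin t) (Fin t) ℂ}
    (hV : V ∈ Matrix.unitaryGroup (Fin t) ℂ) {x a : Fin n → ℝ} (ha : IsCompatible x a)
    {ε : Fin n → ℤˣ} {π : Equiv.Perm (Fin n)}
    (h : rectDiag t x = U * rectDiag t (signedPerm ε π x) * Vᴴ) :
    rectDiag t a = U * rectDiag t (signedPerm ε π a) * Vᴴ := by
  set x' := signedPerm ε π x with hx'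
  set a' := signedPerm ε π a with ha'
  have hrel : ∀ i j, (x i = x' j → a i = a' j) ∧ (x i = -x' j → a i = -a' j) := fun i j => by
    rcases Int.units_eq_one_or (ε j) with hε | hε
    · simpa [hx', ha', signedPerm, hε] using ha i (π j)
    · simpa [hx', ha', signedPerm, hε] using (ha i (π j)).symm
  have e1 : rectDiag t x * V = U * rectDiag t x' := by
    rw [h, Matrix.mul_assoc, unitary_conjTranspose_mul hV, Matrix.mul_one]
  have e2 : Uᴴ * rectDiag t x = rectDiag t x' * Vᴴ := by
    rw [h, ← Matrix.mul_assoc, ← Matrix.mul_assoc, unitary_conjTranspose_mul hU, Matrix.one_mul]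
  have f1 : ∀ i j : Fin n, (x i : ℂ) * V (Fin.castLE hnt i) (Fin.castLE hnt j) = U i j * x' j := by
    intro i j
    have := congrFun (congrFun e1 i) (Fin.castLE hnt j)
    rwa [rectDiag_mul_apply hnt, mul_rectDiag_apply hnt] at this
  have f2 : ∀ i j : Fin n, U i j * x i = x' j * V (Fin.castLE hnt i) (Fin.castLE hnt j) := by
    intro i j
    have := congrArg star (congrFun (congrFun e2 j) (Fin.castLE hnt i))
    rw [rectDiag_mul_apply hnt, mul_rectDiag_apply hnt, Matrix.conjTranspose_apply,
      Matrix.conjTranspose_apply, star_mul', star_star, star_mul', star_star] at this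
    simpa using this
  have f3 : ∀ (i : Fin n) (j : Fin t), n ≤ j → (x i : ℂ) * V (Fin.castLE hnt i) j = 0 := by
    intro i j hj
    have := congrFun (congrFun e1 i) j
    rwa [rectDiag_mul_apply hnt, mul_rectDiag_apply_of_le _ _ _ _ hj] at this
  have key : rectDiag t a * V = U * rectDiag t a' := by
    ext i j
    rw [rectDiag_mul_apply hnt]
    by_cases hj : (j : ℕ) < n
    · obtain ⟨k, rfl⟩ : ∃ k : Fin n, j = Fin.castLE hnt k := ⟨⟨j, hj⟩, rfl⟩
      rw [mul_rectDiag_apply hnt]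
      have g1 := f1 i k
      have g2 := f2 i k
      set u := U i k
      set v := V (Fin.castLE hnt i) (Fin.castLE hnt k)
      by_cases hp : x i = x' k
      · rw [(hrel i k).1 hp]
        by_cases hx0 : x' k = 0
        · have : a i = -a' k := (hrel i k).2 (by rw [hp, hx0, neg_zero])
          have h0 : a' k = 0 := by linarith [(hrel i k).1 hp]
          simp [h0]
        · have hc : (x' k : ℂ) ≠ 0 := by exact_mod_cast hx0
          rw [hp, mul_comm] at g1
          rw [mul_right_cancel₀ hc g1, mul_comm]
      · by_cases hm : x i = -x' k
        · rw [(hrel i k).2 hm]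
          have hc : (x' k : ℂ) ≠ 0 := by
            intro h0
            have h0' : x' k = 0 := by exact_mod_cast h0
            exact hp (by rw [hm, h0', neg_zero])
          rw [hm] at g1
          push_cast at g1 ⊢
          have : u = -v := mul_right_cancel₀ hc (by linear_combination -g1)
          rw [this]
          ring
        · have hc : ((x i : ℂ) ^ 2 - (x' k : ℂ) ^ 2) ≠ 0 := by
            rw [sub_ne_zero]
            intro hsq
            rcases sq_eq_sq_iff_eq_or_eq_neg.1 (by exact_mod_cast hsq : x i ^ 2 = x' k ^ 2)
              with h' | h'
            · exact hp h'
            · exact hm h'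
          have hv : v = 0 := (mul_eq_zero.1 (by
            linear_combination (x i : ℂ) * g1 + (x' k : ℂ) * g2 :
            ((x i : ℂ) ^ 2 - (x' k : ℂ) ^ 2) * v = 0)).resolve_left hc
          have hu : u = 0 := (mul_eq_zero.1 (by
            linear_combination (x' k : ℂ) * g1 + (x i : ℂ) * g2 :
            ((x i : ℂ) ^ 2 - (x' k : ℂ) ^ 2) * u = 0)).resolve_left hc
          rw [hu, hv, mul_zero, zero_mul]
    · rw [mul_rectDiag_apply_of_le _ _ _ _ (by omega)]
      rcases mul_eq_zero.1 (f3 i j (by omega)) with h0 | h0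
      · have h0' : x i = 0 := by exact_mod_cast h0
        have : a i = -a i := (ha i i).2 (by rw [h0', neg_zero])
        have h1 : a i = 0 := by linarith
        simp [h1]
      · rw [h0, mul_zero]
  rw [← key, Matrix.mul_assoc, unitary_mul_conjTranspose hV, Matrix.mul_one]

end HDDegree

namespace HDDegree

variable {n t : ℕ}

/-! ### The tangent space of `σ⁻¹(S)` at a diagonal matrix -/

lemma trace_rectDiag (hnt : n ≤ t) (x y : Fin n → ℝ) :
    (Matrix.trace (rectDiag t x * (rectDiag t y)ᴴ)).re = x ⬝ᵥ y := by
  rw [rectDiag_mul_conjTranspose hnt, Matrix.trace_diagonal, Complex.re_sum]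
  rfl

lemma signedPerm_dotProduct (ε : Fin n → ℤˣ) (π : Equiv.Perm (Fin n)) (x y : Fin n → ℝ) :
    signedPerm ε π x ⬝ᵥ signedPerm ε π y = x ⬝ᵥ y := by
  have h : ∀ i, signedPerm ε π x i * signedPerm ε π y i = x (π i) * y (π i) := fun i => by
    rcases Int.units_eq_one_or (ε i) with h | h <;> simp [signedPerm, h]
  simp only [dotProduct, h]
  exact Equiv.sum_comp π fun i => x i * y i

lemma signedPerm_add_smul (ε : Fin n → ℤˣ) (π : Equiv.Perm (Fin n)) (s : ℝ) (x y : Fin n → ℝ) :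
    signedPerm ε π (x + s • y) = signedPerm ε π x + s • signedPerm ε π y := by
  ext i
  simp only [signedPerm, Pi.add_apply, Pi.smul_apply, smul_eq_mul]
  ring

lemma exists_signedPerm_inv (ε : Fin n → ℤˣ) (π : Equiv.Perm (Fin n)) :
    ∃ (ε' : Fin n → ℤˣ) (π' : Equiv.Perm (Fin n)),
      (∀ z : Fin n → ℝ, signedPerm ε' π' (signedPerm ε π z) = z) ∧
      ∀ z : Fin n → ℝ, signedPerm ε π (signedPerm ε' π' z) = z := by
  refine ⟨fun i => ε (π.symm i), π.symm, fun z => ?_, fun z => ?_⟩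
  · ext i
    rcases Int.units_eq_one_or (ε (π.symm i)) with h | h <;> simp [signedPerm, h]
  · ext i
    rcases Int.units_eq_one_or (ε i) with h | h <;> simp [signedPerm, h]

/-- The directional derivative of a nonnegative polynomial vanishing on `S` vanishes on `S`, so
tangent vectors to `S` are isotropic for its Hessian. -/
lemma line_second_derivative_eq_zero {ι : Type} [Fintype ι] {S : Set (ι → ℝ)}
    {Q : MvPolynomial ι ℝ} (hQ : Q ∈ MvPolynomial.vanishingIdeal ℝ S)
    (hQ0 : ∀ z : ι → ℝ, 0 ≤ MvPolynomial.aeval z Q) {x b : ι → ℝ} (hb : b ∈ tangentSpace S x)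
    {q : Polynomial ℝ} (hq : ∀ s, q.eval s = MvPolynomial.aeval (x + s • b) Q) :
    q.derivative.derivative.eval 0 = 0 := by
  set f : MvPolynomial ι ℝ := ∑ i, MvPolynomial.C (b i) * MvPolynomial.pderiv i Q with hf
  have hfev : ∀ z, MvPolynomial.aeval z f = grad Q z ⬝ᵥ b := fun z => by
    rw [hf, map_sum, dotProduct]
    refine Finset.sum_congr rfl fun i _ => ?_
    rw [map_mul, MvPolynomial.algHom_C, Algebra.algebraMap_self, RingHom.id_apply, mul_comm]
    rfl
  have hfS : f ∈ MvPolynomial.vanishingIdeal ℝ S := by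
    rw [mem_vanishingIdeal]
    intro z hz
    have hmin : IsLocalMin (fun w => MvPolynomial.aeval w Q) z := by
      refine Filter.Eventually.of_forall fun w => ?_
      beta_reduce
      rw [mem_vanishingIdeal.1 hQ z hz]
      exact hQ0 w
    have h0 := hmin.hasFDerivAt_eq_zero (hasStrictFDerivAt_aeval Q z).hasFDerivAt
    rw [hfev, ← gradCLM_apply, h0]
    rfl
  obtain ⟨q', hq', hq''⟩ := exists_line_polynomial Q x b
  obtain ⟨r, hr, hr'⟩ := exists_line_polynomial f x b
  have e1 : q = q' := Polynomial.funext fun s => by rw [hq, hq']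
  have e2 : q'.derivative = r := Polynomial.funext fun s => by rw [hq'', hr, hfev]
  rw [e1, e2, hr', zero_smul, add_zero]
  exact hb f hfS

/-- A tangent vector to `σ⁻¹(S)` at `diag(x)` that is orthogonal to the unitary orbit and to the
diagonal matrices tangent to `S` vanishes: by a simultaneous singular value decomposition it
is a translate of `diag(b)` with `b ⊥ T_x S`, hence `b` is the gradient of some `p ∈ I(S)`, and the
second derivative of the lift of `∑ (p ∘ g)²` along it is at least `2 |b|⁴`. -/
lemma eq_zero_of_mem_matTangentSpace (hnt : n ≤ t) {S : Set (Fin n → ℝ)} (hS : IsRealAlgebraic S)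
    (hsym : IsAbsolutelySymmetric S) {x : Fin n → ℝ} (hx : x ∈ S)
    (hcomp : ∀ a ∈ tangentSpace S x, IsCompatible x a) {B : Matrix (Fin n) (Fin t) ℂ}
    (hB : B ∈ matTangentSpace (sigmaInv t S) (rectDiag t x))
    (horb : ∀ (Z : Matrix (Fin n) (Fin n) ℂ) (W : Matrix (Fin t) (Fin t) ℂ),
      (Matrix.trace (B * ((Z - Zᴴ) * rectDiag t x + rectDiag t x * (W - Wᴴ))ᴴ)).re = 0)
    (hdiag : ∀ a ∈ tangentSpace S x, (Matrix.trace (B * (rectDiag t a)ᴴ)).re = 0) : B = 0 := by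
  obtain ⟨h1, h2⟩ := hermitian_of_orth_orbit horb
  obtain ⟨U, hU, V, hV, x', b', hXe, hBe⟩ := exists_simultaneous_svd hnt x h1 h2
  obtain ⟨ε, π, rfl⟩ := exists_signedPerm_of_svd_eq hnt (one_mem _) hU (one_mem _) hV
    (x := x) (x' := x') (by
      rw [← hXe, Matrix.one_mul, Matrix.conjTranspose_one, Matrix.mul_one])
  obtain ⟨ε', π', hl, hr⟩ := exists_signedPerm_inv ε π
  obtain ⟨b, rfl⟩ : ∃ b, b' = signedPerm ε π b := ⟨_, (hr b').symm⟩
  have hbT : ∀ a ∈ tangentSpace S x, b ⬝ᵥ a = 0 := fun a ha => by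
    have := hdiag a ha
    rwa [rectDiag_eq_of_isCompatible hnt hU hV (hcomp a ha) hXe, hBe, trace_unitaryEquiv hU hV,
      trace_rectDiag hnt, signedPerm_dotProduct] at this
  obtain ⟨m, f, hfI, -, hfT⟩ := exists_generators hS
  obtain ⟨c, hc⟩ := exists_coeff_of_orth (fun j => grad (f j) x) (w := b)
    fun a ha => hbT a ((hfT x hx a).2 ha)
  set p : MvPolynomial (Fin n) ℝ := ∑ j, MvPolynomial.C (c j) * f j with hp
  have hpI : p ∈ MvPolynomial.vanishingIdeal ℝ S :=
    sum_mem fun j _ => Ideal.mul_mem_left _ _ (hfI j)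
  have hpg : ∀ v, grad p x ⬝ᵥ v = b ⬝ᵥ v := fun v => by
    have h : grad p x = b := by
      rw [hc]
      ext i
      simp [hp, grad, Finset.sum_apply]
    rw [h]
  obtain ⟨Q, hQ⟩ := exists_lift_sum_sq (t := t) hnt p
  have hQS : Q ∈ MvPolynomial.vanishingIdeal ℝ (realCoords n t '' sigmaInv t S) := by
    rw [mem_vanishingIdeal]
    rintro _ ⟨_, ⟨z, hz, U', hU', V', hV', rfl⟩, rfl⟩
    rw [hQ U' hU' V' hV']
    refine Finset.sum_eq_zero fun g _ => ?_
    rw [mem_vanishingIdeal.1 hpI _ (hsym.signedPerm_mem _ _ hz), zero_pow two_ne_zero]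
  have hQ0 : ∀ v : RealIdx n t → ℝ, 0 ≤ MvPolynomial.aeval v Q := fun v => by
    obtain ⟨A, rfl⟩ := (realCoords n t).surjective v
    obtain ⟨U', hU', V', hV', z, rfl⟩ := exists_svd hnt A
    rw [hQ U' hU' V' hV']
    exact Finset.sum_nonneg fun g _ => sq_nonneg _
  choose q hq hq' using fun g : (Fin n → ℤˣ) × Equiv.Perm (Fin n) =>
    exists_line_polynomial p (signedPerm g.1 g.2 (signedPerm ε π x))
      (signedPerm g.1 g.2 (signedPerm ε π b))
  have hline : ∀ s, (∑ g, q g ^ 2).eval s =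
      MvPolynomial.aeval (realCoords n t (rectDiag t x) + s • realCoords n t B) Q := fun s => by
    have h : rectDiag t x + s • B = U * rectDiag t (signedPerm ε π (x + s • b)) * Vᴴ := by
      rw [signedPerm_add_smul, ← rectDiagL_apply (signedPerm ε π x + _), map_add, map_smul,
        rectDiagL_apply, rectDiagL_apply, Matrix.mul_add, Matrix.add_mul, Matrix.mul_smul,
        Matrix.smul_mul, ← hXe, ← hBe]
    rw [← map_smul, ← map_add, h, hQ U hU V hV, Polynomial.eval_finsetSum]
    refine Finset.sum_congr rfl fun g _ => ?_
    rw [Polynomial.eval_pow, hq, signedPerm_add_smul, signedPerm_add_smul]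
  have hzero := line_second_derivative_eq_zero hQS hQ0 hB hline
  have hq0 : ∀ g, (q g).eval 0 = 0 := fun g => by
    rw [hq, zero_smul, add_zero]
    exact mem_vanishingIdeal.1 hpI _
      (hsym.signedPerm_mem _ _ (hsym.signedPerm_mem _ _ hx))
  have hsum : ∑ g, (q g).derivative.eval 0 ^ 2 = 0 := by
    have : (∑ g, q g ^ 2).derivative.derivative.eval 0 = 2 * ∑ g, (q g).derivative.eval 0 ^ 2 := by
      simp only [Polynomial.derivative_sum, Polynomial.eval_finsetSum, Finset.mul_sum]
      refine Finset.sum_congr rfl fun g _ => ?_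
      simp only [pow_two, Polynomial.derivative_mul, Polynomial.derivative_add,
        Polynomial.eval_add, Polynomial.eval_mul, hq0]
      ring
    linarith
  have hg := (Finset.sum_eq_zero_iff_of_nonneg fun g _ => sq_nonneg _).1 hsum (ε', π')
    (Finset.mem_univ _)
  rw [hq', zero_smul, add_zero] at hg
  simp only [hl, hpg] at hg
  have hb0 : b = 0 := dotProduct_self_eq_zero_real ((pow_eq_zero_iff two_ne_zero).1 hg)
  have hsp : signedPerm ε π (0 : Fin n → ℝ) = 0 := by
    ext i
    simp [signedPerm]
  rw [hBe, hb0, hsp, ← rectDiagL_apply, map_zero, Matrix.mul_zero, Matrix.zero_mul]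

end HDDegree

namespace HDDegree

variable {n t : ℕ}

/-! ### From regular points of `S` to regular points of `σ⁻¹(S)` -/

lemma rectDiag_mem_sigmaInv {S : Set (Fin n → ℝ)} {x : Fin n → ℝ} (hx : x ∈ S) :
    rectDiag t x ∈ sigmaInv t S :=
  ⟨x, hx, 1, one_mem _, 1, one_mem _, by
    rw [Matrix.one_mul, Matrix.conjTranspose_one, Matrix.mul_one]⟩

lemma rectDiag_mem_matTangentSpace {S : Set (Fin n → ℝ)} {x a : Fin n → ℝ}
    (ha : a ∈ tangentSpace S x) : rectDiag t a ∈ matTangentSpace (sigmaInv t S) (rectDiag t x) :=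
  map_mem_tangentSpace (S' := realCoords n t '' sigmaInv t S)
    ((realCoords n t).toLinearMap ∘ₗ rectDiagL n t)
    (fun _ hz => ⟨_, rectDiag_mem_sigmaInv hz, rfl⟩) ha

section Orbit

attribute [local instance] Matrix.linftyOpNormedAddCommGroup Matrix.linftyOpNormedSpace
  Matrix.linftyOpNormedRing Matrix.linftyOpNormedAlgebra

/-- The tangent space of `σ⁻¹(S)` at `diag(x)` is spanned by the unitary orbit directions and
`diag(T_x S)`, provided the tangent vectors of `S` are compatible with `x`. -/
theorem exists_of_mem_matTangentSpace (hnt : n ≤ t) {S : Set (Fin n → ℝ)} (hS : IsRealAlgebraic S)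
    (hsym : IsAbsolutelySymmetric S) {x : Fin n → ℝ} (hx : x ∈ S)
    (hcomp : ∀ a ∈ tangentSpace S x, IsCompatible x a) {A : Matrix (Fin n) (Fin t) ℂ}
    (hA : A ∈ matTangentSpace (sigmaInv t S) (rectDiag t x)) :
    ∃ a ∈ tangentSpace S x, ∃ (Z : Matrix (Fin n) (Fin n) ℂ) (W : Matrix (Fin t) (Fin t) ℂ),
      A = rectDiag t a + (Z - Zᴴ) * rectDiag t x + rectDiag t x * (W - Wᴴ) := by
  have hG : HasStrictFDerivAt
      (fun u : tangentSpace S x => rectDiag t x +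
        LinearMap.toContinuousLinearMap (rectDiagL n t ∘ₗ (tangentSpace S x).subtype) u)
      (LinearMap.toContinuousLinearMap (rectDiagL n t ∘ₗ (tangentSpace S x).subtype)) 0 :=
    (ContinuousLinearMap.hasStrictFDerivAt _).const_add _
  obtain ⟨Ψ', -, hΨ⟩ := exists_orbit_deriv hG
  obtain ⟨r, ⟨⟨b, Z, W⟩, rfl⟩, w, hw, hsum⟩ := exists_add_orth (LinearMap.range Ψ'.toLinearMap)
    (realCoords n t A)
  obtain ⟨B, rfl⟩ := (realCoords n t).surjective w
  have hval : ∀ (b : tangentSpace S x) (Z : Matrix (Fin n) (Fin n) ℂ)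
      (W : Matrix (Fin t) (Fin t) ℂ), Ψ' (b, (Z, W)) = realCoords n t
        (rectDiag t b + (Z - Zᴴ) * rectDiag t x + rectDiag t x * (W - Wᴴ)) := fun b Z W => by
    rw [hΨ, map_zero, add_zero]
    rfl
  have hAB : A = rectDiag t b + (Z - Zᴴ) * rectDiag t x + rectDiag t x * (W - Wᴴ) + B := by
    apply (realCoords n t).injective
    rw [hsum, map_add _ _ B]
    exact congrArg (· + realCoords n t B) (hval b Z W)
  have hBT : B ∈ matTangentSpace (sigmaInv t S) (rectDiag t x) := by
    have : B = A - (rectDiag t b + ((Z - Zᴴ) * rectDiag t x + rectDiag t x * (W - Wᴴ))) := by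
      rw [hAB]
      abel
    rw [this]
    exact sub_mem hA (add_mem (rectDiag_mem_matTangentSpace b.2)
      (orbit_mem_matTangentSpace (rectDiag_mem_sigmaInv hx) Z W))
  have horth : ∀ (b : tangentSpace S x) (Z : Matrix (Fin n) (Fin n) ℂ)
      (W : Matrix (Fin t) (Fin t) ℂ), (Matrix.trace (B * (rectDiag t b +
        (Z - Zᴴ) * rectDiag t x + rectDiag t x * (W - Wᴴ))ᴴ)).re = 0 := fun b Z W => by
    rw [← realCoords_dotProduct, ← hval]
    exact hw _ ⟨_, rfl⟩
  have hB0 : B = 0 := by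
    refine eq_zero_of_mem_matTangentSpace hnt hS hsym hx hcomp hBT (fun Z W => ?_) fun a ha => ?_
    · have := horth 0 Z W
      rwa [ZeroMemClass.coe_zero, ← rectDiagL_apply, map_zero, zero_add] at this
    · have := horth ⟨a, ha⟩ 0 0
      simpa using this
  exact ⟨b, b.2, Z, W, by rw [hAB, hB0, add_zero]⟩

/-- Diagonal matrices over regular points of `S` are regular points of `σ⁻¹(S)`, provided the
tangent vectors of `S` are compatible with the point. -/
theorem rectDiag_mem_matRegularLocus (hnt : n ≤ t) {S : Set (Fin n → ℝ)} (hS : IsRealAlgebraic S)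
    (hsym : IsAbsolutelySymmetric S) {x : Fin n → ℝ} (hx : x ∈ regularLocus S)
    (hcomp : ∀ a ∈ tangentSpace S x, IsCompatible x a) :
    rectDiag t x ∈ matRegularLocus (sigmaInv t S) := by
  obtain ⟨K, φ, φ', rfl, hφ, hφS, hφT⟩ := exists_param_of_mem_regularLocus hx
  have hG : HasStrictFDerivAt
      (fun u : K => LinearMap.toContinuousLinearMap (rectDiagL n t) (φ u)) _ 0 :=
    (LinearMap.toContinuousLinearMap (rectDiagL n t)).hasStrictFDerivAt.comp 0 hφ
  obtain ⟨Ψ', hΨd, hΨ⟩ := exists_orbit_deriv hG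
  have h0 : realCoords n t (NormedSpace.exp ((0 : Matrix (Fin n) (Fin n) ℂ) - 0ᴴ) *
      rectDiag t (φ 0) * NormedSpace.exp ((0 : Matrix (Fin t) (Fin t) ℂ) - 0ᴴ))
      = realCoords n t (rectDiag t (φ 0)) := by
    rw [Matrix.conjTranspose_zero, Matrix.conjTranspose_zero, sub_self, sub_self,
      NormedSpace.exp_zero, NormedSpace.exp_zero, Matrix.one_mul, Matrix.mul_one]
  change realCoords n t (rectDiag t (φ 0)) ∈ regularLocus (realCoords n t '' sigmaInv t S)
  rw [← h0]
  refine mem_regularLocus_of_param (S := realCoords n t '' sigmaInv t S) hΨd ?_ ?_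
  · have h1 : Filter.Tendsto (Prod.fst : K × (Matrix (Fin n) (Fin n) ℂ × Matrix (Fin t) (Fin t) ℂ)
        → K) (𝓝 0) (𝓝 0) := continuous_fst.tendsto 0
    filter_upwards [h1.eventually hφS] with q hq
    have h2 := unitaryEquiv_mem_sigmaInv (exp_skew_mem_unitaryGroup q.2.1)
      (unitary_conjTranspose_mem (exp_skew_mem_unitaryGroup q.2.2))
      (rectDiag_mem_sigmaInv (t := t) hq)
    rw [Matrix.conjTranspose_conjTranspose] at h2
    exact ⟨_, h2, rfl⟩
  · intro a ha
    obtain ⟨A, rfl⟩ := (realCoords n t).surjective a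
    have hA : realCoords n t A ∈ tangentSpace (realCoords n t '' sigmaInv t S)
      (realCoords n t (NormedSpace.exp ((0 : Matrix (Fin n) (Fin n) ℂ) - 0ᴴ) *
        rectDiag t (φ 0) * NormedSpace.exp ((0 : Matrix (Fin t) (Fin t) ℂ) - 0ᴴ))) := ha
    rw [h0] at hA
    obtain ⟨a, ha, Z, W, hAe⟩ := exists_of_mem_matTangentSpace hnt hS hsym hx.1 hcomp hA
    obtain ⟨b, rfl⟩ := hφT a ha
    exact ⟨(b, (Z, W)), (hΨ b Z W).trans (congrArg (realCoords n t) hAe.symm)⟩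

end Orbit

/-- ED critical points give HD critical points. -/
theorem rectDiag_mem_hdCritical (hnt : n ≤ t) {S : Set (Fin n → ℝ)} (hS : IsRealAlgebraic S)
    (hsym : IsAbsolutelySymmetric S) {x y : Fin n → ℝ} (hx : x ∈ edCritical S y)
    (hcomp : ∀ a ∈ tangentSpace S x, IsCompatible x a) :
    rectDiag t x ∈ hdCritical (sigmaInv t S) (rectDiag t y) := by
  refine ⟨rectDiag_mem_matRegularLocus hnt hS hsym hx.1 hcomp, fun A hA => ?_⟩
  obtain ⟨a, ha, Z, W, rfl⟩ := exists_of_mem_matTangentSpace hnt hS hsym hx.1.1 hcomp hA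
  have hyx : rectDiag t y - rectDiag t x = rectDiag t (y - x) := by
    rw [← rectDiagL_apply, ← rectDiagL_apply, ← map_sub, rectDiagL_apply]
  -- the trace of the product of a Hermitian and a skew-Hermitian matrix is imaginary
  have hskew : ∀ {m : ℕ} (H Z : Matrix (Fin m) (Fin m) ℂ), Hᴴ = H →
      (Matrix.trace (H * (Z - Zᴴ)ᴴ)).re = 0 := fun H Z hH => by
    have h1 : (Matrix.trace (H * Zᴴ)).re = (Matrix.trace (H * Z)).re := by
      have : H * Zᴴ = (Z * H)ᴴ := by rw [Matrix.conjTranspose_mul, hH]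
      rw [this, Matrix.trace_conjTranspose, Matrix.trace_mul_comm, RCLike.star_def,
        Complex.conj_re]
    rw [Matrix.conjTranspose_sub, Matrix.conjTranspose_conjTranspose, Matrix.mul_sub,
      Matrix.trace_sub, Complex.sub_re, h1, sub_self]
  have hH1 : (rectDiag t (y - x) * (rectDiag t x)ᴴ)ᴴ = rectDiag t (y - x) * (rectDiag t x)ᴴ := by
    rw [rectDiag_mul_conjTranspose hnt, Matrix.diagonal_conjTranspose]
    congr 1
    ext i
    simp
  have hH2 : ((rectDiag t x)ᴴ * rectDiag t (y - x))ᴴ = (rectDiag t x)ᴴ * rectDiag t (y - x) := by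
    rw [rectDiag_conjTranspose_mul, Matrix.diagonal_conjTranspose]
    congr 1
    ext i
    simp only [Pi.star_apply]
    split_ifs <;> simp
  rw [hyx, Matrix.conjTranspose_add, Matrix.conjTranspose_add, Matrix.mul_add, Matrix.mul_add,
    Matrix.trace_add, Matrix.trace_add, Complex.add_re, Complex.add_re, trace_rectDiag hnt,
    Matrix.conjTranspose_mul, ← Matrix.mul_assoc, hskew _ _ hH1, Matrix.conjTranspose_mul,
    ← Matrix.mul_assoc, Matrix.trace_mul_comm, ← Matrix.mul_assoc, hskew _ _ hH2,
    ← neg_sub, neg_dotProduct, hx.2 a ha]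
  simp

end HDDegree

namespace HDDegree

variable {n t : ℕ}

/-! ### From regular points of `σ⁻¹(S)` to regular points of `S` -/

/-- Let `L` be a linear isometry that preserves `S` and fixes `x`.  If a fixed point of `L` is a
normal translate of a point of `S` near `x`, then that point is also fixed by `L`, since the normal
decomposition is unique near `x`. -/
lemma exists_nhds_fixed {ι : Type} [Fintype ι] {S : Set (ι → ℝ)} (hS : IsRealAlgebraic S)
    {x : ι → ℝ} (hx : x ∈ S) (L : (ι → ℝ) ≃ₗ[ℝ] ι → ℝ) (hL : ∀ z, L z ∈ S ↔ z ∈ S)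
    (hiso : ∀ a b, L a ⬝ᵥ L b = a ⬝ᵥ b) (hLx : L x = x) :
    ∃ O ∈ 𝓝 x, ∀ m ∈ S, m ∈ O → ∀ z, L z = z → z - m ∈ orthVec (tangentSpace S x) → L m = m := by
  obtain ⟨k, f, hfI, -, hfT⟩ := exists_generators hS
  obtain ⟨O, hO, hsep⟩ := eventually_eq_of_sub_mem f x (orthVec (tangentSpace S x))
    fun w hw hw0 => dotProduct_self_eq_zero_real (hw w ((hfT x hx w).2 hw0))
  have hcont : Continuous L := L.toLinearMap.continuous_of_finiteDimensional
  refine ⟨O ∩ L ⁻¹' O, Filter.inter_mem hO (hcont.continuousAt.preimage_mem_nhds (by rwa [hLx])),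
    fun m hm hmO z hz hzm => ?_⟩
  refine hsep (L m) hmO.2 m hmO.1 ?_ fun j => by
    rw [mem_vanishingIdeal.1 (hfI j) m hm, mem_vanishingIdeal.1 (hfI j) _ ((hL m).2 hm)]
  have h1 : z - L m ∈ orthVec (tangentSpace S x) := by
    intro a ha
    have h2 := map_mem_tangentSpace (S' := S) L.symm.toLinearMap
      (fun z hz => (hL _).1 (by simpa using hz)) ha
    have h3 : L.symm x = x := by rw [LinearEquiv.symm_apply_eq, hLx]
    rw [LinearEquiv.coe_coe, h3] at h2
    have h4 := hzm _ h2
    rwa [← hiso, map_sub, hz, L.apply_symm_apply] at h4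
  have h5 := sub_mem hzm h1
  rwa [sub_sub_sub_cancel_left] at h5

lemma exists_nhds_fixed_matrix {M : Set (Matrix (Fin n) (Fin t) ℂ)}
    (hM : IsRealAlgebraic (realCoords n t '' M)) {X : Matrix (Fin n) (Fin t) ℂ} (hX : X ∈ M)
    (e : Matrix (Fin n) (Fin t) ℂ ≃ₗ[ℝ] Matrix (Fin n) (Fin t) ℂ) (heM : ∀ A, e A ∈ M ↔ A ∈ M)
    (hiso : ∀ A B, (Matrix.trace (e A * (e B)ᴴ)).re = (Matrix.trace (A * Bᴴ)).re) (heX : e X = X) :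
    ∃ O ∈ 𝓝 (realCoords n t X), ∀ A ∈ M, realCoords n t A ∈ O → ∀ Z, e Z = Z →
      realCoords n t Z - realCoords n t A ∈
        orthVec (tangentSpace (realCoords n t '' M) (realCoords n t X)) → e A = A := by
  obtain ⟨O, hO, h⟩ := exists_nhds_fixed hM (x := realCoords n t X) ⟨X, hX, rfl⟩
    ((realCoords n t).symm.trans (e.trans (realCoords n t)))
    (fun z => by
      obtain ⟨A, rfl⟩ := (realCoords n t).surjective z
      simp only [LinearEquiv.trans_apply, LinearEquiv.symm_apply_apply,
        (realCoords n t).injective.mem_set_image, heM])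
    (fun a b => by
      obtain ⟨A, rfl⟩ := (realCoords n t).surjective a
      obtain ⟨B, rfl⟩ := (realCoords n t).surjective b
      simp only [LinearEquiv.trans_apply, LinearEquiv.symm_apply_apply, realCoords_dotProduct,
        hiso])
    (by simp only [LinearEquiv.trans_apply, LinearEquiv.symm_apply_apply, heX])
  refine ⟨O, hO, fun A hA hAO Z hZ hZA => ?_⟩
  have h1 := h _ ⟨A, hA, rfl⟩ hAO (realCoords n t Z)
    (by simp only [LinearEquiv.trans_apply, LinearEquiv.symm_apply_apply, hZ]) hZA
  simpa using h1

/-- Entrywise complex conjugation of matrices. -/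
noncomputable def conjEquiv (n t : ℕ) :
    Matrix (Fin n) (Fin t) ℂ ≃ₗ[ℝ] Matrix (Fin n) (Fin t) ℂ where
  toFun A := A.map (starRingEnd ℂ)
  invFun A := A.map (starRingEnd ℂ)
  map_add' A B := by
    ext i j
    simp
  map_smul' c A := by
    ext i j
    simp
  left_inv A := by
    ext i j
    simp
  right_inv A := by
    ext i j
    simp

lemma conjEquiv_apply (A : Matrix (Fin n) (Fin t) ℂ) (i : Fin n) (j : Fin t) :
    conjEquiv n t A i j = star (A i j) := rfl

lemma conjEquiv_rectDiag (x : Fin n → ℝ) : conjEquiv n t (rectDiag t x) = rectDiag t x := by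
  ext i j
  rw [conjEquiv_apply, rectDiag_apply]
  split_ifs <;> simp

lemma map_conj_mem_unitaryGroup {m : ℕ} {U : Matrix (Fin m) (Fin m) ℂ}
    (hU : U ∈ Matrix.unitaryGroup (Fin m) ℂ) :
    U.map (starRingEnd ℂ) ∈ Matrix.unitaryGroup (Fin m) ℂ := by
  rw [Matrix.mem_unitaryGroup_iff, Matrix.star_eq_conjTranspose]
  have h : (U.map (starRingEnd ℂ))ᴴ = Uᴴ.map (starRingEnd ℂ) := rfl
  rw [h, ← Matrix.map_mul, unitary_mul_conjTranspose hU]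
  simp

lemma conjEquiv_mem_sigmaInv {S : Set (Fin n → ℝ)} {A : Matrix (Fin n) (Fin t) ℂ}
    (hA : A ∈ sigmaInv t S) : conjEquiv n t A ∈ sigmaInv t S := by
  obtain ⟨x, hx, U, hU, V, hV, rfl⟩ := hA
  refine ⟨x, hx, _, map_conj_mem_unitaryGroup hU, _, map_conj_mem_unitaryGroup hV, ?_⟩
  have h : (V.map (starRingEnd ℂ))ᴴ = Vᴴ.map (starRingEnd ℂ) := rfl
  conv_rhs => rw [h, ← conjEquiv_rectDiag x]
  change (U * rectDiag t x * Vᴴ).map (starRingEnd ℂ) =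
    U.map (starRingEnd ℂ) * (rectDiag t x).map (starRingEnd ℂ) * Vᴴ.map (starRingEnd ℂ)
  rw [Matrix.map_mul, Matrix.map_mul]

/-- The matrices fixed by conjugation with a diagonal unitary matrix with distinct entries and by
entrywise complex conjugation are the real diagonal matrices. -/
lemma exists_phases (hnt : n ≤ t) : ∃ U ∈ Matrix.unitaryGroup (Fin n) ℂ,
    ∃ V ∈ Matrix.unitaryGroup (Fin t) ℂ, (∀ x : Fin n → ℝ, U * rectDiag t x * Vᴴ = rectDiag t x) ∧
      ∀ A, U * A * Vᴴ = A → conjEquiv n t A = A → ∃ x : Fin n → ℝ, A = rectDiag t x := by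
  -- the Cayley transform provides distinct numbers of modulus one
  set c : ℕ → ℂ := fun j => (1 + j * Complex.I) / (1 - j * Complex.I) with hc
  have hp : ∀ j : ℕ, (1 + j * Complex.I) ≠ 0 := fun j h => by
    simpa using congrArg Complex.re h
  have hm : ∀ j : ℕ, (1 - j * Complex.I) ≠ 0 := fun j h => by
    simpa using congrArg Complex.re h
  have hstar : ∀ j, star (c j) = (1 - j * Complex.I) / (1 + j * Complex.I) := fun j => by
    simp [hc, sub_eq_add_neg]
  have hunit : ∀ j, c j * star (c j) = 1 := fun j => by
    have := hp j
    have := hm j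
    rw [hstar]
    simp only [hc]
    field_simp
  have hne : ∀ i j, i ≠ j → c i * star (c j) ≠ 1 := fun i j hij h => by
    rw [hstar] at h
    simp only [hc] at h
    rw [div_mul_div_comm, div_eq_one_iff_eq (mul_ne_zero (hm i) (hp j))] at h
    have h4 : ((i : ℂ) - j) * Complex.I = 0 := by linear_combination h / 2
    have h5 : (i : ℂ) - j = 0 := (mul_eq_zero.1 h4).resolve_right Complex.I_ne_zero
    exact hij (by exact_mod_cast sub_eq_zero.1 h5)
  have hD : ∀ m : ℕ, Matrix.diagonal (fun i : Fin m => c i) ∈ Matrix.unitaryGroup (Fin m) ℂ := by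
    intro m
    rw [Matrix.mem_unitaryGroup_iff, Matrix.star_eq_conjTranspose, Matrix.diagonal_conjTranspose,
      Matrix.diagonal_mul_diagonal]
    simp only [Pi.star_apply, hunit, Matrix.diagonal_one]
  have happ : ∀ (A : Matrix (Fin n) (Fin t) ℂ) i j,
      (Matrix.diagonal (fun i : Fin n => c i) * A * (Matrix.diagonal fun j : Fin t => c j)ᴴ) i j
        = c i * star (c j) * A i j := fun A i j => by
    rw [Matrix.diagonal_conjTranspose, Matrix.mul_diagonal, Matrix.diagonal_mul, Pi.star_apply]
    ring
  refine ⟨_, hD n, _, hD t, fun x => ?_, fun A hA hA' => ?_⟩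
  · ext i j
    rw [happ, rectDiag_apply]
    split_ifs with h
    · rw [h, hunit, one_mul]
    · rw [mul_zero]
  · refine ⟨fun i => (A i (Fin.castLE hnt i)).re, ?_⟩
    ext i j
    have h1 := congrFun (congrFun hA i) j
    have h2 := congrFun (congrFun hA' i) j
    rw [happ] at h1
    rw [conjEquiv_apply] at h2
    rw [rectDiag_apply]
    split_ifs with h
    · have : j = Fin.castLE hnt i := Fin.ext h.symm
      subst this
      exact (Complex.conj_eq_iff_re.1 h2).symm
    · have h3 : (c i * star (c j) - 1) * A i j = 0 := by rw [sub_mul, h1, one_mul, sub_self]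
      exact (mul_eq_zero.1 h3).resolve_left (sub_ne_zero.2 (hne _ _ h))

/-- If `diag(x)` is a regular point of `σ⁻¹(S)` then `x` is a regular point of `S`: the normal
decompositions of diagonal matrices near `diag(x)` are fixed by the isometries whose common fixed
points are the diagonal matrices, hence they are normal decompositions for `S`. -/
theorem mem_regularLocus_of_rectDiag (hnt : n ≤ t) {S : Set (Fin n → ℝ)} (hS : IsRealAlgebraic S)
    (hsym : IsAbsolutelySymmetric S) {x : Fin n → ℝ}
    (hx : rectDiag t x ∈ matRegularLocus (sigmaInv t S)) : x ∈ regularLocus S := by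
  have hMalg := isRealAlgebraic_sigmaInv hnt hS hsym
  have hmem : ∀ z : Fin n → ℝ, rectDiag t z ∈ sigmaInv t S ↔ z ∈ S := fun z => by
    have := mem_sigmaInv_iff hnt hS hsym (one_mem _) (one_mem _) z
    rwa [Matrix.one_mul, Matrix.conjTranspose_one, Matrix.mul_one] at this
  have hXM : rectDiag t x ∈ sigmaInv t S := by
    have := hx.1
    rwa [(realCoords n t).injective.mem_set_image] at this
  have hxS : x ∈ S := (hmem x).1 hXM
  obtain ⟨U, hU, V, hV, hUV, hfix⟩ := exists_phases hnt
  obtain ⟨O₁, hO₁, h₁⟩ := exists_nhds_fixed_matrix hMalg hXM (unitaryEquiv hU hV)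
    (fun A => ⟨fun h => by
      have h1 := unitaryEquiv_mem_sigmaInv (unitary_conjTranspose_mem hU)
        (unitary_conjTranspose_mem hV) h
      rw [Matrix.conjTranspose_conjTranspose] at h1
      rwa [← (unitaryEquiv hU hV).symm_apply_apply A], fun h => unitaryEquiv_mem_sigmaInv hU hV h⟩)
    (fun A B => by rw [unitaryEquiv_apply, unitaryEquiv_apply, trace_unitaryEquiv hU hV]) (hUV x)
  obtain ⟨O₂, hO₂, h₂⟩ := exists_nhds_fixed_matrix hMalg hXM (conjEquiv n t)
    (fun A => ⟨fun h => by
      have h1 := conjEquiv_mem_sigmaInv h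
      rwa [← (conjEquiv n t).symm_apply_apply A], conjEquiv_mem_sigmaInv⟩)
    (fun A B => by
      simp only [← realCoords_dotProduct]
      simp [realCoords, dotProduct, conjEquiv_apply])
    (conjEquiv_rectDiag x)
  obtain ⟨K, φ, φ', hφ0, hφ, hφM, hφT⟩ := exists_param_of_mem_regularLocus
    (x := realCoords n t (rectDiag t x)) hx
  rw [← hφ0] at hφT
  refine mem_regularLocus_of_normal hxS fun O hO => ?_
  let P : (RealIdx n t → ℝ) → Fin n → ℝ := fun v i => v (Sum.inl (i, Fin.castLE hnt i))
  have hPc : Continuous P := by fun_prop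
  have hPd : ∀ z : Fin n → ℝ, P (realCoords n t (rectDiag t z)) = z := fun z => by
    ext i
    change (rectDiag t z i (Fin.castLE hnt i)).re = z i
    rw [rectDiag_castLE, if_pos rfl, Complex.ofReal_re]
  have hdc : Continuous fun z : Fin n → ℝ => realCoords n t (rectDiag t z) :=
    ((realCoords n t).toLinearMap ∘ₗ rectDiagL n t).continuous_of_finiteDimensional
  have hO' : O₁ ∩ O₂ ∩ P ⁻¹' O ∈ 𝓝 (φ 0) := by
    rw [hφ0]
    exact Filter.inter_mem (Filter.inter_mem hO₁ hO₂)
      (hPc.continuousAt.preimage_mem_nhds (by rwa [hPd]))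
  have hev := eventually_exists_normal hφ hφM hφT hO'
  rw [hφ0] at hev
  filter_upwards [hdc.continuousAt.eventually hev] with z hz
  obtain ⟨_, ⟨A, hA, rfl⟩, hAO, hzA⟩ := hz
  obtain ⟨m, rfl⟩ := hfix A (h₁ A hA hAO.1.1 _ (hUV z) hzA)
    (h₂ A hA hAO.1.2 _ (conjEquiv_rectDiag z) hzA)
  refine ⟨m, (hmem m).1 hA, ?_, fun a ha => ?_⟩
  · have := hAO.2
    rwa [Set.mem_preimage, hPd] at this
  · have h3 := hzA _ (rectDiag_mem_matTangentSpace (t := t) ha)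
    rwa [← map_sub, LinearEquiv.coe_coe, realCoords_dotProduct, ← rectDiagL_apply,
      ← rectDiagL_apply, ← map_sub, rectDiagL_apply, trace_rectDiag hnt] at h3

/-- HD critical points of a diagonal matrix with simple singular values are diagonal matrices over
ED critical points. -/
theorem exists_edCritical_of_mem_hdCritical (hnt : n ≤ t) {S : Set (Fin n → ℝ)}
    (hS : IsRealAlgebraic S) (hsym : IsAbsolutelySymmetric S) {y : Fin n → ℝ}
    (hy : HasSimpleSquares y) {X : Matrix (Fin n) (Fin t) ℂ}
    (hX : X ∈ hdCritical (sigmaInv t S) (rectDiag t y)) :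
    ∃ x ∈ edCritical S y, X = rectDiag t x := by
  have hXM : X ∈ sigmaInv t S := by
    have := hX.1.1
    rwa [(realCoords n t).injective.mem_set_image] at this
  obtain ⟨h1, h2⟩ := hermitian_of_orth_orbit fun Z W =>
    hX.2 _ (orbit_mem_matTangentSpace hXM Z W)
  obtain ⟨x, rfl⟩ := eq_rectDiag_of_hermitian hnt hy (A := X)
    (by
      rw [Matrix.sub_mul, Matrix.conjTranspose_sub, Matrix.conjTranspose_mul X,
        Matrix.conjTranspose_conjTranspose] at h1
      exact sub_left_injective h1)
    (by
      rw [Matrix.mul_sub, Matrix.conjTranspose_sub, Matrix.conjTranspose_mul _ X,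
        Matrix.conjTranspose_conjTranspose] at h2
      exact sub_left_injective h2)
  refine ⟨x, ⟨mem_regularLocus_of_rectDiag hnt hS hsym hX.1, fun a ha => ?_⟩, rfl⟩
  have h3 := hX.2 _ (rectDiag_mem_matTangentSpace ha)
  rw [← rectDiagL_apply, ← rectDiagL_apply, ← map_sub, rectDiagL_apply, trace_rectDiag hnt,
    ← neg_sub, neg_dotProduct, neg_eq_zero] at h3
  exact h3

end HDDegree

namespace HDDegree

variable {n t : ℕ}

/-! ### Critical points of generic data -/

lemma rectDiag_injective (hnt : n ≤ t) : Function.Injective (rectDiag t : (Fin n → ℝ) → _) := by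
  intro x y h
  ext i
  have := congrFun (congrFun h i) (Fin.castLE hnt i)
  simpa [rectDiag_castLE] using this

/-- Matrices whose singular values lie in a closed set form a closed set, by compactness of the
unitary groups. -/
lemma isClosed_svd (hnt : n ≤ t) {K : Set (Fin n → ℝ)} (hK : IsClosed K) :
    IsClosed (X := Matrix (Fin n) (Fin t) ℂ) {A | ∃ U ∈ Matrix.unitaryGroup (Fin n) ℂ,
      ∃ V ∈ Matrix.unitaryGroup (Fin t) ℂ, ∃ z ∈ K, A = U * rectDiag t z * Vᴴ} := by
  let f : (Matrix.unitaryGroup (Fin n) ℂ × Matrix.unitaryGroup (Fin t) ℂ) ×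
      Matrix (Fin n) (Fin t) ℂ → Matrix (Fin n) (Fin t) ℂ := fun q =>
    (q.1.1 : Matrix (Fin n) (Fin n) ℂ)ᴴ * q.2 * (q.1.2 : Matrix (Fin t) (Fin t) ℂ)
  have hf : Continuous f := by fun_prop
  have hKd : IsClosed (rectDiag t '' K) :=
    ((rectDiagL n t).isClosedEmbedding_of_injective (LinearMap.ker_eq_bot.2
      (rectDiag_injective hnt))).isClosedMap K hK
  convert isClosedMap_snd_of_compactSpace _ (hKd.preimage hf) using 1
  ext A
  constructor
  · rintro ⟨U, hU, V, hV, z, hz, rfl⟩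
    exact ⟨((⟨U, hU⟩, ⟨V, hV⟩), U * rectDiag t z * Vᴴ), ⟨z, hz,
      ((unitaryEquiv hU hV).symm_apply_apply (rectDiag t z)).symm⟩, rfl⟩
  · rintro ⟨⟨⟨⟨U, hU⟩, ⟨V, hV⟩⟩, A⟩, ⟨z, hz, hzA⟩, rfl⟩
    refine ⟨U, hU, V, hV, z, hz, ?_⟩
    rw [hzA]
    exact ((unitaryEquiv hU hV).apply_symm_apply _).symm

/-- If `y` has simple squares and `S` is tangent, at every critical point of `y`, to the reflection
hyperplanes through the point, then the HD critical points of `U diag(y) V^*` are the matrices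
`U diag(x) V^*` over the ED critical points `x` of `y`. -/
theorem hdCritical_eq (hnt : n ≤ t) {S : Set (Fin n → ℝ)} (hS : IsRealAlgebraic S)
    (hsym : IsAbsolutelySymmetric S) {y : Fin n → ℝ} (hy : HasSimpleSquares y)
    (hcomp : ∀ x ∈ edCritical S y, ∀ a ∈ tangentSpace S x, IsCompatible x a)
    {U : Matrix (Fin n) (Fin n) ℂ} (hU : U ∈ Matrix.unitaryGroup (Fin n) ℂ)
    {V : Matrix (Fin t) (Fin t) ℂ} (hV : V ∈ Matrix.unitaryGroup (Fin t) ℂ) :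
    hdCritical (sigmaInv t S) (U * rectDiag t y * Vᴴ) =
      {X | ∃ x ∈ edCritical S y, X = U * rectDiag t x * Vᴴ} := by
  ext X
  constructor
  · intro hX
    have h := unitary_mem_hdCritical (unitary_conjTranspose_mem hU)
      (unitary_conjTranspose_mem hV) hX
    rw [Matrix.conjTranspose_conjTranspose] at h
    have e : Uᴴ * (U * rectDiag t y * Vᴴ) * V = rectDiag t y :=
      (unitaryEquiv hU hV).symm_apply_apply _
    rw [e] at h
    obtain ⟨x, hx, hXx⟩ := exists_edCritical_of_mem_hdCritical hnt hS hsym hy h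
    refine ⟨x, hx, ?_⟩
    rw [← hXx]
    exact ((unitaryEquiv hU hV).apply_symm_apply X).symm
  · rintro ⟨x, hx, rfl⟩
    exact unitary_mem_hdCritical hU hV (rectDiag_mem_hdCritical hnt hS hsym hx (hcomp x hx))

/-- The counts of critical points on `σ⁻¹(S)` and on `S` agree. -/
lemma encard_hdCritical (hnt : n ≤ t) {S : Set (Fin n → ℝ)} (hS : IsRealAlgebraic S)
    (hsym : IsAbsolutelySymmetric S) {y : Fin n → ℝ} (hy : HasSimpleSquares y)
    (hcomp : ∀ x ∈ edCritical S y, ∀ a ∈ tangentSpace S x, IsCompatible x a)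
    {U : Matrix (Fin n) (Fin n) ℂ} (hU : U ∈ Matrix.unitaryGroup (Fin n) ℂ)
    {V : Matrix (Fin t) (Fin t) ℂ} (hV : V ∈ Matrix.unitaryGroup (Fin t) ℂ) :
    (hdCritical (sigmaInv t S) (U * rectDiag t y * Vᴴ)).encard = (edCritical S y).encard := by
  have himg : hdCritical (sigmaInv t S) (U * rectDiag t y * Vᴴ) =
      (fun x => U * rectDiag t x * Vᴴ) '' edCritical S y := by
    rw [hdCritical_eq hnt hS hsym hy hcomp hU hV]
    ext X
    exact ⟨fun ⟨x, hx, h⟩ => ⟨x, hx, h.symm⟩, fun ⟨x, hx, h⟩ => ⟨x, hx, h.symm⟩⟩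
  rw [himg]
  exact Function.Injective.encard_image
    ((unitaryEquiv hU hV).injective.comp (rectDiag_injective hnt)) _

/-- A nonzero polynomial has a multiple, invariant under signed permutations, that lifts to
matrices. -/
lemma exists_symmetrization (hnt : n ≤ t) {D : MvPolynomial (Fin n) ℝ} (hD : D ≠ 0) :
    ∃ (E : MvPolynomial (Fin n) ℝ) (Q : MvPolynomial (RealIdx n t) ℝ), E ≠ 0 ∧
      (∀ z : Fin n → ℝ, MvPolynomial.aeval z E ≠ 0 → MvPolynomial.aeval z D ≠ 0) ∧
      ∀ U ∈ Matrix.unitaryGroup (Fin n) ℂ, ∀ V ∈ Matrix.unitaryGroup (Fin t) ℂ, ∀ z : Fin n → ℝ,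
        MvPolynomial.aeval (realCoords n t (U * rectDiag t z * Vᴴ)) Q
          = MvPolynomial.aeval z E := by
  choose c hc using exists_comp_signedPerm D
  obtain ⟨Q, hQ⟩ := exists_lift_prod (t := t) hnt D
  refine ⟨∏ g : (Fin n → ℤˣ) × Equiv.Perm (Fin n), c g.1 g.2, Q, ?_, fun z hz h => hz ?_,
    fun U hU V hV z => ?_⟩
  · refine Finset.prod_ne_zero_iff.2 fun g _ h0 => hD ?_
    obtain ⟨ε, π, -, hr⟩ := exists_signedPerm_inv g.1 g.2
    refine MvPolynomial.funext fun w => ?_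
    have h1 := hc g.1 g.2 (signedPerm ε π w)
    rw [h0, map_zero, hr] at h1
    rw [map_zero, ← MvPolynomial.aeval_eq_eval]
    exact h1.symm
  · rw [map_prod]
    refine Finset.prod_eq_zero (Finset.mem_univ ((1, 1) : (Fin n → ℤˣ) × Equiv.Perm (Fin n))) ?_
    rw [hc, ← h]
    congr 2
    ext i
    simp [signedPerm]
  · rw [hQ U hU V hV, map_prod]
    simp only [hc]

/-- Generic data: outside a hypersurface invariant under signed permutations, `y` has simple squares
and lies off the discriminant, and `S` is at each critical point of `y` tangent to all the
reflection hyperplanes that contain the point. -/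
lemma exists_generic_lift (hnt : n ≤ t) {S : Set (Fin n → ℝ)} (hS : IsRealAlgebraic S) :
    ∃ (E : MvPolynomial (Fin n) ℝ) (Q : MvPolynomial (RealIdx n t) ℝ), E ≠ 0 ∧
      (∀ y : Fin n → ℝ, MvPolynomial.aeval y E ≠ 0 → HasSimpleSquares y ∧ y ∉ edDiscriminant S ∧
        ∀ x ∈ edCritical S y, ∀ a ∈ tangentSpace S x, IsCompatible x a) ∧
      ∀ U ∈ Matrix.unitaryGroup (Fin n) ℂ, ∀ V ∈ Matrix.unitaryGroup (Fin t) ℂ, ∀ z : Fin n → ℝ,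
        MvPolynomial.aeval (realCoords n t (U * rectDiag t z * Vᴴ)) Q
          = MvPolynomial.aeval z E := by
  classical
  let l : (Fin n × Fin n) × ℤˣ → Fin n → ℝ := fun s =>
    Pi.single s.1.1 1 - (((s.2 : ℤ) : ℝ)) • Pi.single s.1.2 1
  have hl : ∀ i j e v, l ((i, j), e) ⬝ᵥ v = v i - ((e : ℤ) : ℝ) * v j := fun i j e v => by
    simp [l, sub_dotProduct]
  obtain ⟨D, hD, hgen⟩ := exists_generic_polynomial hS l
  obtain ⟨F, hF⟩ := exists_simple_polynomial n
  have hF0 : F ≠ 0 := by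
    rintro rfl
    obtain ⟨z, hz⟩ := exists_hasSimpleSquares n
    exact (hF z).2 hz (map_zero _)
  obtain ⟨E, Q, hE, hED, hQ⟩ := exists_symmetrization (t := t) hnt (mul_ne_zero hD hF0)
  refine ⟨E, Q, hE, fun y hy => ?_, hQ⟩
  have h1 := hED y hy
  rw [map_mul] at h1
  obtain ⟨hcount, htr⟩ := hgen y (left_ne_zero_of_mul h1)
  refine ⟨(hF y).1 (right_ne_zero_of_mul h1), not_not_intro hcount, fun x hx a ha i j => ?_⟩
  have key : ∀ e : ℤˣ, x i = ((e : ℤ) : ℝ) * x j → a i = ((e : ℤ) : ℝ) * a j := fun e he => by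
    by_contra hne
    refine htr ((i, j), e) ⟨x, hx, ?_, a, ha, ?_⟩
    · rw [hl, he, sub_self]
    · rwa [hl, sub_ne_zero]
  exact ⟨by simpa using key 1, by simpa using key (-1)⟩

/-- The count of critical points is finite and constant near generic data. -/
lemma notMem_hdDiscriminant (hnt : n ≤ t) {S : Set (Fin n → ℝ)} (hS : IsRealAlgebraic S)
    (hsym : IsAbsolutelySymmetric S) {E : MvPolynomial (Fin n) ℝ}
    {Q : MvPolynomial (RealIdx n t) ℝ}
    (hE : ∀ y : Fin n → ℝ, MvPolynomial.aeval y E ≠ 0 → HasSimpleSquares y ∧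
      y ∉ edDiscriminant S ∧ ∀ x ∈ edCritical S y, ∀ a ∈ tangentSpace S x, IsCompatible x a)
    (hQ : ∀ U ∈ Matrix.unitaryGroup (Fin n) ℂ, ∀ V ∈ Matrix.unitaryGroup (Fin t) ℂ,
      ∀ z : Fin n → ℝ, MvPolynomial.aeval (realCoords n t (U * rectDiag t z * Vᴴ)) Q
          = MvPolynomial.aeval z E) {Y : Matrix (Fin n) (Fin t) ℂ}
    (hY : MvPolynomial.aeval (realCoords n t Y) Q ≠ 0) :
    Y ∉ hdDiscriminant (sigmaInv t S) := by
  have hcard : ∀ U ∈ Matrix.unitaryGroup (Fin n) ℂ, ∀ V ∈ Matrix.unitaryGroup (Fin t) ℂ,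
      ∀ z : Fin n → ℝ, MvPolynomial.aeval (realCoords n t (U * rectDiag t z * Vᴴ)) Q ≠ 0 →
      (hdCritical (sigmaInv t S) (U * rectDiag t z * Vᴴ)).encard = (edCritical S z).encard := by
    intro U hU V hV z hz
    rw [hQ U hU V hV] at hz
    exact encard_hdCritical hnt hS hsym (hE z hz).1 (hE z hz).2.2 hU hV
  have hlc : ∀ z : Fin n → ℝ, MvPolynomial.aeval z E ≠ 0 →
      ∃ k : ℕ, ∀ᶠ w in 𝓝 z, (edCritical S w).encard = k := fun z hz =>
    not_not.1 (hE z hz).2.1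
  obtain ⟨U₀, hU₀, V₀, hV₀, y₀, hY₀⟩ := exists_svd hnt Y
  have hy₀ : MvPolynomial.aeval y₀ E ≠ 0 := by rwa [← hQ U₀ hU₀ V₀ hV₀, ← hY₀]
  obtain ⟨k, hk⟩ := hlc y₀ hy₀
  have hNY : (hdCritical (sigmaInv t S) Y).encard = k := by
    rw [hY₀, hcard U₀ hU₀ V₀ hV₀ y₀ (by rwa [← hY₀]), hk.self_of_nhds]
  refine not_not_intro ⟨k, ?_⟩
  have hcl : IsClosed (interior {z : Fin n → ℝ | (edCritical S z).encard = k})ᶜ :=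
    isOpen_interior.isClosed_compl
  -- the singular values of `Y` have count `k` in a neighbourhood, in whatever order and with
  -- whatever signs they are written
  have hmem : Y ∉ {A : Matrix (Fin n) (Fin t) ℂ | ∃ U ∈ Matrix.unitaryGroup (Fin n) ℂ,
      ∃ V ∈ Matrix.unitaryGroup (Fin t) ℂ,
        ∃ z ∈ (interior {z : Fin n → ℝ | (edCritical S z).encard = k})ᶜ,
          A = U * rectDiag t z * Vᴴ} := by
    rintro ⟨U, hU, V, hV, z, hz, hYz⟩
    rw [hYz] at hY hNY
    rw [hcard U hU V hV z hY] at hNY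
    rw [hQ U hU V hV] at hY
    obtain ⟨k', hk'⟩ := hlc z hY
    rw [hk'.self_of_nhds] at hNY
    rw [hNY] at hk'
    exact hz (mem_interior_iff_mem_nhds.2 hk')
  have hopen : ∀ᶠ Z in 𝓝 Y, MvPolynomial.aeval (realCoords n t Z) Q ≠ 0 :=
    ((continuous_aeval Q).comp
      (realCoords n t).toLinearMap.continuous_of_finiteDimensional).continuousAt.eventually_ne hY
  filter_upwards [(isClosed_svd hnt hcl).isOpen_compl.mem_nhds hmem, hopen] with Z hZ hZQ
  obtain ⟨U, hU, V, hV, z, rfl⟩ := exists_svd hnt Z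
  rw [hcard U hU V hV z hZQ]
  by_contra hne
  exact hZ ⟨U, hU, V, hV, z, fun h =>
    hne (interior_subset (s := {z : Fin n → ℝ | (edCritical S z).encard = k}) h), rfl⟩

end HDDegree

open HDDegree in
theorem theorem3 (n t : ℕ) (hnt : n ≤ t) (S : Set (Fin n → ℝ))
    (hS : IsRealAlgebraic S) (hsym : IsAbsolutelySymmetric S) :
    -- the induced set `M = σ⁻¹(S)` is a real variety
    IsRealAlgebraic (realCoords n t '' sigmaInv t S) ∧
    -- generic data: singular value decomposition, description of the critical points, and
    -- equality of the (finite, locally constant) counts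
    (∃ Ω : Set (Matrix (Fin n) (Fin t) ℂ),
      IsSemialgebraic (realCoords n t '' Ω) ∧ IsOpen Ω ∧ Dense Ω ∧
      ∀ Y ∈ Ω,
        Y ∉ hdDiscriminant (sigmaInv t S) ∧
        (∃ U ∈ Matrix.unitaryGroup (Fin n) ℂ, ∃ V ∈ Matrix.unitaryGroup (Fin t) ℂ,
          ∃ y : Fin n → ℝ, Y = U * rectDiag t y * Vᴴ) ∧
        ∀ U ∈ Matrix.unitaryGroup (Fin n) ℂ, ∀ V ∈ Matrix.unitaryGroup (Fin t) ℂ,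
          ∀ y : Fin n → ℝ, Y = U * rectDiag t y * Vᴴ →
            hdCritical (sigmaInv t S) Y =
              {X | ∃ x ∈ edCritical S y, X = U * rectDiag t x * Vᴴ} ∧
            y ∉ edDiscriminant S ∧
            hdDegAt (sigmaInv t S) Y = realEDdegAt S y) ∧
    -- equality of the degrees, as sets of chamberwise values
    hdDeg (sigmaInv t S) = realEDdeg S := by
  obtain ⟨E, Q, hE0, hE, hQ⟩ := exists_generic_lift (t := t) hnt hS
  have hcard : ∀ U ∈ Matrix.unitaryGroup (Fin n) ℂ, ∀ V ∈ Matrix.unitaryGroup (Fin t) ℂ,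
      ∀ y : Fin n → ℝ, MvPolynomial.aeval y E ≠ 0 →
      hdDegAt (sigmaInv t S) (U * rectDiag t y * Vᴴ) = realEDdegAt S y := fun U hU V hV y hy => by
    rw [hdDegAt, realEDdegAt, Set.ncard_def, Set.ncard_def,
      encard_hdCritical hnt hS hsym (hE y hy).1 (hE y hy).2.2 hU hV]
  have hcont : Continuous fun Y : Matrix (Fin n) (Fin t) ℂ =>
      MvPolynomial.aeval (realCoords n t Y) Q :=
    (continuous_aeval Q).comp (realCoords n t).toLinearMap.continuous_of_finiteDimensional
  obtain ⟨y₀, hy₀⟩ : ∃ y : Fin n → ℝ, MvPolynomial.aeval y E ≠ 0 := by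
    by_contra! h
    exact hE0 (MvPolynomial.funext fun w => by rw [map_zero]; exact h w)
  have hdenseE : Dense {y : Fin n → ℝ | MvPolynomial.aeval y E ≠ 0} := dense_aeval_ne_zero hy₀
  have hone : ∀ y : Fin n → ℝ, rectDiag t y = (1 : Matrix (Fin n) (Fin n) ℂ) * rectDiag t y *
      (1 : Matrix (Fin t) (Fin t) ℂ)ᴴ := fun y => by
    rw [Matrix.one_mul, Matrix.conjTranspose_one, Matrix.mul_one]
  have hdense :
      Dense {Y : Matrix (Fin n) (Fin t) ℂ | MvPolynomial.aeval (realCoords n t Y) Q ≠ 0} := by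
    have h1 : Dense {v : RealIdx n t → ℝ | MvPolynomial.aeval v Q ≠ 0} :=
      dense_aeval_ne_zero (v₀ := realCoords n t (rectDiag t y₀)) (by
        rwa [hone, hQ 1 (one_mem _) 1 (one_mem _)])
    exact h1.preimage (realCoords n t).toContinuousLinearEquiv.isOpenMap
  refine ⟨isRealAlgebraic_sigmaInv hnt hS hsym,
    ⟨{Y | MvPolynomial.aeval (realCoords n t Y) Q ≠ 0}, ?_, isOpen_ne_fun hcont continuous_const,
      hdense, fun Y hY => ⟨notMem_hdDiscriminant hnt hS hsym hE hQ hY, exists_svd hnt Y, ?_⟩⟩, ?_⟩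
  · have : realCoords n t '' {Y | MvPolynomial.aeval (realCoords n t Y) Q ≠ 0}
        = {v | MvPolynomial.aeval v Q ≠ 0} := by
      ext v
      obtain ⟨A, rfl⟩ := (realCoords n t).surjective v
      exact (realCoords n t).injective.mem_set_image
    rw [this]
    exact (IsSemialgebraic.polyFun_eq (mem_polyFun.2 ⟨Q, fun _ => rfl⟩) (polyFun_const 0)).not
  · rintro U hU V hV y rfl
    have hy : MvPolynomial.aeval y E ≠ 0 := by
      rw [← hQ U hU V hV]
      exact hY
    exact ⟨hdCritical_eq hnt hS hsym (hE y hy).1 (hE y hy).2.2 hU hV, (hE y hy).2.1,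
      hcard U hU V hV y hy⟩
  · ext d
    constructor
    · rintro ⟨Y, hY, rfl⟩
      obtain ⟨k, hk⟩ := not_not.1 hY
      obtain ⟨Y', hY', hY'k⟩ := hdense.inter_nhds_nonempty hk
      have hdeg : hdDegAt (sigmaInv t S) Y = hdDegAt (sigmaInv t S) Y' :=
        congrArg ENat.toNat (hk.self_of_nhds.trans hY'k.symm)
      obtain ⟨U, hU, V, hV, y, rfl⟩ := exists_svd hnt Y'
      have hy : MvPolynomial.aeval y E ≠ 0 := by
        rw [← hQ U hU V hV]
        exact hY'
      exact ⟨y, (hE y hy).2.1, by rw [hdeg, hcard U hU V hV y hy]⟩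
    · rintro ⟨y, hy, rfl⟩
      obtain ⟨k, hk⟩ := not_not.1 hy
      obtain ⟨y', hy', hy'k⟩ := hdenseE.inter_nhds_nonempty hk
      have hdeg : realEDdegAt S y = realEDdegAt S y' :=
        congrArg ENat.toNat (hk.self_of_nhds.trans hy'k.symm)
      refine ⟨rectDiag t y', notMem_hdDiscriminant hnt hS hsym hE hQ ?_, ?_⟩
      · rwa [hone, hQ 1 (one_mem _) 1 (one_mem _)]
      · rw [hone, hcard 1 (one_mem _) 1 (one_mem _) y' hy', hdeg]
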